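/- Let $d\ge 1$, $\gamma\in\mathbb R\setminus\{0\}$, and let $Z$ be the self-interacting dyadic branching Brownian motion in $\mathbb R^d$ with unit-time branching: $Z_0$ is a single particle at the origin; at each integer time $m\ge1$ every particle is replaced by two particles starting at its position; and on $[m,m+1)$ the $2^m$ particles solve $$Z^i_{m+\tau}=Z^i_m+B^{m,i}_\tau+\frac{\gamma}{2^m}\int_0^\tau\sum_{j=1}^{2^m}\bigl(Z^j_{m+s}-Z^i_{m+s}\bigr)\,ds,\qquad 0\le\tau<1,\ i=1,\dots,2^m,$$ where the $B^{m,i}$ are independent standard $d$-dimensional Brownian motions started at $0$. Write $n_t=2^{\lfloor t\rfloor}$, $\overline Z_t=\frac1{n_t}\sum_{i\le n_t}Z^i_t$ for the center of mass, and $Y^i_t=Z^i_t-\overline Z_t$ for the system viewed from its center of mass. By a branching Ornstein–Uhlenbeck process with parameter $\gamma$ we mean the following: one particle starts at the origin; at each integer time $m\ge 1$ every particle is replaced by two at its position; on $[m,m+1)$ the $2^m$ particles solve $dY^i=dW^{m,i}-\gamma Y^i\,dt$, where $(W^{m,i})_{i\le 2^m}$ are jointly Gaussian continuous centered processes with $E[W^{m,i,k}_sW^{m,j,l}_{t}]=\delta_{kl}(\delta_{ij}-2^{-m})\min(s,t)$,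 independent for different $m$. Then: (a) $\overline Z_t$ converges almost surely, as $t\to\infty$, to a random vector $N\sim\mathcal N(0,2I_d)$. (b) The process $Y$ is independent of $N$, and even of the pair $(\overline Z,N)$, where $\overline Z=(\overline Z_t)_{t\ge0}$. It is a branching Ornstein–Uhlenbeck process with parameter $\gamma$, and each of its particles is on $[m,m+1)$ a diffusion (with respect to the history of $Y$, in the sense of the martingale problem for $C_c^\infty$ test functions) with generator $$\tfrac12\sigma_m\Delta-\gamma x\cdot\nabla,\qquad\sigma_m=1-2^{-m}.$$ As $m\to\infty$ these generators converge pointwise on $C_c^\infty(\mathbb R^d)$ to the Ornstein–Uhlenbeck operator $\frac12\Delta-\gamma x\cdot\nabla$. (c) Let $P^x=P(\cdot\mid N=x)$ be any regular version of the conditional probability. For almost all $x$ with respect to the law of $N$, under $P^x$: $\overline Z_t\to x$ almost surely; $Z_t=\overline Z_t\oplus Y_t$, i.e. $Z^i_t=\overline Z_t+Y^i_t$ with the processes $\overline Z$ and $Y$ independent; $Y$ has the same law as under $P$, and is a branching Ornstein–Uhlenbeck process as in (b), with the same generators; and $\max_{i\le n_t}|Z^i_t-(x+Y^i_t)|\to0$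 almost surely, i.e. $Z$ behaves asymptotically as $Y$ with the origin shifted to $x$. -/

import Mathlib

open MeasureTheory ProbabilityTheory Filter Topology
open scoped NNReal ENNReal

/-- The state space `ℝᵈ` with its Euclidean norm. -/
abbrev Space (d : ℕ) : Type := EuclideanSpace ℝ (Fin d)

/-- The number `n_t = 2 ^ ⌊t⌋` of particles alive at time `t ≥ 0`. -/
noncomputable def numParticles (t : ℝ) : ℕ := 2 ^ ⌊t⌋₊

/-!
A particle system is a map `X : ℝ → ℕ → Ω → Space d`, where `X t i ω` is the position at time `t`
of the `i`-th particle. Only `t ≥ 0` and `i < numParticles t` are meaningful.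
At every integer time each particle `i` is replaced by the two particles `2 i` and `2 i + 1`.
-/

section Systems

variable {Ω : Type*} [MeasurableSpace Ω] {d : ℕ}

/-- A system of particles in `ℝᵈ` which starts with a single particle at the origin, moves
continuously between integer times, and undergoes dyadic fission at the times `1, 2, 3, …`:
both children start where their parent has been just before the fission. -/
structure IsDyadicSystem (X : ℝ → ℕ → Ω → Space d) (P : Measure Ω) : Prop where
  measurable : ∀ t : ℝ, 0 ≤ t → ∀ i < numParticles t, Measurable (X t i)
  start : ∀ᵐ ω ∂P, X 0 0 ω = 0
  continuous : ∀ᵐ ω ∂P, ∀ m : ℕ, ∀ i < 2 ^ m,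
    ContinuousOn (fun t => X t i ω) (Set.Ico (m : ℝ) (m + 1))
  fission : ∀ᵐ ω ∂P, ∀ m : ℕ, ∀ i < 2 ^ (m + 1),
    Tendsto (fun t => X t (i / 2) ω) (𝓝[<] ((m : ℝ) + 1)) (𝓝 (X ((m : ℝ) + 1) i ω))

/-- The noise of the self-interacting system: for every generation `m` and every particle `i` of
that generation a standard `d`-dimensional Brownian motion `B m i` started at the origin,
independent of all the others. -/
structure IsIndependentNoise (B : (m : ℕ) → Fin (2 ^ m) → ℝ≥0 → Ω → Space d)
    (P : Measure Ω) : Prop where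
  measurable : ∀ m i τ, Measurable (B m i τ)
  brownian : ∀ m i (k : Fin d), IsBrownianReal (fun τ ω => B m i τ ω k) P
  indep : iIndepFun (fun (a : (Σ m : ℕ, Fin (2 ^ m)) × Fin d) ω (τ : ℝ≥0) =>
    B a.1.1 a.1.2 τ ω a.2) P

/-- `Z` is the self-interacting dyadic branching Brownian motion with interaction parameter `γ`,
driven by the noise `B`. On `[m, m + 1)` the `2 ^ m` particles solve
`Z_{m+τ}^i = Z_m^i + B_τ^{m,i} + (γ / 2 ^ m) ∫_0^τ ∑_j (Z_{m+s}^j - Z_{m+s}^i) ds`. -/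
structure IsSelfInteractingBBM (γ : ℝ) (B : (m : ℕ) → Fin (2 ^ m) → ℝ≥0 → Ω → Space d)
    (Z : ℝ → ℕ → Ω → Space d) (P : Measure Ω) : Prop extends IsDyadicSystem Z P where
  noise : IsIndependentNoise B P
  sde : ∀ᵐ ω ∂P, ∀ (m : ℕ) (i : Fin (2 ^ m)) (τ : ℝ≥0), τ < 1 →
    Z (m + τ) i ω = Z m i ω + B m i τ ω
      + (γ / 2 ^ m) • ∫ s in (0 : ℝ)..τ, ∑ j : Fin (2 ^ m), (Z (m + s) j ω - Z (m + s) i ω)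

/-- The center of mass of the system at time `t`. -/
noncomputable def centerOfMass (X : ℝ → ℕ → Ω → Space d) (t : ℝ) (ω : Ω) : Space d :=
  (numParticles t : ℝ)⁻¹ • ∑ i ∈ Finset.range (numParticles t), X t i ω

/-- The system viewed from its center of mass. -/
noncomputable def relativeSystem (X : ℝ → ℕ → Ω → Space d) (t : ℝ) (i : ℕ) (ω : Ω) : Space d :=
  X t i ω - centerOfMass X t ω

/-- The whole trajectory of the center of mass over the times `t ≥ 0`. -/
noncomputable def centerPath (X : ℝ → ℕ → Ω → Space d) (ω : Ω) : ℝ≥0 → Space d :=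
  fun t => centerOfMass X t ω

/-- The whole trajectory of the system: at each time `t ≥ 0` the positions of all the particles
alive at that time. -/
def systemPath (X : ℝ → ℕ → Ω → Space d) (ω : Ω) :
    (t : ℝ≥0) → Fin (numParticles t) → Space d :=
  fun t i => X t i ω

/-- `σ_m = 1 - 2 ^ (-m)`. -/
noncomputable def sigmaOU (m : ℕ) : ℝ := 1 - (2 ^ m : ℝ)⁻¹

/-- The `2 ^ m × 2 ^ m` matrix with entries `1 - 2 ^ (-m)` on the diagonal and `- 2 ^ (-m)` off
the diagonal. -/
noncomputable def centeringMatrix (m : ℕ) : Matrix (Fin (2 ^ m)) (Fin (2 ^ m)) ℝ :=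
  Matrix.of fun i j => (if i = j then 1 else 0) - (2 ^ m : ℝ)⁻¹

/-- `W` is a family `(W^i)_{i ∈ ι}` of `d`-dimensional Brownian motions started at the origin,
with correlations `E[W_s^{i,k} W_t^{j,l}] = min s t * C i j * δ_{kl}`. -/
structure IsCorrelatedBrownian {ι : Type*} (C : Matrix ι ι ℝ) (W : ι → ℝ≥0 → Ω → Space d)
    (P : Measure Ω) : Prop where
  measurable : ∀ i τ, Measurable (W i τ)
  gaussian : IsGaussianProcess (fun (a : ℝ≥0 × ι × Fin d) ω => W a.2.1 a.1 ω a.2.2) P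
  mean : ∀ i t k, ∫ ω, W i t ω k ∂P = 0
  covariance : ∀ (i j : ι) (s t : ℝ≥0) (k l : Fin d),
    ∫ ω, W i s ω k * W j t ω l ∂P = min (s : ℝ) t * C i j * (if k = l then 1 else 0)
  continuous : ∀ᵐ ω ∂P, ∀ i, Continuous (fun t => W i t ω)

/-- `Y` is the (correlated) dyadic branching Ornstein–Uhlenbeck process with parameter `γ`, started
with one particle at the origin: on `[m, m + 1)` the particles solve `dY^i = dW^{m,i} - γ Y^i dt`,
where the driving Brownian motions `W^{m,i}` (of variance `σ_m τ` per coordinate at time `τ`) have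
correlations given by the centering matrix and are independent for different `m`. -/
structure IsBranchingOU (γ : ℝ) (Y : ℝ → ℕ → Ω → Space d) (P : Measure Ω) : Prop
    extends IsDyadicSystem Y P where
  sde : ∃ W : (m : ℕ) → Fin (2 ^ m) → ℝ≥0 → Ω → Space d,
    (∀ m, IsCorrelatedBrownian (centeringMatrix m) (W m) P) ∧
    iIndepFun (fun (m : ℕ) ω (i : Fin (2 ^ m)) (τ : ℝ≥0) => W m i τ ω) P ∧
    ∀ᵐ ω ∂P, ∀ (m : ℕ) (i : Fin (2 ^ m)) (τ : ℝ≥0), τ < 1 →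
      Y (m + τ) i ω = Y m i ω + W m i τ ω - γ • ∫ s in (0 : ℝ)..τ, Y (m + s) i ω

/-- The Ornstein–Uhlenbeck operator `(1/2) σ Δ - γ x ⬝ ∇`. -/
noncomputable def generatorOU (σ γ : ℝ) (f : Space d → ℝ) (x : Space d) : ℝ :=
  1 / 2 * σ * Laplacian.laplacian f x - γ * inner ℝ x (gradient f x)

/-- The σ-algebra generated by the system up to time `t`. -/
abbrev history (X : ℝ → ℕ → Ω → Space d) (t : ℝ) : MeasurableSpace Ω :=
  ⨆ (s : ℝ) (_ : 0 ≤ s ∧ s ≤ t) (i : ℕ) (_ : i < numParticles s),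
    MeasurableSpace.comap (X s i) inferInstance

/-- On the time interval `[a, b)` the `i`-th particle of the system is a diffusion with generator
`L`, in the sense of the martingale problem: for every test function `f` the process
`f(X_t^i) - f(X_a^i) - ∫_a^t L f(X_u^i) du` has martingale increments with respect to the history
of the whole system. -/
def HasGeneratorOn (L : (Space d → ℝ) → Space d → ℝ) (X : ℝ → ℕ → Ω → Space d) (i : ℕ)
    (a b : ℝ) (P : Measure Ω) : Prop :=
  ∀ f : Space d → ℝ, ContDiff ℝ (⊤ : ℕ∞) f → HasCompactSupport f →
    ∀ s t : ℝ, a ≤ s → s ≤ t → t < b →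
      Integrable (fun ω => f (X t i ω) - f (X s i ω) - ∫ u in s..t, L f (X u i ω)) P ∧
      ∀ A : Set Ω, MeasurableSet[history X s] A →
        ∫ ω in A, (f (X t i ω) - f (X s i ω) - ∫ u in s..t, L f (X u i ω)) ∂P = 0

/-- `κ x` is a regular version of the conditional probability `P(· | N = x)`. -/
def IsRegularCondProb (N : Ω → Space d) (P : Measure Ω) (κ : Kernel (Space d) Ω) : Prop :=
  IsMarkovKernel κ ∧ (P.map N).compProd κ = P.map (fun ω => (N ω, ω))

end Systems

/-! Averaging the equations over a generation makes the attractions cancel in pairs, and fission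
does not move the center of mass. So the center is driven by the averages of the Brownian motions
alone: in generation `k` it gains an independent centered Gaussian vector with covariance `2 ^ (-k)`
times the identity (`ae_centerOfMass_natCast`), and these covariances add up to twice the identity.
Doob's inequality and Borel–Cantelli bound the motion within generation `m` by a multiple of `(3 /
4) ^ m`, eventually almost surely. This gives convergence (`ae_exists_tendsto`), and characteristic
functions identify the limit law (`hasLaw_limit`).

After subtraction of the average, the attraction on particle `i` is `-γ Y^i` and its noise is the
deviation of `B^i` from the average (`ae_relativeSystem_eq`). The deviations have the centering
matrix as covariance, a projection that annihilates constants. Hence deviations and averages are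
uncorrelated and, being jointly Gaussian, independent (`indepFun_centeredNoise_meanNoise`). The
explicit solution of the linear equation exhibits `Y` as a function of the deviations up to null
sets, while the center and its limit `N` are functions of the averages; independence carries over.
The σ-algebras `aeCompletion` keep track of the null sets.

The generator is found without stochastic integration. The explicit solution and Taylor's formula
expand `E[f(Y_{r+h}); A]` in `h` with an error of order `h ^ (3/2)` (`exists_ou_step_bound`). This
yields the right derivative in time, and integrating it gives the martingale problem
(`hasGeneratorOn`).

Since the deviations are independent of the averages and `N` jointly, conditioning on `N = x`
changes neither their law nor their independence of the averages (`ae_indep_cond`). One exceptional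
set of `x` suffices because continuous paths are determined by countably many times. Under the
conditional measure `Y` again solves the Ornstein–Uhlenbeck equation, so the generator result
applies to that measure directly. -/

open scoped Matrix

/-! ### Measurability up to null sets -/

section Completion

lemma measurable_limUnder_atTop {Ω E : Type*} {m : MeasurableSpace Ω} [TopologicalSpace E]
    [TopologicalSpace.IsCompletelyMetrizableSpace E] [SecondCountableTopology E] [Nonempty E]
    [MeasurableSpace E] [BorelSpace E] {f : ℕ → Ω → E} (hf : ∀ n, Measurable (f n)) :
    Measurable (fun ω => limUnder atTop (fun n => f n ω)) :=
  (StronglyMeasurable.limUnder fun n => (hf n).stronglyMeasurable).measurable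

variable {Ω : Type*} {m m₁ m₂ : MeasurableSpace Ω} {mΩ : MeasurableSpace Ω} {μ : Measure Ω}

/-- The measurable sets which agree `μ`-almost everywhere with a set of the σ-algebra `m`. -/
@[reducible] def aeCompletion (m : MeasurableSpace Ω) {mΩ : MeasurableSpace Ω}
    (μ : Measure Ω) : MeasurableSpace Ω :=
  eventuallyMeasurableSpace m (ae μ) ⊓ mΩ

lemma measurableSet_aeCompletion {s : Set Ω} : MeasurableSet[aeCompletion m μ] s ↔
    (∃ t, MeasurableSet[m] t ∧ s =ᵐ[μ] t) ∧ MeasurableSet s :=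
  MeasurableSpace.measurableSet_inf

lemma aeCompletion_le : aeCompletion m μ ≤ mΩ := inf_le_right

lemma le_aeCompletion (h : m ≤ mΩ) : m ≤ aeCompletion m μ :=
  le_inf le_eventuallyMeasurableSpace h

lemma aeCompletion_mono (h : m₁ ≤ m₂) : aeCompletion m₁ μ ≤ aeCompletion m₂ μ := by
  intro s hs
  rw [measurableSet_aeCompletion] at hs ⊢
  obtain ⟨⟨t, ht, hst⟩, hs⟩ := hs
  exact ⟨⟨t, h _ ht, hst⟩, hs⟩

lemma aeCompletion_idem : aeCompletion (aeCompletion m μ) μ ≤ aeCompletion m μ := by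
  intro s hs
  rw [measurableSet_aeCompletion] at hs
  obtain ⟨⟨t, ht, hst⟩, hs⟩ := hs
  rw [measurableSet_aeCompletion] at ht ⊢
  obtain ⟨⟨u, hu, htu⟩, ht⟩ := ht
  exact ⟨⟨u, hu, hst.trans htu⟩, hs⟩

lemma measurable_aeCompletion_of_ae_eq {E : Type*} [MeasurableSpace E] {f g : Ω → E}
    (hg : Measurable[aeCompletion m μ] g) (hf : Measurable f) (h : f =ᵐ[μ] g) :
    Measurable[aeCompletion m μ] f := by
  intro s hs
  have := hg hs
  rw [measurableSet_aeCompletion] at this ⊢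
  obtain ⟨⟨t, ht, hst⟩, -⟩ := this
  exact ⟨⟨t, ht, (h.preimage s).trans hst⟩, hf hs⟩

/-- Almost sure limits stay in the completion because `limUnder` is a measurable version of them.
This serves for positions at fission times, for the limit `N`, and for paths sampled at dense times.
-/
lemma measurable_aeCompletion_of_tendsto {E : Type*} [TopologicalSpace E]
    [TopologicalSpace.IsCompletelyMetrizableSpace E] [SecondCountableTopology E] [Nonempty E]
    [MeasurableSpace E] [BorelSpace E] {f : ℕ → Ω → E} {g : Ω → E}
    (hf : ∀ n, Measurable[aeCompletion m μ] (f n)) (hg : Measurable g)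
    (h : ∀ᵐ ω ∂μ, Tendsto (fun n => f n ω) atTop (𝓝 (g ω))) :
    Measurable[aeCompletion m μ] g := by
  have hlim : Measurable[aeCompletion m μ] (fun ω => limUnder atTop (fun n => f n ω)) :=
    measurable_limUnder_atTop hf
  refine measurable_aeCompletion_of_ae_eq hlim hg ?_
  filter_upwards [h] with ω hω
  exact hω.limUnder_eq.symm

/-- Changing sets by null sets changes no probability. Processes that are functions of the noise
only almost surely thus inherit the independence of the noise. -/
lemma Indep.aeCompletion (h : Indep m₁ m₂ μ) :
    Indep (aeCompletion m₁ μ) (aeCompletion m₂ μ) μ := by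
  rw [Indep_iff] at h ⊢
  intro s t hs ht
  rw [measurableSet_aeCompletion] at hs ht
  obtain ⟨⟨s', hs', hss⟩, -⟩ := hs
  obtain ⟨⟨t', ht', htt⟩, -⟩ := ht
  rw [measure_congr hss, measure_congr htt, measure_congr (hss.inter htt), h _ _ hs' ht']

/-- A null set of `μ + ν` is null for both measures, so one representative in `m` serves both. The
lemma is meant for `P` and a conditional measure, which may be mutually singular. -/
lemma measure_eq_of_aeCompletion_add {μ ν : Measure Ω}
    (h : ∀ s, MeasurableSet[m] s → μ s = ν s) {s : Set Ω}
    (hs : MeasurableSet[aeCompletion m (μ + ν)] s) : μ s = ν s := by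
  rw [measurableSet_aeCompletion] at hs
  obtain ⟨⟨t, ht, hst⟩, -⟩ := hs
  have hst' := ae_add_measure_iff.1 hst
  rw [measure_congr hst'.1, measure_congr hst'.2, h t ht]

end Completion

/-! ### Measurability of time integrals -/

section TimeIntegral

variable {Ω : Type*} {E : Type*} [NormedAddCommGroup E] [NormedSpace ℝ E]
  [SecondCountableTopology E] [MeasurableSpace E] [BorelSpace E]

/-- Continuity in time makes the process jointly measurable. The σ-algebra `m` is arbitrary, so that
completed pasts of the noise are allowed. -/
lemma measurable_intervalIntegral_of_continuous {m : MeasurableSpace Ω} {g : ℝ → Ω → E}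
    (hg : ∀ s, Measurable (g s)) (hc : ∀ ω, Continuous (fun s => g s ω)) (a b : ℝ) :
    Measurable (fun ω => ∫ s in a..b, g s ω) := by
  have h := stronglyMeasurable_uncurry_of_continuous_of_stronglyMeasurable
    hc (fun s => (hg s).stronglyMeasurable)
  have h' : StronglyMeasurable (fun p : Ω × ℝ => g p.2 p.1) := h.comp_measurable measurable_swap
  simp only [intervalIntegral]
  exact (h'.integral_prod_right (ν := volume.restrict _)).measurable.sub
    (h'.integral_prod_right (ν := volume.restrict _)).measurable

end TimeIntegral

/-! ### Regular conditional probabilities -/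

section Conditional

lemma MeasurableSpace.exists_countable_piSystem {Ω : Type*} (m : MeasurableSpace Ω)
    [h : @MeasurableSpace.CountablyGenerated Ω m] :
    ∃ S : Set (Set Ω), S.Countable ∧ IsPiSystem S ∧ m = MeasurableSpace.generateFrom S := by
  obtain ⟨b, hb, rfl⟩ := h.isCountablyGenerated
  refine ⟨{s | ∃ F : Set (Set Ω), (F.Finite ∧ F ⊆ b) ∧ ⋂₀ F = s}, ?_, ?_, ?_⟩
  · exact (Set.countable_ofPred_finite_subset hb).image _
  · rintro _ ⟨F, ⟨hF, hFb⟩, rfl⟩ _ ⟨G, ⟨hG, hGb⟩, rfl⟩ -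
    exact ⟨F ∪ G, ⟨hF.union hG, Set.union_subset hFb hGb⟩, Set.sInter_union _ _⟩
  · apply le_antisymm
    · refine MeasurableSpace.generateFrom_mono fun s hs => ⟨{s}, ⟨by simp, by simpa⟩, by simp⟩
    · refine MeasurableSpace.generateFrom_le ?_
      rintro _ ⟨F, ⟨hF, hFb⟩, rfl⟩
      exact @MeasurableSet.sInter _ (_) _ hF.countable
        fun s hs => MeasurableSpace.measurableSet_generateFrom (hFb hs)

variable {Ω : Type*} {m₁ m₂ : MeasurableSpace Ω} [mΩ : MeasurableSpace Ω] {d : ℕ}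
  {P : Measure Ω} [IsProbabilityMeasure P]
  {N : Ω → Space d} {κ : Kernel (Space d) Ω}

lemma IsRegularCondProb.setLIntegral (hN : Measurable N) (hκ : IsRegularCondProb N P κ)
    {C : Set (Space d)} (hC : MeasurableSet C) {A : Set Ω} (hA : MeasurableSet A) :
    ∫⁻ x in C, κ x A ∂(P.map N) = P (N ⁻¹' C ∩ A) := by
  have := hκ.1
  have : IsProbabilityMeasure (P.map N) := Measure.isProbabilityMeasure_map hN.aemeasurable
  rw [← Measure.compProd_apply_prod hC hA, hκ.2, Measure.map_apply (by fun_prop) (hC.prod hA)]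
  rfl

/-- The exceptional set need not be measurable; a measurable null superset has average `κ x`-mass
zero, hence mass zero for almost every `x`. -/
lemma IsRegularCondProb.ae_ae (hN : Measurable N) (hκ : IsRegularCondProb N P κ) {p : Ω → Prop}
    (hp : ∀ᵐ ω ∂P, p ω) : ∀ᵐ x ∂(P.map N), ∀ᵐ ω ∂(κ x), p ω := by
  have h0 : P (toMeasurable P {ω | ¬ p ω}) = 0 := by rw [measure_toMeasurable]; exact hp
  have h := hκ.setLIntegral hN MeasurableSet.univ (measurableSet_toMeasurable P {ω | ¬ p ω})
  rw [Set.preimage_univ, Set.univ_inter, h0, Measure.restrict_univ,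
    lintegral_eq_zero_iff (Kernel.measurable_coe κ (measurableSet_toMeasurable P _))] at h
  filter_upwards [h] with x hx
  exact measure_mono_null (subset_toMeasurable P {ω | ¬ p ω}) hx

lemma IsRegularCondProb.ae_eq (hN : Measurable N) (hκ : IsRegularCondProb N P κ) :
    ∀ᵐ x ∂(P.map N), ∀ᵐ ω ∂(κ x), N ω = x := by
  have := hκ.1
  have : IsProbabilityMeasure (P.map N) := Measure.isProbabilityMeasure_map hN.aemeasurable
  have hm : MeasurableSet {p : Space d × Ω | N p.2 = p.1} :=
    measurableSet_eq_fun (hN.comp measurable_snd) measurable_fst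
  refine Measure.ae_ae_of_ae_compProd (p := fun p : Space d × Ω => N p.2 = p.1) ?_
  rw [hκ.2, ae_map_iff (by fun_prop) hm]
  simp

/-- Independence of `m₂` from `m₁` and `N` jointly factors `P(A ∩ N⁻¹ C ∩ B)` for every `C`, which
identifies `κ x (A ∩ B)` for almost every `x`. The exceptional set depends on `A` and `B`; countable
π-systems that generate the two σ-algebras make it common to all pairs. -/
lemma IsRegularCondProb.ae_indep (hN : Measurable N) (hκ : IsRegularCondProb N P κ)
    (h₁ : m₁ ≤ mΩ) (h₂ : m₂ ≤ mΩ)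
    (c₁ : @MeasurableSpace.CountablyGenerated Ω m₁)
    (c₂ : @MeasurableSpace.CountablyGenerated Ω m₂)
    (hind : Indep (m₁ ⊔ MeasurableSpace.comap N inferInstance) m₂ P) :
    ∀ᵐ x ∂(P.map N), Indep m₁ m₂ (κ x) ∧ ∀ s, MeasurableSet[m₂] s → κ x s = P s := by
  have := hκ.1
  have : IsProbabilityMeasure (P.map N) := Measure.isProbabilityMeasure_map hN.aemeasurable
  obtain ⟨S, hSc, hSp, hS⟩ := MeasurableSpace.exists_countable_piSystem m₁
  obtain ⟨T, hTc, hTp, hT⟩ := MeasurableSpace.exists_countable_piSystem m₂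
  have key : ∀ A, MeasurableSet[m₁] A → ∀ B, MeasurableSet[m₂] B →
      ∀ᵐ x ∂(P.map N), κ x (A ∩ B) = κ x A * P B := by
    intro A hA B hB
    refine ae_eq_of_forall_setLIntegral_eq_of_sigmaFinite
      (Kernel.measurable_coe κ ((h₁ _ hA).inter (h₂ _ hB)))
      ((Kernel.measurable_coe κ (h₁ _ hA)).mul_const _) fun C hC _ => ?_
    rw [lintegral_mul_const _ (Kernel.measurable_coe κ (h₁ _ hA)),
      hκ.setLIntegral hN hC (h₁ _ hA), hκ.setLIntegral hN hC ((h₁ _ hA).inter (h₂ _ hB)),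
      ← Set.inter_assoc]
    refine (Indep_iff _ _ _).1 hind _ _ ?_ hB
    refine @MeasurableSet.inter _ (_) _ _ ?_ ?_
    · exact (le_sup_right : _ ≤ m₁ ⊔ MeasurableSpace.comap N inferInstance) _ ⟨C, hC, rfl⟩
    · exact (le_sup_left : _ ≤ m₁ ⊔ MeasurableSpace.comap N inferInstance) _ hA
  have hSm : ∀ A ∈ S, MeasurableSet[m₁] A := fun A hA => by
    rw [hS]; exact MeasurableSpace.measurableSet_generateFrom hA
  have hTm : ∀ B ∈ T, MeasurableSet[m₂] B := fun B hB => by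
    rw [hT]; exact MeasurableSpace.measurableSet_generateFrom hB
  have e1 : ∀ᵐ x ∂(P.map N), ∀ A ∈ S, ∀ B ∈ T, κ x (A ∩ B) = κ x A * P B :=
    (ae_ball_iff hSc).2 fun A hA => (ae_ball_iff hTc).2 fun B hB => key A (hSm A hA) B (hTm B hB)
  have e2 : ∀ᵐ x ∂(P.map N), ∀ B ∈ T, κ x B = P B :=
    (ae_ball_iff hTc).2 fun B hB => by
      filter_upwards [key Set.univ (@MeasurableSet.univ _ m₁) B (hTm B hB)] with x hx
      simpa using hx
  filter_upwards [e1, e2] with x hx1 hx2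
  have hlaw : ∀ s, MeasurableSet[m₂] s → κ x s = P s := by
    -- Trimming to `m₂` is what allows the uniqueness theorem, since the π-system `T` generates `m₂`
    -- and not the ambient σ-algebra.
    intro s hs
    have := ext_of_generate_finite (μ := (κ x).trim h₂) (ν := P.trim h₂) T hT hTp
      (fun B hB => by
        rw [trim_measurableSet_eq h₂ (hTm B hB), trim_measurableSet_eq h₂ (hTm B hB), hx2 B hB])
      (by rw [trim_measurableSet_eq h₂ (@MeasurableSet.univ _ m₂),
            trim_measurableSet_eq h₂ (@MeasurableSet.univ _ m₂)]; simp)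
    rw [← trim_measurableSet_eq h₂ hs, this, trim_measurableSet_eq h₂ hs]
  refine ⟨?_, hlaw⟩
  refine IndepSets.indep h₁ h₂ hSp hTp hS hT ?_
  rw [IndepSets_iff]
  intro A B hA hB
  rw [hx1 A hA B hB, hlaw B (hTm B hB)]

end Conditional

/-! ### Joint Gaussianity of families of processes -/

section GaussianFamilies

variable {Ω : Type*} {mΩ : MeasurableSpace Ω} {P : Measure Ω}

/-- A family of finite linear combinations of a Gaussian process is a Gaussian process. -/
lemma ProbabilityTheory.IsGaussianProcess.of_sum {T S : Type*} {X : T → Ω → ℝ} {Y : S → Ω → ℝ}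
    (hX : IsGaussianProcess X P)
    (h : ∀ s, ∃ I : Finset T, ∃ c : T → ℝ, ∀ ω, Y s ω = ∑ t ∈ I, c t * X t ω) :
    IsGaussianProcess Y P := by
  refine hX.of_isGaussianProcess fun s => ?_
  obtain ⟨I, c, hc⟩ := h s
  refine ⟨I, ∑ t : I, c t • ContinuousLinearMap.proj (R := ℝ) (φ := fun _ : I => ℝ) t,
    fun ω => ?_⟩
  rw [hc, sum_apply, ← Finset.sum_coe_sort]
  simp

/-- Independent Gaussian processes are jointly Gaussian. -/
lemma ProbabilityTheory.iIndepFun.isGaussianProcess_sigma {T : Type*} {S : T → Type*}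
    {X : (t : T) → S t → Ω → ℝ} (hX : ∀ t, IsGaussianProcess (X t) P)
    (hind : iIndepFun (fun t ω s => X t s ω) P) :
    IsGaussianProcess (fun p : (t : T) × S t => X p.1 p.2) P := by
  classical
  constructor
  intro I
  -- A finite set of indices meets finitely many processes, each at finitely many indices. These
  -- independent Gaussian marginals form a Gaussian vector, from which `L` reads off the coordinates
  -- in `I`.
  let A : Finset T := I.image Sigma.fst
  let J : (t : T) → Finset (S t) := fun t =>
    I.preimage (Sigma.mk t) (fun _ _ _ _ h => eq_of_heq (Sigma.mk.inj h).2)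
  have h1 : HasGaussianLaw (fun ω (a : A) => (J a).restrict (X a · ω)) P := by
    refine iIndepFun.hasGaussianLaw (fun a : A => (hX a).hasGaussianLaw (J a)) ?_
    have h2 := hind.precomp (Subtype.val_injective : Function.Injective ((↑) : A → T))
    exact h2.comp (fun a : A => (J a).restrict) (fun a => by fun_prop)
  have hA : ∀ p : I, p.1.1 ∈ A := fun p => Finset.mem_image_of_mem _ p.2
  have hJ : ∀ p : I, p.1.2 ∈ J p.1.1 := fun p => Finset.mem_preimage.2 p.2
  let L : ((a : A) → J a → ℝ) →L[ℝ] (I → ℝ) :=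
    ContinuousLinearMap.pi fun p =>
      (ContinuousLinearMap.proj (R := ℝ) (φ := fun _ : J p.1.1 => ℝ) ⟨p.1.2, hJ p⟩).comp
        (ContinuousLinearMap.proj (R := ℝ) (φ := fun a : A => J a → ℝ) ⟨p.1.1, hA p⟩)
  exact h1.map_fun L

end GaussianFamilies

/-! ### The average noise and the centered noise -/

section Noise

variable {Ω : Type*} {d : ℕ} {B : (m : ℕ) → Fin (2 ^ m) → ℝ≥0 → Ω → Space d}

/-- A linear combination of the Brownian motions of generation `m`. -/
noncomputable def noiseComb (B : (m : ℕ) → Fin (2 ^ m) → ℝ≥0 → Ω → Space d) (m : ℕ)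
    (c : Fin (2 ^ m) → ℝ) (τ : ℝ≥0) (ω : Ω) : Space d :=
  ∑ j, c j • B m j τ ω

lemma noiseComb_apply (m : ℕ) (c : Fin (2 ^ m) → ℝ) (τ : ℝ≥0) (ω : Ω) (k : Fin d) :
    noiseComb B m c τ ω k = ∑ j, c j * B m j τ ω k := by
  simp [noiseComb]

lemma continuous_noiseComb {m : ℕ} {c : Fin (2 ^ m) → ℝ} {ω : Ω}
    (h : ∀ j, Continuous fun τ => B m j τ ω) : Continuous fun τ => noiseComb B m c τ ω := by
  simp only [noiseComb]
  fun_prop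

/-- The average of the Brownian motions of generation `m`. -/
noncomputable def meanNoise (B : (m : ℕ) → Fin (2 ^ m) → ℝ≥0 → Ω → Space d) (m : ℕ) :
    ℝ≥0 → Ω → Space d :=
  noiseComb B m fun _ => (2 ^ m : ℝ)⁻¹

/-- The deviations of the Brownian motions of generation `m` from their average. -/
noncomputable def centeredNoise (B : (m : ℕ) → Fin (2 ^ m) → ℝ≥0 → Ω → Space d) (m : ℕ)
    (i : Fin (2 ^ m)) : ℝ≥0 → Ω → Space d :=
  noiseComb B m (centeringMatrix m i)

lemma centeredNoise_eq (m : ℕ) (i : Fin (2 ^ m)) (τ : ℝ≥0) (ω : Ω) :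
    centeredNoise B m i τ ω = B m i τ ω - meanNoise B m τ ω := by
  simp [centeredNoise, meanNoise, noiseComb, centeringMatrix, sub_smul, Finset.sum_sub_distrib]

/-- The centering matrix is an orthogonal projection, so it is its own Gram matrix. This makes it
the covariance of the centered noise. -/
lemma sum_centeringMatrix_mul (m : ℕ) (i j : Fin (2 ^ m)) :
    ∑ l, centeringMatrix m i l * centeringMatrix m j l = centeringMatrix m i j := by
  simp only [centeringMatrix, Matrix.of_apply, sub_mul, mul_sub, Finset.sum_sub_distrib]
  simp [eq_comm (a := j)]

/-- The projection annihilates constant vectors. This is the source of the independence of `Y` from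
the center of mass. -/
lemma sum_centeringMatrix (m : ℕ) (i : Fin (2 ^ m)) :
    ∑ l, centeringMatrix m i l * (2 ^ m : ℝ)⁻¹ = 0 := by
  simp [centeringMatrix, sub_mul, Finset.sum_sub_distrib]

lemma measurable_coords {X : Ω → Space d} {m : MeasurableSpace Ω}
    (h : ∀ k, Measurable (fun ω => X ω k)) : Measurable X :=
  (WithLp.measurable_toLp 2 (Fin d → ℝ)).comp (measurable_pi_lambda _ h)

variable [mΩ : MeasurableSpace Ω] {P : Measure Ω}

lemma IsIndependentNoise.isGaussianProcess_coord (hB : IsIndependentNoise B P) (m : ℕ)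
    (i : Fin (2 ^ m)) (k : Fin d) : IsGaussianProcess (fun τ ω => B m i τ ω k) P := by
  have hX := hB.brownian m i k
  exact hX.isGaussianProcess

lemma IsIndependentNoise.isGaussianProcess (hB : IsIndependentNoise B P) :
    IsGaussianProcess (fun (p : (_ : (Σ m : ℕ, Fin (2 ^ m)) × Fin d) × ℝ≥0) ω =>
      B p.1.1.1 p.1.1.2 p.2 ω p.1.2) P :=
  iIndepFun.isGaussianProcess_sigma
    (X := fun (a : (Σ m : ℕ, Fin (2 ^ m)) × Fin d) (τ : ℝ≥0) ω => B a.1.1 a.1.2 τ ω a.2)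
    (fun a => (hB.isGaussianProcess_coord a.1.1 a.1.2 a.2)) hB.indep

lemma IsIndependentNoise.covariance (hB : IsIndependentNoise B P)
    (a b : (Σ m : ℕ, Fin (2 ^ m)) × Fin d) (s t : ℝ≥0) :
    cov[fun ω => B a.1.1 a.1.2 s ω a.2, fun ω => B b.1.1 b.1.2 t ω b.2; P] =
      if a = b then min (s : ℝ) t else 0 := by
  split_ifs with h
  · subst h
    rw [(hB.brownian a.1.1 a.1.2 a.2).covariance_fun_eval]
    simp
  · have h1 := (hB.indep.indepFun h).comp (measurable_pi_apply s) (measurable_pi_apply t)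
    exact h1.covariance_eq_zero
      ((hB.isGaussianProcess_coord a.1.1 a.1.2 a.2).hasGaussianLaw_eval s).memLp_two
      ((hB.isGaussianProcess_coord b.1.1 b.1.2 b.2).hasGaussianLaw_eval t).memLp_two

lemma IsIndependentNoise.memLp (hB : IsIndependentNoise B P) (m : ℕ) (j : Fin (2 ^ m)) (k : Fin d)
    (τ : ℝ≥0) : MemLp (fun ω => B m j τ ω k) 2 P :=
  ((hB.isGaussianProcess_coord m j k).hasGaussianLaw_eval τ).memLp_two

lemma IsIndependentNoise.isProbabilityMeasure (hB : IsIndependentNoise B P) :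
    IsProbabilityMeasure P :=
  hB.isGaussianProcess.isProbabilityMeasure

/-- Indexing by all generations and all coefficient vectors at once makes the centered and the
average noises jointly Gaussian, as is needed to pass from zero covariance to independence. -/
lemma IsIndependentNoise.isGaussianProcess_noiseComb (hB : IsIndependentNoise B P) :
    IsGaussianProcess (fun (p : (Σ m : ℕ, Fin (2 ^ m) → ℝ) × ℝ≥0 × Fin d) ω =>
      noiseComb B p.1.1 p.1.2 p.2.1 ω p.2.2) P := by
  classical
  refine hB.isGaussianProcess.of_sum ?_
  rintro ⟨⟨m, c⟩, τ, k⟩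
  let e : Fin (2 ^ m) → (_ : (Σ m : ℕ, Fin (2 ^ m)) × Fin d) × ℝ≥0 := fun j => ⟨(⟨m, j⟩, k), τ⟩
  have he : Function.Injective e := by
    intro i j h
    simpa [e] using h
  refine ⟨Finset.univ.image e, fun p => if h : p.1.1.1 = m then c (h ▸ p.1.1.2) else 0,
    fun ω => ?_⟩
  rw [Finset.sum_image (fun _ _ _ _ h => he h), noiseComb_apply]
  simp [e]

lemma IsIndependentNoise.covariance_noiseComb (hB : IsIndependentNoise B P) (m : ℕ)
    (c c' : Fin (2 ^ m) → ℝ) (s t : ℝ≥0) (k l : Fin d) :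
    cov[fun ω => noiseComb B m c s ω k, fun ω => noiseComb B m c' t ω l; P] =
      min (s : ℝ) t * (∑ j, c j * c' j) * (if k = l then 1 else 0) := by
  simp_rw [noiseComb_apply]
  have : IsProbabilityMeasure P := hB.isGaussianProcess.isProbabilityMeasure
  rw [covariance_fun_sum_fun_sum (fun j => (hB.memLp m j k s).const_mul (c j))
    (fun j => (hB.memLp m j l t).const_mul (c' j))]
  simp_rw [covariance_const_mul_left, covariance_const_mul_right]
  have h := fun i j => hB.covariance (⟨m, i⟩, k) (⟨m, j⟩, l) s t
  simp only at h
  simp_rw [h]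
  by_cases hkl : k = l
  · subst hkl
    simp [Finset.mul_sum]
    exact Finset.sum_congr rfl fun j _ => by ring
  · simp [hkl]

lemma IsIndependentNoise.covariance_noiseComb_of_ne (hB : IsIndependentNoise B P) {m n : ℕ}
    (hmn : m ≠ n) (c : Fin (2 ^ m) → ℝ) (c' : Fin (2 ^ n) → ℝ) (s t : ℝ≥0) (k l : Fin d) :
    cov[fun ω => noiseComb B m c s ω k, fun ω => noiseComb B n c' t ω l; P] = 0 := by
  simp_rw [noiseComb_apply]
  have : IsProbabilityMeasure P := hB.isGaussianProcess.isProbabilityMeasure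
  rw [covariance_fun_sum_fun_sum (fun j => (hB.memLp m j k s).const_mul (c j))
    (fun j => (hB.memLp n j l t).const_mul (c' j))]
  simp_rw [covariance_const_mul_left, covariance_const_mul_right]
  have h := fun i j => hB.covariance (⟨m, i⟩, k) (⟨n, j⟩, l) s t
  simp only at h
  simp_rw [h]
  simp [hmn]

lemma IsIndependentNoise.integral_noiseComb (hB : IsIndependentNoise B P) (m : ℕ)
    (c : Fin (2 ^ m) → ℝ) (s : ℝ≥0) (k : Fin d) :
    ∫ ω, noiseComb B m c s ω k ∂P = 0 := by
  simp_rw [noiseComb_apply]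
  have : IsProbabilityMeasure P := hB.isGaussianProcess.isProbabilityMeasure
  rw [integral_finsetSum _ fun j _ => ((hB.memLp m j k s).integrable (by simp)).const_mul (c j)]
  simp_rw [integral_const_mul]
  exact Finset.sum_eq_zero fun j _ => by rw [(hB.brownian m j k).integral_eval, mul_zero]

lemma IsIndependentNoise.measurable_noiseComb (hB : IsIndependentNoise B P) (m : ℕ)
    (c : Fin (2 ^ m) → ℝ) (s : ℝ≥0) : Measurable (noiseComb B m c s) :=
  Finset.measurable_sum _ fun j _ => (hB.measurable m j s).const_smul (c j)

lemma IsIndependentNoise.continuous (hB : IsIndependentNoise B P) :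
    ∀ᵐ ω ∂P, ∀ m j, Continuous (fun τ => B m j τ ω) := by
  simp only [ae_all_iff]
  intro m j
  have h : ∀ᵐ ω ∂P, ∀ k, Continuous (fun τ => B m j τ ω k) :=
    ae_all_iff.2 fun k => (hB.brownian m j k).cont
  filter_upwards [h] with ω hω
  have : (fun τ => B m j τ ω) = fun τ => WithLp.toLp 2 (fun k => B m j τ ω k) := rfl
  rw [this]
  exact (PiLp.continuous_toLp 2 _).comp (continuous_pi hω)

lemma IsIndependentNoise.isCorrelatedBrownian_centeredNoise (hB : IsIndependentNoise B P)
    (m : ℕ) : IsCorrelatedBrownian (centeringMatrix m) (centeredNoise B m) P where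
  measurable i τ := hB.measurable_noiseComb _ _ _
  gaussian := hB.isGaussianProcess_noiseComb.comp_right
    fun a : ℝ≥0 × Fin (2 ^ m) × Fin d => (⟨m, centeringMatrix m a.2.1⟩, a.1, a.2.2)
  mean i t k := hB.integral_noiseComb _ _ _ _
  covariance i j s t k l := by
    have : IsProbabilityMeasure P := hB.isGaussianProcess.isProbabilityMeasure
    have h := hB.covariance_noiseComb m (centeringMatrix m i) (centeringMatrix m j) s t k l
    have hL : ∀ i s k, MemLp (fun ω => noiseComb B m (centeringMatrix m i) s ω k) 2 P :=
      fun i s k => (hB.isGaussianProcess_noiseComb.hasGaussianLaw_eval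
        (⟨m, centeringMatrix m i⟩, s, k)).memLp_two
    rw [covariance_eq_sub (hL i s k) (hL j t l), hB.integral_noiseComb, zero_mul, sub_zero,
      sum_centeringMatrix_mul] at h
    exact h
  continuous := by
    filter_upwards [hB.continuous] with ω hω i
    exact continuous_noiseComb (hω m)

lemma IsIndependentNoise.iIndepFun_centeredNoise (hB : IsIndependentNoise B P) :
    iIndepFun (fun (m : ℕ) ω (i : Fin (2 ^ m)) (τ : ℝ≥0) => centeredNoise B m i τ ω) P := by
  have h : iIndepFun (fun (m : ℕ) ω (p : Fin (2 ^ m) × ℝ≥0 × Fin d) =>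
      centeredNoise B m p.1 p.2.1 ω p.2.2) P := by
    refine IsGaussianProcess.iIndepFun_of_covariance_eq_zero
      (X := fun (m : ℕ) (p : Fin (2 ^ m) × ℝ≥0 × Fin d) ω => centeredNoise B m p.1 p.2.1 ω p.2.2)
      (hB.isGaussianProcess_noiseComb.comp_right
        fun a : (m : ℕ) × (Fin (2 ^ m) × ℝ≥0 × Fin d) =>
          (⟨a.1, centeringMatrix a.1 a.2.1⟩, a.2.2.1, a.2.2.2))
      (fun m p => ?_) (fun m n hmn p q => hB.covariance_noiseComb_of_ne hmn _ _ _ _ _ _)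
    exact (hB.isGaussianProcess_noiseComb.hasGaussianLaw_eval
      (⟨m, centeringMatrix m p.1⟩, p.2)).aemeasurable
  exact h.comp (fun (m : ℕ) (x : Fin (2 ^ m) × ℝ≥0 × Fin d → ℝ) (i : Fin (2 ^ m)) (τ : ℝ≥0) =>
      (WithLp.toLp 2 (fun k => x (i, τ, k)) : Space d)) fun m => by
    refine measurable_pi_lambda _ fun i => measurable_pi_lambda _ fun τ => ?_
    exact measurable_coords fun k => measurable_pi_apply _

/-- For jointly Gaussian families it is enough that covariances vanish: within a generation because
the rows of the centering matrix sum to zero, across generations because the Brownian motions are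
independent. -/
lemma IsIndependentNoise.indepFun_centeredNoise_meanNoise (hB : IsIndependentNoise B P) :
    IndepFun (fun ω (p : (Σ m : ℕ, Fin (2 ^ m)) × ℝ≥0) => centeredNoise B p.1.1 p.1.2 p.2 ω)
      (fun ω (p : ℕ × ℝ≥0) => meanNoise B p.1 p.2 ω) P := by
  have h : IndepFun
      (fun ω (p : (Σ m : ℕ, Fin (2 ^ m)) × ℝ≥0 × Fin d) =>
        centeredNoise B p.1.1 p.1.2 p.2.1 ω p.2.2)
      (fun ω (p : ℕ × ℝ≥0 × Fin d) => meanNoise B p.1 p.2.1 ω p.2.2) P := by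
    refine IsGaussianProcess.indepFun_of_covariance_eq_zero
      (X := fun (p : (Σ m : ℕ, Fin (2 ^ m)) × ℝ≥0 × Fin d) ω =>
        centeredNoise B p.1.1 p.1.2 p.2.1 ω p.2.2)
      (Y := fun (p : ℕ × ℝ≥0 × Fin d) ω => meanNoise B p.1 p.2.1 ω p.2.2) ?_ ?_ ?_ ?_
    · refine (hB.isGaussianProcess_noiseComb.comp_right
        (Sum.elim (fun p : (Σ m : ℕ, Fin (2 ^ m)) × ℝ≥0 × Fin d =>
            ((⟨p.1.1, centeringMatrix p.1.1 p.1.2⟩ : Σ m : ℕ, Fin (2 ^ m) → ℝ), p.2))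
          (fun p : ℕ × ℝ≥0 × Fin d => (⟨p.1, fun _ => (2 ^ p.1 : ℝ)⁻¹⟩, p.2)))).congr ?_
      rintro (p | p) <;> exact Eventually.of_forall fun _ => rfl
    · exact fun p => (hB.isGaussianProcess_noiseComb.hasGaussianLaw_eval
        (⟨p.1.1, centeringMatrix p.1.1 p.1.2⟩, p.2)).aemeasurable
    · exact fun p => (hB.isGaussianProcess_noiseComb.hasGaussianLaw_eval
        (⟨p.1, fun _ => (2 ^ p.1 : ℝ)⁻¹⟩, p.2)).aemeasurable
    · rintro ⟨⟨m, i⟩, s, k⟩ ⟨n, t, l⟩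
      by_cases hmn : m = n
      · subst hmn
        refine (hB.covariance_noiseComb m _ _ s t k l).trans ?_
        rw [sum_centeringMatrix]
        simp
      · exact hB.covariance_noiseComb_of_ne hmn _ _ _ _ _ _
  refine h.comp
    (φ := fun (x : (Σ m : ℕ, Fin (2 ^ m)) × ℝ≥0 × Fin d → ℝ)
      (p : (Σ m : ℕ, Fin (2 ^ m)) × ℝ≥0) =>
        (WithLp.toLp 2 (fun k => x (p.1, p.2, k)) : Space d))
    (ψ := fun (x : ℕ × ℝ≥0 × Fin d → ℝ) (p : ℕ × ℝ≥0) =>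
      (WithLp.toLp 2 (fun k => x (p.1, p.2, k)) : Space d)) ?_ ?_ <;>
  exact measurable_pi_lambda _ fun p => measurable_coords fun k => measurable_pi_apply _

end Noise

/-! ### Variation of constants for the Ornstein–Uhlenbeck equation -/

section LinearEquation

variable {E : Type*} [NormedAddCommGroup E] [NormedSpace ℝ E] [CompleteSpace E]

/-- Since `w` is not differentiable, the integrating factor is applied to `y - w = y₀ - γ ∫ y`,
which is. The resulting expression, corrected by the integral of `exp (γ r) • w r`, has derivative
zero. -/
lemma linear_equation_solution_of_continuous {y w : ℝ → E} {γ τ : ℝ} (hy : Continuous y)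
    (hw : Continuous w) {y₀ : E} (hτ : 0 ≤ τ)
    (h : ∀ s ∈ Set.Icc 0 τ, y s = y₀ + w s - γ • ∫ r in (0 : ℝ)..s, y r) :
    y τ = Real.exp (-(γ * τ)) • (y₀ - γ • ∫ s in (0 : ℝ)..τ, Real.exp (γ * s) • w s) + w τ := by
  have hE : ∀ s, HasDerivAt (fun s => Real.exp (γ * s)) (Real.exp (γ * s) * γ) s := fun s => by
    simpa using ((hasDerivAt_id s).const_mul γ).exp
  have hew : Continuous fun s => Real.exp (γ * s) • w s := by fun_prop
  have hG : ∀ s, HasDerivAt (fun s => Real.exp (γ * s) • (y₀ - γ • ∫ r in (0 : ℝ)..s, y r)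
      + γ • ∫ r in (0 : ℝ)..s, Real.exp (γ * r) • w r)
      (Real.exp (γ * s) • (-(γ • y s)) +
        (Real.exp (γ * s) * γ) • (y₀ - γ • ∫ r in (0 : ℝ)..s, y r)
        + γ • (Real.exp (γ * s) • w s)) s := fun s =>
    ((hE s).smul (((hy.integral_hasStrictDerivAt 0 s).hasDerivAt.const_smul γ).const_sub y₀)).add
      ((hew.integral_hasStrictDerivAt 0 s).hasDerivAt.const_smul γ)
  have h0 := constant_of_has_deriv_right_zero (a := 0) (b := τ)
    (fun s _ => (hG s).continuousAt.continuousWithinAt) (fun s hs => by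
      have := (hG s).hasDerivWithinAt (s := Set.Ici s)
      convert this using 1
      rw [h s ⟨hs.1, hs.2.le⟩]
      module) τ ⟨hτ, le_rfl⟩
  simp only [mul_zero, Real.exp_zero, one_smul, intervalIntegral.integral_same, smul_zero,
    sub_zero, add_zero] at h0
  rw [h τ ⟨hτ, le_rfl⟩, sub_eq_of_eq_add h0.symm]
  have he : Real.exp (-(γ * τ)) * Real.exp (γ * τ) = 1 := by rw [← Real.exp_add]; simp
  rw [smul_smul, he, one_smul]
  abel

/-- The solution of `dy = dw - γ y dt`. -/
lemma linear_equation_solution {y w : ℝ → E} {γ T : ℝ} (hy : ContinuousOn y (Set.Ico 0 T))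
    (hw : Continuous w) {y₀ : E}
    (h : ∀ s ∈ Set.Ico 0 T, y s = y₀ + w s - γ • ∫ r in (0 : ℝ)..s, y r) {τ : ℝ}
    (hτ : τ ∈ Set.Ico 0 T) :
    y τ = Real.exp (-(γ * τ)) • (y₀ - γ • ∫ s in (0 : ℝ)..τ, Real.exp (γ * s) • w s) + w τ := by
  have hmem : ∀ s, max 0 (min s τ) ∈ Set.Ico 0 T := fun s =>
    ⟨le_max_left _ _, max_lt (hτ.1.trans_lt hτ.2) ((min_le_right _ _).trans_lt hτ.2)⟩
  have heq : ∀ s ∈ Set.Icc 0 τ, max 0 (min s τ) = s := fun s hs => by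
    rw [min_eq_left hs.2, max_eq_right hs.1]
  -- Clamping time to `[0, τ]` extends `y` to a continuous function on the line without altering the
  -- equation there.
  have := linear_equation_solution_of_continuous (y := fun s => y (max 0 (min s τ))) (w := w)
    (γ := γ) (y₀ := y₀) (hy.comp_continuous (by fun_prop) hmem) hw hτ.1 (fun s hs => by
      rw [heq s hs, h s ⟨hs.1, hs.2.trans_lt hτ.2⟩]
      congr 2
      refine intervalIntegral.integral_congr fun r hr => ?_
      rw [Set.uIcc_of_le hs.1] at hr
      rw [heq r ⟨hr.1, hr.2.trans hs.2⟩])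
  simpa [hτ.1] using this

end LinearEquation

/-! ### The center of mass within a generation and across fissions -/

section CenterOfMass

variable {Ω : Type*} {d : ℕ} {X : ℝ → ℕ → Ω → Space d}

lemma numParticles_of_mem_Ico {m : ℕ} {t : ℝ} (ht : t ∈ Set.Ico (m : ℝ) (m + 1)) :
    numParticles t = 2 ^ m := by
  rw [numParticles, (Nat.floor_eq_iff (m.cast_nonneg.trans ht.1)).2 ht]

lemma numParticles_natCast (m : ℕ) : numParticles m = 2 ^ m := by simp [numParticles]

lemma centerOfMass_of_mem_Ico {m : ℕ} {t : ℝ} (ht : t ∈ Set.Ico (m : ℝ) (m + 1)) (ω : Ω) :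
    centerOfMass X t ω = (2 ^ m : ℝ)⁻¹ • ∑ i : Fin (2 ^ m), X t i ω := by
  rw [centerOfMass, numParticles_of_mem_Ico ht, Finset.sum_range]
  simp

lemma natCast_mem_Ico (m : ℕ) : (m : ℝ) ∈ Set.Ico (m : ℝ) (m + 1) := ⟨le_rfl, by linarith⟩

lemma add_mem_Ico (m : ℕ) {τ : ℝ} (h0 : 0 ≤ τ) (h1 : τ < 1) :
    (m : ℝ) + τ ∈ Set.Ico (m : ℝ) (m + 1) := ⟨by linarith, by linarith⟩

lemma mem_Ico_floor {t : ℝ} (ht : 0 ≤ t) :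
    t ∈ Set.Ico (⌊t⌋₊ : ℝ) (⌊t⌋₊ + 1) := ⟨Nat.floor_le ht, Nat.lt_floor_add_one t⟩

lemma sum_range_two_mul_div {M : Type*} [AddCommMonoid M] (g : ℕ → M) (n : ℕ) :
    ∑ i ∈ Finset.range (2 * n), g (i / 2) = 2 • ∑ i ∈ Finset.range n, g i := by
  induction n with
  | zero => simp
  | succ n ih =>
    rw [Finset.sum_range_succ, smul_add, ← ih, mul_add, mul_one, Finset.sum_range_succ,
      Finset.sum_range_succ, show 2 * n / 2 = n by omega, show (2 * n + 1) / 2 = n by omega,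
      two_smul, add_assoc]

lemma continuousOn_centerOfMass {m : ℕ} {ω : Ω} (h : ∀ i < 2 ^ m,
    ContinuousOn (fun t => X t i ω) (Set.Ico (m : ℝ) (m + 1))) :
    ContinuousOn (fun t => centerOfMass X t ω) (Set.Ico (m : ℝ) (m + 1)) := by
  have : ContinuousOn (fun t => (2 ^ m : ℝ)⁻¹ • ∑ i : Fin (2 ^ m), X t i ω)
      (Set.Ico (m : ℝ) (m + 1)) :=
    ContinuousOn.fun_const_smul
      (continuousOn_finsetSum _ fun (i : Fin (2 ^ m)) _ => h i i.2) _
  exact this.congr fun t ht => centerOfMass_of_mem_Ico ht ω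

/-- Every parent has exactly two children at its final position, so the average over the children is
the limit of the average over the parents. -/
lemma tendsto_centerOfMass {m : ℕ} {ω : Ω} (h : ∀ i < 2 ^ (m + 1),
    Tendsto (fun t => X t (i / 2) ω) (𝓝[<] ((m : ℝ) + 1)) (𝓝 (X ((m : ℝ) + 1) i ω))) :
    Tendsto (fun t => centerOfMass X t ω) (𝓝[<] ((m : ℝ) + 1))
      (𝓝 (centerOfMass X ((m : ℝ) + 1) ω)) := by
  have hn : numParticles ((m : ℝ) + 1) = 2 ^ (m + 1) := by
    exact_mod_cast numParticles_natCast (m + 1)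
  have h1 : Tendsto (fun t => (2 ^ (m + 1) : ℝ)⁻¹ •
      ∑ i ∈ Finset.range (2 ^ (m + 1)), X t (i / 2) ω) (𝓝[<] ((m : ℝ) + 1))
      (𝓝 (centerOfMass X ((m : ℝ) + 1) ω)) := by
    rw [centerOfMass, hn]
    push_cast
    exact (tendsto_finsetSum _ fun i hi => h i (Finset.mem_range.1 hi)).const_smul _
  refine h1.congr' ?_
  have hmem : Set.Ico (m : ℝ) (m + 1) ∈ 𝓝[<] ((m : ℝ) + 1) :=
    Ico_mem_nhdsLT (by linarith)
  filter_upwards [hmem] with t ht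
  rw [centerOfMass, numParticles_of_mem_Ico ht, pow_succ' (2 : ℕ) m,
    sum_range_two_mul_div (fun i => X t i ω), ← Nat.cast_smul_eq_nsmul ℝ, smul_smul]
  congr 1
  push_cast
  field_simp
  ring

lemma measurable_centerOfMass [MeasurableSpace Ω]
    (h : ∀ t : ℝ, 0 ≤ t → ∀ i < numParticles t, Measurable (X t i)) {t : ℝ} (ht : 0 ≤ t) :
    Measurable (centerOfMass X t) := by
  have : Measurable fun ω => ∑ i ∈ Finset.range (numParticles t), X t i ω :=
    Finset.measurable_fun_sum _ fun i hi => h t ht i (Finset.mem_range.1 hi)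
  exact this.const_smul ((numParticles t : ℝ)⁻¹)

end CenterOfMass

/-! ### Equations for the center of mass and for the relative system -/

section Decomposition

variable {Ω : Type*} [mΩ : MeasurableSpace Ω] {P : Measure Ω} {d : ℕ} {γ : ℝ}
  {B : (m : ℕ) → Fin (2 ^ m) → ℝ≥0 → Ω → Space d} {Z : ℝ → ℕ → Ω → Space d}

lemma IsDyadicSystem.relativeSystem (h : IsDyadicSystem Z P) :
    IsDyadicSystem (relativeSystem Z) P where
  measurable t ht i hi := (h.measurable t ht i hi).sub (measurable_centerOfMass h.measurable ht)
  start := Eventually.of_forall fun ω => by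
    simp [_root_.relativeSystem, centerOfMass, numParticles]
  continuous := by
    filter_upwards [h.continuous] with ω hω m i hi
    exact (hω m i hi).sub (continuousOn_centerOfMass (hω m))
  fission := by
    filter_upwards [h.fission] with ω hω m i hi
    exact (hω m i hi).sub (tendsto_centerOfMass (hω m))

lemma IsSelfInteractingBBM.ae_centerOfMass_add (h : IsSelfInteractingBBM γ B Z P) :
    ∀ᵐ ω ∂P, ∀ (m : ℕ) (τ : ℝ≥0), τ < 1 →
      centerOfMass Z (m + τ) ω = centerOfMass Z m ω + meanNoise B m τ ω := by
  filter_upwards [h.sde, h.continuous] with ω hω hc m τ hτ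
  have hτ' : (τ : ℝ) < 1 := by exact_mod_cast hτ
  rw [centerOfMass_of_mem_Ico (add_mem_Ico m τ.coe_nonneg hτ'), centerOfMass_of_mem_Ico (natCast_mem_Ico m),
    Finset.sum_congr rfl fun i _ => hω m i τ hτ]
  have hci : ∀ i : Fin (2 ^ m), ContinuousOn (fun s => Z (m + s) i ω) (Set.uIcc 0 (τ : ℝ)) := by
    intro i
    refine (hc m i i.2).comp (by fun_prop) fun s hs => ?_
    rw [Set.uIcc_of_le τ.coe_nonneg] at hs
    exact add_mem_Ico m hs.1 (hs.2.trans_lt hτ')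
  -- The total interaction vanishes because `Z^j - Z^i` is antisymmetric in the pair. Continuity of
  -- the paths justifies exchanging sum and integral.
  have h0 : ∑ i : Fin (2 ^ m), ∫ s in (0 : ℝ)..τ, ∑ j : Fin (2 ^ m),
      (Z (m + s) j ω - Z (m + s) i ω) = 0 := by
    rw [← intervalIntegral.integral_finsetSum fun i _ => ContinuousOn.intervalIntegrable
      (continuousOn_finsetSum _ fun j _ => (hci j).fun_sub (hci i))]
    refine (intervalIntegral.integral_congr fun s _ => ?_).trans intervalIntegral.integral_zero
    simp only [Finset.sum_sub_distrib]
    rw [Finset.sum_comm, sub_self]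
  simp only [Finset.sum_add_distrib, ← Finset.smul_sum, h0, smul_zero, add_zero, smul_add]
  simp [meanNoise, noiseComb, Finset.smul_sum]

/-- The equation is available only for `τ < 1`. The value at the fission time is the left limit of
the center of mass, to be compared with the left limit of the average noise. -/
lemma IsSelfInteractingBBM.ae_centerOfMass_succ (h : IsSelfInteractingBBM γ B Z P) :
    ∀ᵐ ω ∂P, ∀ m : ℕ,
      centerOfMass Z ((m + 1 : ℕ) : ℝ) ω = centerOfMass Z m ω + meanNoise B m 1 ω := by
  filter_upwards [h.ae_centerOfMass_add, h.fission, h.noise.continuous] with ω h1 h2 h3 m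
  have hlim := tendsto_centerOfMass (h2 m)
  have hlim' : Tendsto (fun t => centerOfMass Z t ω) (𝓝[<] ((m : ℝ) + 1))
      (𝓝 (centerOfMass Z m ω + meanNoise B m 1 ω)) := by
    have hcont : Continuous fun t : ℝ =>
        centerOfMass Z m ω + meanNoise B m (t - m).toNNReal ω := by
      have : Continuous fun τ => meanNoise B m τ ω := continuous_noiseComb (h3 m)
      fun_prop
    have hl := (hcont.tendsto ((m : ℝ) + 1)).mono_left
      (nhdsWithin_le_nhds (s := Set.Iio ((m : ℝ) + 1)))
    simp only [add_sub_cancel_left, Real.toNNReal_one] at hl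
    refine hl.congr' ?_
    filter_upwards [Ico_mem_nhdsLT (show (m : ℝ) < m + 1 by linarith)] with t ht
    have ht0 : 0 ≤ t - m := by linarith [ht.1]
    rw [← h1 m (t - m).toNNReal (by rw [← Real.toNNReal_one, Real.toNNReal_lt_toNNReal_iff] <;>
      linarith [ht.2]), Real.coe_toNNReal _ ht0]
    congr 1
    ring
  push_cast
  exact tendsto_nhds_unique hlim hlim'

lemma IsSelfInteractingBBM.ae_centerOfMass_natCast (h : IsSelfInteractingBBM γ B Z P) :
    ∀ᵐ ω ∂P, ∀ m : ℕ,
      centerOfMass Z m ω = ∑ k ∈ Finset.range m, meanNoise B k 1 ω := by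
  filter_upwards [h.ae_centerOfMass_succ, h.start] with ω h1 h2 m
  induction m with
  | zero => simpa [centerOfMass, numParticles] using h2
  | succ m ih => rw [h1, ih, Finset.sum_range_succ]

/-- The system viewed from its center of mass solves the Ornstein–Uhlenbeck equation. -/
lemma IsSelfInteractingBBM.ae_relativeSystem_eq (h : IsSelfInteractingBBM γ B Z P) :
    ∀ᵐ ω ∂P, ∀ (m : ℕ) (i : Fin (2 ^ m)) (τ : ℝ≥0), τ < 1 →
      relativeSystem Z (m + τ) i ω = relativeSystem Z m i ω + centeredNoise B m i τ ω
        - γ • ∫ s in (0 : ℝ)..τ, relativeSystem Z (m + s) i ω := by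
  filter_upwards [h.sde, h.ae_centerOfMass_add] with ω hω hc m i τ hτ
  have hτ' : (τ : ℝ) < 1 := by exact_mod_cast hτ
  -- Summing over all partners gives `2 ^ m` times the vector from particle `i` to the center; the
  -- factor cancels the normalization of `γ`.
  have hI : ∫ s in (0 : ℝ)..τ, ∑ j : Fin (2 ^ m), (Z (m + s) j ω - Z (m + s) i ω)
      = ∫ s in (0 : ℝ)..τ, (-(2 ^ m : ℝ)) • relativeSystem Z (m + s) i ω := by
    refine intervalIntegral.integral_congr fun s hs => ?_
    rw [Set.uIcc_of_le τ.coe_nonneg] at hs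
    simp only [_root_.relativeSystem]
    rw [centerOfMass_of_mem_Ico (add_mem_Ico m hs.1 (hs.2.trans_lt hτ')), smul_sub, smul_smul,
      neg_mul, mul_inv_cancel₀ (by positivity), Finset.sum_sub_distrib, Finset.sum_const,
      Finset.card_univ, Fintype.card_fin, ← Nat.cast_smul_eq_nsmul ℝ]
    push_cast
    module
  have h1 := hω m i τ hτ
  rw [hI, intervalIntegral.integral_smul, smul_smul,
    show γ / 2 ^ m * -(2 ^ m : ℝ) = -γ by field_simp] at h1
  have h2 := hc m τ hτ
  rw [centeredNoise_eq]
  nth_rw 1 [_root_.relativeSystem]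
  rw [h1, h2]
  simp only [_root_.relativeSystem]
  module

lemma IsSelfInteractingBBM.isBranchingOU (h : IsSelfInteractingBBM γ B Z P) :
    IsBranchingOU γ (relativeSystem Z) P where
  toIsDyadicSystem := h.toIsDyadicSystem.relativeSystem
  sde := ⟨centeredNoise B, h.noise.isCorrelatedBrownian_centeredNoise,
    h.noise.iIndepFun_centeredNoise, h.ae_relativeSystem_eq⟩

end Decomposition

/-! ### Doob's maximal inequality for Brownian motion -/

section Maximal

variable {Ω : Type*} [mΩ : MeasurableSpace Ω] {P : Measure Ω} {X : ℝ≥0 → Ω → ℝ}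

/-- Increments are centered and independent of the past. Discrete time suffices, because the maximal
inequality is applied on dyadic grids. -/
lemma ProbabilityTheory.IsPreBrownianReal.martingale_natCast_mul (hX : IsPreBrownianReal X P)
    (hm : ∀ t, Measurable (X t)) (δ : ℝ≥0) :
    Martingale (fun j : ℕ => X (j * δ))
      (Filtration.natural (fun j : ℕ => X (j * δ)) fun _ => (hm _).stronglyMeasurable) P := by
  have : IsProbabilityMeasure P := hX.isGaussianProcess.isProbabilityMeasure
  refine martingale_of_condExp_sub_eq_zero_nat
    (Filtration.stronglyAdapted_natural fun j => (hm _).stronglyMeasurable)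
    (fun j => hX.integrable_eval _) fun j => ?_
  have hsm : Measurable (fun ω (t : Set.Iic (j * δ)) => X t ω) :=
    measurable_pi_lambda _ fun t => hm t
  have hind := (hX.indepFun_shift (j * δ)).comp (measurable_pi_apply δ) measurable_id
  rw [Function.id_comp, IndepFun_iff_Indep] at hind
  have hle : Filtration.natural (fun j : ℕ => X (j * δ)) (fun j => (hm _).stronglyMeasurable) j ≤
      MeasurableSpace.comap (fun ω (t : Set.Iic (j * δ)) => X t ω) inferInstance := by
    refine iSup₂_le fun i hi => ?_
    have hi' : (i : ℝ≥0) * δ ∈ Set.Iic ((j : ℝ≥0) * δ) :=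
      mul_le_mul_left (by exact_mod_cast hi) δ
    exact Measurable.comap_le (measurable_pi_apply (⟨i * δ, hi'⟩ : Set.Iic (j * δ)) |>.comp
      (comap_measurable (fun ω (t : Set.Iic (j * δ)) => X t ω)))
  have heq : (fun j : ℕ => X (j * δ)) (j + 1) - (fun j : ℕ => X (j * δ)) j =
      (fun x : ℝ≥0 → ℝ => x δ) ∘ fun ω t => X (j * δ + t) ω - X (j * δ) ω := by
    funext ω
    simp [add_mul]
  rw [heq]
  have hmeas : Measurable ((fun x : ℝ≥0 → ℝ => x δ) ∘ fun ω t => X (j * δ + t) ω - X (j * δ) ω) :=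
    (hm _).sub (hm _)
  refine (condExp_indep_eq hmeas.comap_le (Filtration.le _ j)
    (comap_measurable _).stronglyMeasurable (indep_of_indep_of_le_right hind hle)).trans ?_
  refine Eventually.of_forall fun ω => ?_
  simp only [Function.comp_apply, Pi.zero_apply]
  rw [integral_sub (hX.integrable_eval _) (hX.integrable_eval _), hX.integral_eval,
    hX.integral_eval, sub_zero]

lemma ProbabilityTheory.IsPreBrownianReal.integral_abs_one_le (hX : IsPreBrownianReal X P) :
    ∫ ω, |X 1 ω| ∂P ≤ 1 := by
  have : IsProbabilityMeasure P := hX.isGaussianProcess.isProbabilityMeasure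
  have h2 : MemLp (X 1) 2 P := (hX.isGaussianProcess.hasGaussianLaw_eval 1).memLp_two
  have hv : ∫ ω, X 1 ω * X 1 ω ∂P = 1 := by
    have h := hX.covariance_eval 1 1
    rw [covariance_eq_sub h2 h2, hX.integral_eval] at h
    simpa using h
  have hi : Integrable (fun ω => X 1 ω * X 1 ω) P := by simpa [pow_two] using h2.integrable_sq
  calc ∫ ω, |X 1 ω| ∂P ≤ ∫ ω, (1 + X 1 ω * X 1 ω) / 2 ∂P := by
        refine integral_mono (hX.integrable_eval 1).abs
          (((integrable_const 1).add hi).div_const 2) fun ω => ?_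
        simp only
        nlinarith [sq_nonneg (|X 1 ω| - 1), abs_mul_abs_self (X 1 ω)]
    _ = 1 := by
        rw [integral_div, integral_add (integrable_const 1) hi, hv]
        simp

/-- The maximum `|X|` of the martingales `X` and `-X` is a nonnegative submartingale, and its
expectation at time `1` is at most `1`. -/
lemma ProbabilityTheory.IsPreBrownianReal.measure_dyadic_le (hX : IsPreBrownianReal X P)
    (hm : ∀ t, Measurable (X t)) (ε : ℝ≥0) (n : ℕ) :
    ε * P {ω | ∃ j : ℕ, j ≤ 2 ^ n ∧ (ε : ℝ) ≤ |X (j * (2 ^ n)⁻¹) ω|} ≤ 1 := by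
  have : IsProbabilityMeasure P := hX.isGaussianProcess.isProbabilityMeasure
  have hM := hX.martingale_natCast_mul hm (2 ^ n)⁻¹
  have hS := hM.submartingale.sup hM.neg.submartingale
  have h := maximal_ineq hS (fun j ω => by simp [abs_nonneg, ← abs_eq_max_neg]) (ε := ε) (2 ^ n)
  have hset : {ω | ∃ j : ℕ, j ≤ 2 ^ n ∧ (ε : ℝ) ≤ |X (j * (2 ^ n)⁻¹) ω|} =
      {ω | (ε : ℝ) ≤ (Finset.range (2 ^ n + 1)).sup' Finset.nonempty_range_add_one fun k =>
        ((fun j : ℕ => X (j * (2 ^ n)⁻¹)) ⊔ -(fun j : ℕ => X (j * (2 ^ n)⁻¹))) k ω} := by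
    ext ω
    simp [Finset.le_sup'_iff, abs, le_sup_iff]
  rw [hset]
  refine h.trans (ENNReal.ofReal_le_one.2 ((setIntegral_le_integral (hS.integrable _)
    (Eventually.of_forall fun ω => by simp [abs_nonneg, ← abs_eq_max_neg])).trans ?_))
  have h1 : ((2 ^ n : ℕ) : ℝ≥0) * (2 ^ n)⁻¹ = 1 := by
    push_cast
    exact mul_inv_cancel₀ (by positivity)
  have h2 := hX.integral_abs_one_le
  rw [← h1] at h2
  exact h2

/-- **Doob's maximal inequality** for Brownian motion on the unit interval. -/
lemma ProbabilityTheory.IsPreBrownianReal.measure_exists_le (hX : IsPreBrownianReal X P)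
    (hm : ∀ t, Measurable (X t)) (hc : ∀ᵐ ω ∂P, Continuous fun t => X t ω) (ε : ℝ≥0) :
    ε * P {ω | ∃ τ : ℝ≥0, τ ≤ 1 ∧ (ε : ℝ) < |X τ ω|} ≤ 1 := by
  let A : ℕ → Set Ω := fun n => {ω | ∃ j : ℕ, j ≤ 2 ^ n ∧ (ε : ℝ) ≤ |X (j * (2 ^ n)⁻¹) ω|}
  have hA : Monotone A := by
    refine monotone_nat_of_le_succ fun n ω => ?_
    rintro ⟨j, hj, h⟩
    refine ⟨2 * j, by rw [pow_succ]; omega, ?_⟩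
    have h2 : ((2 * j : ℕ) : ℝ≥0) * (2 ^ (n + 1))⁻¹ = j * (2 ^ n)⁻¹ := by
      rw [pow_succ]
      push_cast
      field_simp
    rwa [h2]
  -- A strict excess at `τ` persists by continuity at the dyadic approximations of `τ` from below,
  -- which stay in `[0, 1]`.
  have hsub : {ω | ∃ τ : ℝ≥0, τ ≤ 1 ∧ (ε : ℝ) < |X τ ω|} ≤ᵐ[P] ⋃ n, A n := by
    filter_upwards [hc] with ω hω
    rintro ⟨τ, hτ, h⟩
    have hlim : Tendsto (fun n : ℕ => ((⌊τ * 2 ^ n⌋₊ : ℝ≥0) * (2 ^ n)⁻¹)) atTop (𝓝 τ) := by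
      rw [← NNReal.tendsto_coe]
      have h1 := (tendsto_nat_floor_mul_div_atTop (R := ℝ) τ.coe_nonneg).comp
        (tendsto_pow_atTop_atTop_of_one_lt (one_lt_two : (1 : ℝ) < 2))
      refine h1.congr fun n => ?_
      simp only [Function.comp_apply, div_eq_mul_inv, NNReal.coe_mul, NNReal.coe_inv,
        NNReal.coe_pow, NNReal.coe_ofNat, NNReal.coe_natCast]
      congr 2
    have hlim' := ((hω.abs.tendsto τ).comp hlim).eventually (lt_mem_nhds h)
    obtain ⟨n, hn⟩ := hlim'.exists
    refine Set.mem_iUnion.2 ⟨n, ⌊τ * 2 ^ n⌋₊, ?_, hn.le⟩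
    have : τ * 2 ^ n ≤ ((2 ^ n : ℕ) : ℝ≥0) := by
      push_cast
      exact mul_le_of_le_one_left (by positivity) hτ
    exact Nat.floor_le_of_le this
  calc ε * P {ω | ∃ τ : ℝ≥0, τ ≤ 1 ∧ (ε : ℝ) < |X τ ω|} ≤ ε * P (⋃ n, A n) := by
        gcongr 1
        exact measure_mono_ae hsub
    _ = ⨆ n, ε * P (A n) := by rw [hA.measure_iUnion, ENNReal.mul_iSup]
    _ ≤ 1 := iSup_le fun n => hX.measure_dyadic_le hm ε n

end Maximal

/-! ### Convergence of the center of mass and the law of its limit -/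

section MeanNoise

variable {Ω : Type*} [mΩ : MeasurableSpace Ω] {P : Measure Ω} {d : ℕ}
  {B : (m : ℕ) → Fin (2 ^ m) → ℝ≥0 → Ω → Space d}

lemma IsIndependentNoise.covariance_meanNoise (hB : IsIndependentNoise B P) (m n : ℕ)
    (s t : ℝ≥0) (k l : Fin d) :
    cov[fun ω => meanNoise B m s ω k, fun ω => meanNoise B n t ω l; P] =
      if m = n ∧ k = l then min (s : ℝ) t * (2 ^ m)⁻¹ else 0 := by
  by_cases hmn : m = n
  · subst hmn
    refine (hB.covariance_noiseComb m _ _ s t k l).trans ?_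
    by_cases hkl : k = l <;> simp [hkl]
  · rw [if_neg (by tauto)]
    exact hB.covariance_noiseComb_of_ne hmn _ _ _ _ _ _

lemma IsIndependentNoise.isGaussianProcess_meanNoise (hB : IsIndependentNoise B P) :
    IsGaussianProcess (fun (p : ℕ × ℝ≥0 × Fin d) ω => meanNoise B p.1 p.2.1 ω p.2.2) P :=
  hB.isGaussianProcess_noiseComb.comp_right
    fun p : ℕ × ℝ≥0 × Fin d =>
      ((⟨p.1, fun _ => (2 ^ p.1 : ℝ)⁻¹⟩ : Σ m : ℕ, Fin (2 ^ m) → ℝ), p.2)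

lemma IsIndependentNoise.isPreBrownianReal_meanNoise (hB : IsIndependentNoise B P) (m : ℕ)
    (k : Fin d) : IsPreBrownianReal (fun τ ω => √2 ^ m * meanNoise B m τ ω k) P := by
  refine IsGaussianProcess.isPreBrownianReal_of_covariance ?_ (fun t => ?_) (fun s t hst => ?_)
  · exact (hB.isGaussianProcess_meanNoise.comp_right fun τ : ℝ≥0 => (m, τ, k)).smul
      fun _ => √2 ^ m
  · rw [integral_const_mul, meanNoise, hB.integral_noiseComb, mul_zero]
  · rw [covariance_const_mul_left, covariance_const_mul_right, hB.covariance_meanNoise]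
    have h2 : √2 ^ m * √2 ^ m = (2 : ℝ) ^ m := by rw [← mul_pow]; simp
    rw [if_pos ⟨rfl, rfl⟩, ← mul_assoc, h2, min_eq_left (by exact_mod_cast hst)]
    field_simp

/-- Rescaled by `√2 ^ m` the average noise is a Brownian motion, so Doob's inequality bounds the
probability of exceeding the threshold by a geometric sequence, and Borel–Cantelli applies. Any
ratio strictly between `1 / √2` and `1` could replace `3 / 4`. -/
lemma ae_meanNoise_coord_le (hB : IsIndependentNoise B P) (k : Fin d) :
    ∀ᵐ ω ∂P, ∀ᶠ m : ℕ in atTop, ∀ τ : ℝ≥0, τ ≤ 1 → |meanNoise B m τ ω k| ≤ (3 / 4 : ℝ) ^ m := by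
  -- The rescaled threshold is `r ^ m`; its ratio exceeds `1` because `3 / 4 > 1 / √2`.
  let r : ℝ≥0 := NNReal.sqrt 2 * (3 / 4)
  have hr : 1 < r := by
    rw [← NNReal.coe_lt_coe]
    simp only [r, NNReal.coe_mul, Real.coe_sqrt]
    push_cast
    nlinarith [Real.sq_sqrt (show (0 : ℝ) ≤ 2 by norm_num), Real.sqrt_nonneg 2,
      sq_nonneg (√2 - 4 / 3)]
  have hbound : ∀ m : ℕ, P {ω | ∃ τ : ℝ≥0, τ ≤ 1 ∧ ((r ^ m : ℝ≥0) : ℝ) <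
      |√2 ^ m * meanNoise B m τ ω k|} ≤ ((r⁻¹ : ℝ≥0) : ℝ≥0∞) ^ m := by
    intro m
    have hm : ∀ τ, Measurable fun ω => meanNoise B m τ ω k := fun τ =>
      (by fun_prop : Measurable fun x : Space d => x k).comp (hB.measurable_noiseComb _ _ _)
    have h := (hB.isPreBrownianReal_meanNoise m k).measure_exists_le
      (fun τ => (hm τ).const_mul _) (by
        filter_upwards [hB.continuous] with ω hω
        have : Continuous fun τ => meanNoise B m τ ω := continuous_noiseComb (hω m)
        fun_prop) (r ^ m)
    have hr0 : r ^ m ≠ 0 := pow_ne_zero _ (by positivity)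
    rw [mul_comm] at h
    refine (ENNReal.le_div_iff_mul_le (Or.inl (by exact_mod_cast hr0))
      (Or.inl ENNReal.coe_ne_top)).2 h |>.trans (le_of_eq ?_)
    rw [one_div, ← ENNReal.coe_inv hr0, ← ENNReal.coe_pow, inv_pow]
  have hsum : ∑' m : ℕ, P {ω | ∃ τ : ℝ≥0, τ ≤ 1 ∧ ((r ^ m : ℝ≥0) : ℝ) <
      |√2 ^ m * meanNoise B m τ ω k|} ≠ ∞ := by
    refine ne_top_of_le_ne_top ?_ (ENNReal.tsum_le_tsum hbound)
    rw [ENNReal.tsum_geometric]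
    refine ENNReal.inv_ne_top.2 (tsub_pos_of_lt ?_).ne'
    exact_mod_cast inv_lt_one_of_one_lt₀ hr
  filter_upwards [ae_eventually_notMem hsum] with ω hω
  filter_upwards [hω] with m hm τ hτ
  by_contra hlt
  refine hm ⟨τ, hτ, ?_⟩
  rw [abs_mul, abs_of_nonneg (by positivity)]
  simp only [r, mul_pow, NNReal.coe_mul, NNReal.coe_pow, Real.coe_sqrt]
  push_cast
  exact mul_lt_mul_of_pos_left (not_le.1 hlt) (by positivity)

lemma norm_le_sum_abs (x : Space d) : ‖x‖ ≤ ∑ k, |x k| := by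
  conv_lhs => rw [← (EuclideanSpace.basisFun (Fin d) ℝ).sum_repr x]
  refine (norm_sum_le _ _).trans (le_of_eq ?_)
  simp [norm_smul]

lemma ae_norm_meanNoise_le (hB : IsIndependentNoise B P) :
    ∀ᵐ ω ∂P, ∀ᶠ m : ℕ in atTop, ∀ τ : ℝ≥0, τ ≤ 1 →
      ‖meanNoise B m τ ω‖ ≤ d * (3 / 4 : ℝ) ^ m := by
  filter_upwards [ae_all_iff.2 (ae_meanNoise_coord_le hB)] with ω hω
  filter_upwards [eventually_all.2 hω] with m hm τ hτ
  refine (norm_le_sum_abs _).trans ((Finset.sum_le_sum fun k _ => hm k τ hτ).trans ?_)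
  simp

/-- At integer times the center is a partial sum of a series with geometrically bounded terms.
Between integer times the same bound, uniform over the generation, controls the oscillation. -/
lemma IsSelfInteractingBBM.ae_exists_tendsto {γ : ℝ} {Z : ℝ → ℕ → Ω → Space d}
    (h : IsSelfInteractingBBM γ B Z P) :
    ∀ᵐ ω ∂P, ∃ l, Tendsto (fun t => centerOfMass Z t ω) atTop (𝓝 l) := by
  filter_upwards [ae_norm_meanNoise_le h.noise, h.ae_centerOfMass_natCast,
    h.ae_centerOfMass_add] with ω hb hn ha
  have hgeo : Summable fun m : ℕ => (d : ℝ) * (3 / 4 : ℝ) ^ m :=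
    (summable_geometric_of_lt_one (by norm_num) (by norm_num)).mul_left _
  have hs : Summable fun m => meanNoise B m 1 ω :=
    Summable.of_norm_bounded_eventually_nat hgeo (hb.mono fun m hm => hm 1 le_rfl)
  refine ⟨∑' m, meanNoise B m 1 ω, ?_⟩
  have hfl : Tendsto (fun t : ℝ => ⌊t⌋₊) atTop atTop := tendsto_nat_floor_atTop
  have h1 : Tendsto (fun t : ℝ => centerOfMass Z (⌊t⌋₊ : ℝ) ω) atTop
      (𝓝 (∑' m, meanNoise B m 1 ω)) := by
    have := hs.hasSum.tendsto_sum_nat.comp hfl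
    exact this.congr fun t => (hn _).symm
  have h2 : Tendsto (fun t : ℝ => meanNoise B ⌊t⌋₊ (t - ⌊t⌋₊).toNNReal ω) atTop (𝓝 0) := by
    refine squeeze_zero_norm' ?_ (hgeo.tendsto_atTop_zero.comp hfl)
    filter_upwards [hfl.eventually hb, eventually_ge_atTop 0] with t ht ht0
    refine ht _ (Real.toNNReal_le_one.2 ?_)
    linarith [Nat.lt_floor_add_one t]
  have h3 := h1.add h2
  rw [add_zero] at h3
  refine h3.congr' ?_
  filter_upwards [eventually_ge_atTop 0] with t ht
  have hle := Nat.floor_le ht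
  rw [← ha _ _ (by rw [← Real.toNNReal_one, Real.toNNReal_lt_toNNReal_iff] <;>
    linarith [Nat.lt_floor_add_one t]), Real.coe_toNNReal _ (by linarith)]
  congr 1
  ring

lemma IsSelfInteractingBBM.exists_limit {γ : ℝ} {Z : ℝ → ℕ → Ω → Space d}
    (h : IsSelfInteractingBBM γ B Z P) :
    ∃ N : Ω → Space d, Measurable N ∧
      ∀ᵐ ω ∂P, Tendsto (fun t => centerOfMass Z t ω) atTop (𝓝 (N ω)) := by
  have hcast : Tendsto (fun n : ℕ => (n : ℝ)) atTop atTop := tendsto_natCast_atTop_atTop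
  obtain ⟨N, hN, hlim⟩ := measurable_limit_of_tendsto_metrizable_ae (μ := P) (L := atTop)
    (f := fun (n : ℕ) ω => centerOfMass Z n ω)
    (fun n => (measurable_centerOfMass h.measurable n.cast_nonneg).aemeasurable)
    (h.ae_exists_tendsto.mono fun ω ⟨l, hl⟩ => ⟨l, hl.comp hcast⟩)
  refine ⟨N, hN, ?_⟩
  filter_upwards [hlim, h.ae_exists_tendsto] with ω h1 ⟨l, hl⟩
  rwa [tendsto_nhds_unique h1 (hl.comp hcast)]

/-- One-dimensional projections suffice to compute characteristic functions. Generation `k`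
contributes variance `2 ^ (-k) * ‖t‖ ^ 2`, with no cross terms between generations or coordinates.
-/
lemma IsIndependentNoise.map_inner_sum_meanNoise (hB : IsIndependentNoise B P) (t : Space d)
    (m : ℕ) : P.map (fun ω => inner ℝ (∑ k ∈ Finset.range m, meanNoise B k 1 ω) t) =
      gaussianReal 0 (∑ k ∈ Finset.range m, ((2 : ℝ) ^ k)⁻¹ * ‖t‖ ^ 2).toNNReal := by
  have hprob : IsProbabilityMeasure P := hB.isGaussianProcess.isProbabilityMeasure
  have hG : IsGaussianProcess (fun (p : ℕ × Fin d) ω => t p.2 * meanNoise B p.1 1 ω p.2) P :=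
    (hB.isGaussianProcess_meanNoise.comp_right fun p : ℕ × Fin d => (p.1, 1, p.2)).smul
      fun p => t p.2
  have heq : (fun ω => inner ℝ (∑ k ∈ Finset.range m, meanNoise B k 1 ω) t) =
      fun ω => ∑ p ∈ Finset.range m ×ˢ Finset.univ, t p.2 * meanNoise B p.1 1 ω p.2 := by
    funext ω
    rw [sum_inner, Finset.sum_product]
    simp [PiLp.inner_apply]
  rw [heq]
  have hL := hG.hasGaussianLaw_fun_sum (I := Finset.range m ×ˢ Finset.univ)
  rw [hL.map_eq_gaussianReal]
  congr 2
  · rw [integral_finsetSum _ fun p _ => (hG.hasGaussianLaw_eval p).integrable]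
    refine Finset.sum_eq_zero fun p _ => ?_
    rw [integral_const_mul, meanNoise, hB.integral_noiseComb, mul_zero]
  · rw [← covariance_self hL.aemeasurable, covariance_fun_sum_fun_sum'
      (fun p _ => (hG.hasGaussianLaw_eval p).memLp_two)
      (fun p _ => (hG.hasGaussianLaw_eval p).memLp_two)]
    simp_rw [covariance_const_mul_left, covariance_const_mul_right, hB.covariance_meanNoise,
      ← Prod.ext_iff]
    simp only [Finset.sum_product, EuclideanSpace.real_norm_sq_eq, Finset.mul_sum, mul_ite,
      mul_zero]
    refine Finset.sum_congr rfl fun k hk => Finset.sum_congr rfl fun l _ => ?_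
    rw [← Finset.sum_product (f := fun p : ℕ × Fin d => if (k, l) = p then
      t l * (t p.2 * (min ((1 : ℝ≥0) : ℝ) (1 : ℝ≥0) * (2 ^ k)⁻¹)) else 0),
      Finset.sum_ite_eq, if_pos (by simpa using hk)]
    simp
    ring

/-- The characteristic functions of the partial sums converge by dominated convergence, and the
geometric series of variances sums to `2 * ‖t‖ ^ 2`. -/
lemma IsSelfInteractingBBM.hasLaw_limit {γ : ℝ} {Z : ℝ → ℕ → Ω → Space d}
    (h : IsSelfInteractingBBM γ B Z P) {N : Ω → Space d} (hN : Measurable N)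
    (hlim : ∀ᵐ ω ∂P, Tendsto (fun t => centerOfMass Z t ω) atTop (𝓝 (N ω))) :
    HasLaw N (multivariateGaussian 0 ((2 : ℝ) • (1 : Matrix (Fin d) (Fin d) ℝ))) P := by
  have hprob : IsProbabilityMeasure P := h.noise.isProbabilityMeasure
  have : IsProbabilityMeasure (P.map N) := Measure.isProbabilityMeasure_map hN.aemeasurable
  refine ⟨hN.aemeasurable, Measure.ext_of_charFun (funext fun t => ?_)⟩
  have hpos : ((2 : ℝ) • (1 : Matrix (Fin d) (Fin d) ℝ)).PosSemidef :=
    Matrix.PosSemidef.one.smul (by norm_num)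
  rw [charFun_multivariateGaussian hpos]
  have hSm : ∀ m : ℕ, Measurable fun ω => ∑ k ∈ Finset.range m, meanNoise B k 1 ω := fun m =>
    Finset.measurable_fun_sum _ fun k _ => h.noise.measurable_noiseComb _ _ _
  have hS : ∀ᵐ ω ∂P, Tendsto (fun m : ℕ => ∑ k ∈ Finset.range m, meanNoise B k 1 ω) atTop
      (𝓝 (N ω)) := by
    filter_upwards [hlim, h.ae_centerOfMass_natCast] with ω h1 h2
    exact (h1.comp tendsto_natCast_atTop_atTop).congr fun m => h2 m
  have hc1 : Tendsto (fun m : ℕ => ∫ ω, Complex.exp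
      ((inner ℝ (∑ k ∈ Finset.range m, meanNoise B k 1 ω) t : ℝ) * Complex.I) ∂P) atTop
      (𝓝 (charFun (P.map N) t)) := by
    rw [charFun_apply, integral_map hN.aemeasurable (by fun_prop)]
    refine tendsto_integral_of_dominated_convergence (fun _ => 1)
      (fun m => ?_) (integrable_const 1) (fun m => ?_) ?_
    · exact ((by fun_prop : Continuous fun x : Space d =>
        Complex.exp ((inner ℝ x t : ℝ) * Complex.I)).measurable.comp (hSm m)).aestronglyMeasurable
    · exact Eventually.of_forall fun ω => by rw [Complex.norm_exp_ofReal_mul_I]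
    · filter_upwards [hS] with ω hω
      exact ((by fun_prop : Continuous fun x : Space d =>
        Complex.exp ((inner ℝ x t : ℝ) * Complex.I)).tendsto _).comp hω
  have hc2 : ∀ m : ℕ, ∫ ω, Complex.exp
      ((inner ℝ (∑ k ∈ Finset.range m, meanNoise B k 1 ω) t : ℝ) * Complex.I) ∂P =
      Complex.exp (-(∑ k ∈ Finset.range m, ((2 : ℝ) ^ k)⁻¹ * ‖t‖ ^ 2 : ℝ) / 2) := by
    intro m
    have h1 := congrArg (fun μ => charFun μ 1) (h.noise.map_inner_sum_meanNoise t m)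
    rw [charFun_gaussianReal, charFun_apply, integral_map
      ((hSm m).inner_const).aemeasurable (by fun_prop),
      Real.coe_toNNReal _ (Finset.sum_nonneg fun k _ => by positivity)] at h1
    simpa [neg_div] using h1
  simp_rw [hc2] at hc1
  refine tendsto_nhds_unique hc1 ?_
  have hgeo : Tendsto (fun m : ℕ => ∑ k ∈ Finset.range m, ((2 : ℝ) ^ k)⁻¹ * ‖t‖ ^ 2) atTop
      (𝓝 (2 * ‖t‖ ^ 2)) := by
    have := (hasSum_geometric_two.mul_right (‖t‖ ^ 2)).tendsto_sum_nat
    simpa using this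
  have hc3 : Continuous fun x : ℝ => Complex.exp (-(x : ℂ) / 2) := by fun_prop
  suffices heq : Complex.exp ((inner ℝ t (0 : Space d) : ℝ) * Complex.I -
      ((t ⬝ᵥ ((2 : ℝ) • (1 : Matrix (Fin d) (Fin d) ℝ)) *ᵥ t : ℝ) : ℂ) / 2) =
      Complex.exp (-((2 * ‖t‖ ^ 2 : ℝ) : ℂ) / 2) by
    rw [heq]
    exact (hc3.tendsto _).comp hgeo
  rw [Matrix.smul_mulVec, Matrix.one_mulVec, dotProduct_smul]
  have : t ⬝ᵥ t = ‖t‖ ^ 2 := by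
    rw [EuclideanSpace.real_norm_sq_eq]
    simp [dotProduct, pow_two]
  rw [this]
  simp [neg_div]

end MeanNoise

/-! ### The filtration of the noise -/

section NoisePast

lemma measurable_comap_apply {Ω ι E : Type*} [MeasurableSpace E] (F : Ω → ι → E) (i : ι) :
    Measurable[MeasurableSpace.comap F inferInstance] (fun ω => F ω i) :=
  (measurable_pi_apply i).comp (comap_measurable F)

variable {Ω : Type*} {d : ℕ}

/-- The σ-algebra generated by the noise of the generations before `m` and the noise of
generation `m` up to time `u`. -/
@[reducible] def noisePast (W : (m : ℕ) → Fin (2 ^ m) → ℝ≥0 → Ω → Space d) (m : ℕ) (u : ℝ≥0) :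
    MeasurableSpace Ω :=
  MeasurableSpace.comap (fun ω (p : {p : (Σ n : ℕ, Fin (2 ^ n)) × ℝ≥0 //
    p.1.1 < m ∨ p.1.1 = m ∧ p.2 ≤ u}) => W p.1.1.1 p.1.1.2 p.1.2 ω) inferInstance

/-- The σ-algebra generated by the whole noise. -/
@[reducible] def noiseAlgebra (W : (m : ℕ) → Fin (2 ^ m) → ℝ≥0 → Ω → Space d) :
    MeasurableSpace Ω :=
  MeasurableSpace.comap (fun ω (p : (Σ n : ℕ, Fin (2 ^ n)) × ℝ≥0) => W p.1.1 p.1.2 p.2 ω)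
    inferInstance

variable {W : (m : ℕ) → Fin (2 ^ m) → ℝ≥0 → Ω → Space d}

lemma measurable_noisePast {m n : ℕ} {u τ : ℝ≥0} (j : Fin (2 ^ n))
    (h : n < m ∨ n = m ∧ τ ≤ u) : Measurable[noisePast W m u] (W n j τ) :=
  measurable_comap_apply (fun ω (p : {p : (Σ n : ℕ, Fin (2 ^ n)) × ℝ≥0 //
    p.1.1 < m ∨ p.1.1 = m ∧ p.2 ≤ u}) => W p.1.1.1 p.1.1.2 p.1.2 ω) ⟨(⟨n, j⟩, τ), h⟩

lemma noisePast_le {m : ℕ} {u : ℝ≥0} {m' : MeasurableSpace Ω}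
    (h : ∀ n j τ, (n < m ∨ n = m ∧ τ ≤ u) → Measurable[m'] (W n j τ)) :
    noisePast W m u ≤ m' :=
  Measurable.comap_le (measurable_pi_lambda _ fun p => h p.1.1.1 p.1.1.2 p.1.2 p.2)

lemma noisePast_mono {m n : ℕ} {u v : ℝ≥0} (h : m < n ∨ m = n ∧ u ≤ v) :
    noisePast W m u ≤ noisePast W n v :=
  noisePast_le fun l j τ hl => measurable_noisePast j (by
    rcases h with h | ⟨rfl, h⟩ <;> rcases hl with hl | ⟨rfl, hl⟩
    · exact Or.inl (hl.trans h)
    · exact Or.inl h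
    · exact Or.inl hl
    · exact Or.inr ⟨rfl, hl.trans h⟩)

lemma measurable_noiseAlgebra (n : ℕ) (j : Fin (2 ^ n)) (τ : ℝ≥0) :
    Measurable[noiseAlgebra W] (W n j τ) :=
  measurable_comap_apply (fun ω (p : (Σ n : ℕ, Fin (2 ^ n)) × ℝ≥0) =>
    W p.1.1 p.1.2 p.2 ω) (⟨n, j⟩, τ)

lemma noisePast_le_noiseAlgebra (m : ℕ) (u : ℝ≥0) : noisePast W m u ≤ noiseAlgebra W :=
  noisePast_le fun n j τ _ => measurable_noiseAlgebra n j τ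

variable {m' : MeasurableSpace Ω} [mΩ : MeasurableSpace Ω] {Q : Measure Ω}

lemma covariance_of_isCorrelatedBrownian {ι : Type*} {C : Matrix ι ι ℝ} {V : ι → ℝ≥0 → Ω → Space d}
    (hV : IsCorrelatedBrownian C V Q) (i j : ι) (s t : ℝ≥0) (k l : Fin d) :
    cov[fun ω => V i s ω k, fun ω => V j t ω l; Q] =
      min (s : ℝ) t * C i j * (if k = l then 1 else 0) := by
  have : IsProbabilityMeasure Q := hV.gaussian.isProbabilityMeasure
  have h := hV.covariance i j s t k l
  rw [covariance_eq_sub (hV.gaussian.hasGaussianLaw_eval (s, i, k)).memLp_two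
    (hV.gaussian.hasGaussianLaw_eval (t, j, l)).memLp_two, hV.mean i s k, zero_mul, sub_zero]
  exact h

lemma measurable_coord (k : Fin d) : Measurable fun x : Space d => x k := by fun_prop

lemma isGaussianProcess_noise
    (hW : ∀ m, IsCorrelatedBrownian (centeringMatrix m) (W m) Q)
    (hind : iIndepFun (fun (m : ℕ) ω (i : Fin (2 ^ m)) (τ : ℝ≥0) => W m i τ ω) Q) :
    IsGaussianProcess (fun (p : (n : ℕ) × (ℝ≥0 × Fin (2 ^ n) × Fin d)) ω =>
      W p.1 p.2.2.1 p.2.1 ω p.2.2.2) Q :=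
  iIndepFun.isGaussianProcess_sigma
    (X := fun (n : ℕ) (a : ℝ≥0 × Fin (2 ^ n) × Fin d) ω => W n a.2.1 a.1 ω a.2.2)
    (fun _ => (hW _).gaussian)
    (hind.comp (fun (n : ℕ) (x : Fin (2 ^ n) → ℝ≥0 → Space d) (a : ℝ≥0 × Fin (2 ^ n) × Fin d) =>
        x a.2.1 a.1 a.2.2) fun _ => measurable_pi_lambda _ fun a =>
        (measurable_coord a.2.2).comp
          ((measurable_pi_apply a.1).comp (measurable_pi_apply a.2.1)))

lemma covariance_noise
    (hW : ∀ m, IsCorrelatedBrownian (centeringMatrix m) (W m) Q)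
    (hind : iIndepFun (fun (m : ℕ) ω (i : Fin (2 ^ m)) (τ : ℝ≥0) => W m i τ ω) Q) {m n : ℕ}
    (hmn : m ≠ n) (i : Fin (2 ^ m)) (j : Fin (2 ^ n)) (s t : ℝ≥0) (k l : Fin d) :
    cov[fun ω => W m i s ω k, fun ω => W n j t ω l; Q] = 0 := by
  have h := (hind.indepFun hmn).comp
    (φ := fun x : Fin (2 ^ m) → ℝ≥0 → Space d => x i s k)
    (ψ := fun x : Fin (2 ^ n) → ℝ≥0 → Space d => x j t l)
    ((measurable_coord k).comp ((measurable_pi_apply s).comp (measurable_pi_apply i)))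
    ((measurable_coord l).comp ((measurable_pi_apply t).comp (measurable_pi_apply j)))
  exact h.covariance_eq_zero ((hW m).gaussian.hasGaussianLaw_eval (s, i, k)).memLp_two
    ((hW n).gaussian.hasGaussianLaw_eval (t, j, l)).memLp_two

/-- The increments of the noise are independent of its past. -/
lemma indep_noisePast_increment
    (hW : ∀ m, IsCorrelatedBrownian (centeringMatrix m) (W m) Q)
    (hind : iIndepFun (fun (m : ℕ) ω (i : Fin (2 ^ m)) (τ : ℝ≥0) => W m i τ ω) Q)
    (m : ℕ) (i : Fin (2 ^ m)) {u v : ℝ≥0} (huv : u ≤ v) :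
    Indep (noisePast W m u)
      (MeasurableSpace.comap (fun ω => W m i v ω - W m i u ω) inferInstance) Q := by
  classical
  have hprob : IsProbabilityMeasure Q := (hW 0).gaussian.isProbabilityMeasure
  have hG := isGaussianProcess_noise hW hind
  have h : IndepFun
      (fun ω (p : {p : (Σ n : ℕ, Fin (2 ^ n)) × ℝ≥0 // p.1.1 < m ∨ p.1.1 = m ∧ p.2 ≤ u} × Fin d) =>
        W p.1.1.1.1 p.1.1.1.2 p.1.1.2 ω p.2)
      (fun ω (k : Fin d) => W m i v ω k - W m i u ω k) Q := by
    refine IsGaussianProcess.indepFun_of_covariance_eq_zero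
      (X := fun (p : {p : (Σ n : ℕ, Fin (2 ^ n)) × ℝ≥0 //
        p.1.1 < m ∨ p.1.1 = m ∧ p.2 ≤ u} × Fin d) ω => W p.1.1.1.1 p.1.1.1.2 p.1.1.2 ω p.2)
      (Y := fun (k : Fin d) ω => W m i v ω k - W m i u ω k) ?_ (fun p => ?_) (fun k => ?_) ?_
    · refine hG.of_isGaussianProcess ?_
      rintro (p | k)
      · exact ⟨{⟨p.1.1.1.1, p.1.1.2, p.1.1.1.2, p.2⟩},
          ContinuousLinearMap.proj (R := ℝ) (φ := fun _ => ℝ) ⟨_, Finset.mem_singleton_self _⟩,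
          fun ω => rfl⟩
      · exact ⟨{⟨m, v, i, k⟩, ⟨m, u, i, k⟩},
          ContinuousLinearMap.proj (R := ℝ) (φ := fun _ => ℝ) ⟨⟨m, v, i, k⟩, by simp⟩ -
          ContinuousLinearMap.proj (R := ℝ) (φ := fun _ => ℝ) ⟨⟨m, u, i, k⟩, by simp⟩,
          fun ω => rfl⟩
    · exact (hG.hasGaussianLaw_eval ⟨p.1.1.1.1, p.1.1.2, p.1.1.1.2, p.2⟩).aemeasurable
    · exact ((hG.hasGaussianLaw_eval ⟨m, v, i, k⟩).aemeasurable).sub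
        ((hG.hasGaussianLaw_eval ⟨m, u, i, k⟩).aemeasurable)
    · rintro ⟨⟨⟨⟨n, j⟩, τ⟩, hτ⟩, l⟩ k
      have hLp : ∀ n (j : Fin (2 ^ n)) τ l, MemLp (fun ω => W n j τ ω l) 2 Q := fun n j τ l =>
        (hG.hasGaussianLaw_eval ⟨n, τ, j, l⟩).memLp_two
      rw [covariance_fun_sub_right (hLp _ _ _ _) (hLp _ _ _ _) (hLp _ _ _ _)]
      -- Earlier generations are uncorrelated with generation `m`. Within it, `τ ≤ u ≤ v` gives `min
      -- τ v = min τ u = τ`, so the two covariances cancel.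
      rcases hτ with hn | ⟨hn, hτu⟩
      · rw [covariance_noise hW hind (ne_of_lt hn), covariance_noise hW hind (ne_of_lt hn),
          sub_zero]
      · simp only at hn hτu
        subst hn
        rw [covariance_of_isCorrelatedBrownian (hW n), covariance_of_isCorrelatedBrownian (hW n),
          min_eq_left (by exact_mod_cast hτu.trans huv), min_eq_left (by exact_mod_cast hτu),
          sub_self]
  have h' := h.comp
    (φ := fun x (p : {p : (Σ n : ℕ, Fin (2 ^ n)) × ℝ≥0 //
      p.1.1 < m ∨ p.1.1 = m ∧ p.2 ≤ u}) => (WithLp.toLp 2 (fun k => x (p, k)) : Space d))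
    (ψ := fun x : Fin d → ℝ => (WithLp.toLp 2 x : Space d))
    (measurable_pi_lambda _ fun p => measurable_coords fun k => measurable_pi_apply _)
    (measurable_coords fun k => measurable_pi_apply _)
  exact (IndepFun_iff_Indep _ _ _).1 h'

/-- Paths are continuous only almost surely, so they are set to zero off a measurable set of full
measure, and they are stopped at `u` so that only the past enters. The modified paths are continuous
everywhere, and their integral is measurable for the completed past. -/
lemma aemeasurable_path_integral {V : ℝ≥0 → Ω → Space d}
    (hV : ∀ τ, Measurable (V τ)) (hc : ∀ᵐ ω ∂Q, Continuous fun τ => V τ ω) (u : ℝ≥0)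
    (hV' : ∀ τ ≤ u, Measurable[aeCompletion m' Q] (V τ)) (γ : ℝ) :
    ∃ J : Ω → Space d, Measurable[aeCompletion m' Q] J ∧
      (fun ω => ∫ s in (0 : ℝ)..u, Real.exp (γ * s) • V s.toNNReal ω) =ᵐ[Q] J := by
  classical
  obtain ⟨G, hGc, hGm, hG⟩ := hc.exists_measurable_mem
  let g : ℝ → Ω → Space d := fun s ω =>
    Real.exp (γ * s) • G.indicator (V (min s.toNNReal u)) ω
  have hgm : ∀ s, Measurable[aeCompletion m' Q] (g s) := by
    intro s
    have h1 : Measurable[aeCompletion m' Q] (G.indicator (V (min s.toNNReal u))) := by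
      refine measurable_aeCompletion_of_ae_eq (hV' (min s.toNNReal u) (min_le_right _ _))
        ((hV _).indicator hGm) ?_
      filter_upwards [hGc] with ω hω
      rw [Set.indicator_of_mem hω]
    exact h1.const_smul (Real.exp (γ * s))
  have hgc : ∀ ω, Continuous fun s => g s ω := by
    intro ω
    by_cases hω : ω ∈ G
    · simp only [g, Set.indicator_of_mem hω]
      have := hG ω hω
      fun_prop
    · simp only [g, Set.indicator_of_notMem hω, smul_zero]
      exact continuous_const
  refine ⟨_, measurable_intervalIntegral_of_continuous hgm hgc 0 u, ?_⟩
  filter_upwards [hGc] with ω hω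
  refine intervalIntegral.integral_congr fun s hs => ?_
  rw [Set.uIcc_of_le u.coe_nonneg] at hs
  have : min s.toNNReal u = s.toNNReal := min_eq_left (Real.toNNReal_le_iff_le_coe.2 hs.2)
  simp only [g, Set.indicator_of_mem hω, this]

end NoisePast

/-! ### Adaptedness of the Ornstein–Uhlenbeck system to its noise -/

section OUPaths

variable {Ω : Type*} {d : ℕ} {γ : ℝ}
  {W : (m : ℕ) → Fin (2 ^ m) → ℝ≥0 → Ω → Space d} {Y : ℝ → ℕ → Ω → Space d}

/-- The solution of the Ornstein–Uhlenbeck equation, started at time `m + u`. -/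
lemma ou_path_eq {ω : Ω} {m : ℕ} {i : Fin (2 ^ m)}
    (hc : ContinuousOn (fun t => Y t i ω) (Set.Ico (m : ℝ) (m + 1)))
    (hWc : Continuous fun τ => W m i τ ω)
    (hs : ∀ τ : ℝ≥0, τ < 1 →
      Y (m + τ) i ω = Y m i ω + W m i τ ω - γ • ∫ s in (0 : ℝ)..τ, Y (m + s) i ω)
    (u h : ℝ≥0) (huh : u + h < 1) :
    Y (m + u + h) i ω = Real.exp (-(γ * h)) • (Y (m + u) i ω - γ • ∫ s in (0 : ℝ)..h,
      Real.exp (γ * s) • (W m i (u + s.toNNReal) ω - W m i u ω)) +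
      (W m i (u + h) ω - W m i u ω) := by
  have huh' : (u : ℝ) + h < 1 := by exact_mod_cast huh
  have hI : ∀ a b : ℝ, 0 ≤ a → a < 1 → 0 ≤ b → b < 1 →
      IntervalIntegrable (fun s => Y (m + s) i ω) volume a b := by
    intro a b ha0 ha hb0 hb
    refine (hc.comp (by fun_prop) fun s hs => ?_).intervalIntegrable
    rw [Set.mem_uIcc] at hs
    rcases hs with hs | hs <;> exact add_mem_Ico m (by linarith) (by linarith)
  have key := linear_equation_solution (y := fun s => Y (m + u + s) i ω)
    (w := fun s => W m i (u + s.toNNReal) ω - W m i u ω) (γ := γ) (T := 1 - u)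
    (y₀ := Y (m + u) i ω) ?_ (by fun_prop) ?_ (τ := h) ⟨h.coe_nonneg, by linarith⟩
  · simpa using key
  · refine hc.comp (by fun_prop) fun s hs => ?_
    rw [add_assoc]
    exact add_mem_Ico m (by linarith [u.coe_nonneg, hs.1]) (by linarith [hs.2])
  · intro s hs'
    have hs0 := hs'.1
    have hs1 := hs'.2
    have hu0 := u.coe_nonneg
    have e1 := hs (u + s.toNNReal) (by
      rw [← NNReal.coe_lt_coe]
      push_cast
      rw [Real.coe_toNNReal _ hs0]
      linarith)
    have e2 := hs u (lt_of_le_of_lt (by simp) huh)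
    push_cast at e1
    rw [Real.coe_toNNReal _ hs0] at e1
    have e3 := intervalIntegral.integral_add_adjacent_intervals
      (hI 0 u le_rfl (by linarith) hu0 (by linarith))
      (hI u (u + s) hu0 (by linarith) (by linarith) (by linarith))
    have e4 : ∫ r in (0 : ℝ)..s, Y (m + u + r) i ω =
        ∫ r in (u : ℝ)..(u + s), Y (m + r) i ω := by
      have := intervalIntegral.integral_comp_add_left (fun r => Y (m + r) i ω) (a := 0) (b := s)
        (u : ℝ)
      simpa [add_assoc] using this
    rw [add_assoc, e1, e2, e4, ← e3]
    module

variable [mΩ : MeasurableSpace Ω] {Q : Measure Ω}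

lemma measurable_ou_of_measurable_start
    (hY : IsDyadicSystem Y Q) (hWm : ∀ m i τ, Measurable (W m i τ))
    (hWc : ∀ᵐ ω ∂Q, ∀ m i, Continuous fun τ => W m i τ ω)
    (hs : ∀ᵐ ω ∂Q, ∀ (m : ℕ) (i : Fin (2 ^ m)) (τ : ℝ≥0), τ < 1 →
      Y (m + τ) i ω = Y m i ω + W m i τ ω - γ • ∫ s in (0 : ℝ)..τ, Y (m + s) i ω)
    {m : ℕ} (h0 : ∀ i < 2 ^ m, Measurable[aeCompletion (noisePast W m 0) Q] (Y m i))
    {u : ℝ≥0} (hu : u < 1) {i : ℕ} (hi : i < 2 ^ m) :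
    Measurable[aeCompletion (noisePast W m u) Q] (Y (m + u) i) := by
  have hu' : (u : ℝ) < 1 := by exact_mod_cast hu
  have hle : noisePast W m u ≤ mΩ := noisePast_le fun n j τ _ => hWm n j τ
  have hmW : ∀ τ ≤ u, Measurable[aeCompletion (noisePast W m u) Q]
      (fun ω => W m ⟨i, hi⟩ τ ω - W m ⟨i, hi⟩ 0 ω) := fun τ hτ =>
    ((measurable_noisePast _ (Or.inr ⟨rfl, hτ⟩)).mono (le_aeCompletion hle) le_rfl).sub
      ((measurable_noisePast _ (Or.inr ⟨rfl, by simp⟩)).mono (le_aeCompletion hle) le_rfl)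
  obtain ⟨J, hJm, hJ⟩ := aemeasurable_path_integral (m' := noisePast W m u) (Q := Q)
    (V := fun τ ω => W m ⟨i, hi⟩ τ ω - W m ⟨i, hi⟩ 0 ω)
    (fun τ => (hWm _ _ _).sub (hWm _ _ _))
    (by filter_upwards [hWc] with ω hω; have := hω m ⟨i, hi⟩; fun_prop) u hmW γ
  have hY0 : Measurable[aeCompletion (noisePast W m u) Q] (Y m i) :=
    (h0 i hi).mono (aeCompletion_mono (noisePast_mono (Or.inr ⟨rfl, by simp⟩))) le_rfl
  have hmeas : Measurable[aeCompletion (noisePast W m u) Q] (fun ω =>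
      Real.exp (-(γ * u)) • (Y m i ω - γ • J ω) +
        (W m ⟨i, hi⟩ u ω - W m ⟨i, hi⟩ 0 ω)) :=
    ((hY0.sub (hJm.const_smul γ)).const_smul (Real.exp (-(γ * u)))).add (hmW u le_rfl)
  refine measurable_aeCompletion_of_ae_eq hmeas (hY.measurable _ (by positivity) i
    (by rwa [numParticles_of_mem_Ico (add_mem_Ico m u.coe_nonneg hu')])) ?_
  filter_upwards [hJ, hs, hY.continuous, hWc] with ω h1 h2 h3 h4
  have := ou_path_eq (i := ⟨i, hi⟩) (h3 m i hi) (h4 m ⟨i, hi⟩) (h2 m ⟨i, hi⟩) 0 u (by simpa using hu)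
  simp only [NNReal.coe_zero, add_zero, zero_add] at this
  rw [this, ← h1]

/-- Induction over generations: the explicit solution carries measurability through a generation,
and the position of a newborn is the left limit of that of its parent. -/
lemma measurable_ou_start
    (hY : IsDyadicSystem Y Q) (hWm : ∀ m i τ, Measurable (W m i τ))
    (hWc : ∀ᵐ ω ∂Q, ∀ m i, Continuous fun τ => W m i τ ω)
    (hs : ∀ᵐ ω ∂Q, ∀ (m : ℕ) (i : Fin (2 ^ m)) (τ : ℝ≥0), τ < 1 →
      Y (m + τ) i ω = Y m i ω + W m i τ ω - γ • ∫ s in (0 : ℝ)..τ, Y (m + s) i ω)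
    (m : ℕ) : ∀ i < 2 ^ m, Measurable[aeCompletion (noisePast W m 0) Q] (Y m i) := by
  induction m with
  | zero =>
    intro i hi
    obtain rfl : i = 0 := by simpa using hi
    refine measurable_aeCompletion_of_ae_eq (g := fun _ => (0 : Space d))
      (@measurable_const _ _ _ (_) _) (hY.measurable _ (by simp) 0 (by simp [numParticles])) ?_
    filter_upwards [hY.start] with ω h
    simpa using h
  | succ m ih =>
    intro i hi
    -- These times increase to `1` but stay strictly below it, where the equation of generation `m`
    -- is valid.
    let u : ℕ → ℝ≥0 := fun n => 1 - (n + 2 : ℝ≥0)⁻¹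
    have hu1 : ∀ n, u n < 1 := fun n =>
      tsub_lt_self one_pos (by positivity)
    have hi2 : i / 2 < 2 ^ m := by rw [pow_succ] at hi; omega
    have hm : ∀ n, Measurable[aeCompletion (noisePast W (m + 1) 0) Q] (Y (m + u n) (i / 2)) :=
      fun n => (measurable_ou_of_measurable_start hY hWm hWc hs ih (hu1 n) hi2).mono
        (aeCompletion_mono (noisePast_mono (Or.inl m.lt_succ_self))) le_rfl
    refine measurable_aeCompletion_of_tendsto hm
      (hY.measurable _ (by positivity) i (by rwa [numParticles_natCast])) ?_
    have hlim : Tendsto (fun n => (m : ℝ) + u n) atTop (𝓝[<] ((m : ℝ) + 1)) := by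
      refine tendsto_nhdsWithin_iff.2 ⟨?_, Eventually.of_forall fun n => ?_⟩
      · have hcoe : ∀ n : ℕ, (m : ℝ) + u n = m + (1 - ((n : ℝ) + 2)⁻¹) := fun n => by
          have : ((n : ℝ≥0) + 2)⁻¹ ≤ 1 := inv_le_one_of_one_le₀ (by
            exact le_add_of_nonneg_of_le (by positivity) (by norm_num))
          simp only [u]
          rw [NNReal.coe_sub this]
          push_cast
          rfl
        simp_rw [hcoe]
        have h1 : Tendsto (fun n : ℕ => ((n : ℝ) + 2)⁻¹) atTop (𝓝 0) :=
          (tendsto_atTop_add_const_right _ 2 tendsto_natCast_atTop_atTop).inv_tendsto_atTop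
        simpa using (h1.const_sub 1).const_add (m : ℝ)
      · have : (u n : ℝ) < 1 := by exact_mod_cast hu1 n
        simpa using this
    filter_upwards [hY.fission] with ω hω
    have := (hω m i hi).comp hlim
    push_cast
    exact this

/-- A branching Ornstein–Uhlenbeck process is adapted to the completed filtration of its noise. -/
lemma history_le_noisePast
    (hY : IsDyadicSystem Y Q) (hWm : ∀ m i τ, Measurable (W m i τ))
    (hWc : ∀ᵐ ω ∂Q, ∀ m i, Continuous fun τ => W m i τ ω)
    (hs : ∀ᵐ ω ∂Q, ∀ (m : ℕ) (i : Fin (2 ^ m)) (τ : ℝ≥0), τ < 1 →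
      Y (m + τ) i ω = Y m i ω + W m i τ ω - γ • ∫ s in (0 : ℝ)..τ, Y (m + s) i ω)
    {m : ℕ} {u : ℝ≥0} (hu : u < 1) :
    history Y (m + u) ≤ aeCompletion (noisePast W m u) Q := by
  refine iSup₂_le fun s hs' => iSup₂_le fun i hi => ?_
  have hfl := mem_Ico_floor hs'.1
  set n := ⌊s⌋₊
  have hv : (((s - n).toNNReal : ℝ≥0) : ℝ) = s - n := Real.coe_toNNReal _ (by linarith [hfl.1])
  have hv1 : (s - n).toNNReal < 1 := by
    rw [← NNReal.coe_lt_coe, hv]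
    push_cast
    linarith [hfl.2]
  have hs2 : s = n + (s - n).toNNReal := by rw [hv]; ring
  rw [numParticles_of_mem_Ico hfl] at hi
  have hu' : (u : ℝ) < 1 := by exact_mod_cast hu
  have hY1 := measurable_ou_of_measurable_start hY hWm hWc hs (measurable_ou_start hY hWm hWc hs n) hv1 hi
  rw [← hs2] at hY1
  refine (hY1.mono (aeCompletion_mono (noisePast_mono ?_)) le_rfl).comap_le
  have hnm : n ≤ m := by
    have : (n : ℝ) < m + 1 := by linarith [hfl.1, hs'.2]
    exact Nat.lt_succ_iff.1 (by exact_mod_cast this)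
  rcases hnm.lt_or_eq with h | h
  · exact Or.inl h
  · refine Or.inr ⟨h, ?_⟩
    rw [← NNReal.coe_le_coe, hv, h]
    linarith [hs'.2]

end OUPaths

/-! ### Derivatives of test functions -/

section Calculus

variable {d : ℕ} {f : Space d → ℝ}

lemma contDiff_fderiv (hf : ContDiff ℝ (⊤ : ℕ∞) f) : ContDiff ℝ (⊤ : ℕ∞) (fderiv ℝ f) :=
  hf.fderiv_right (by simp)

lemma contDiff_fderiv_fderiv (hf : ContDiff ℝ (⊤ : ℕ∞) f) :
    ContDiff ℝ (⊤ : ℕ∞) (fderiv ℝ (fderiv ℝ f)) :=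
  (contDiff_fderiv hf).fderiv_right (by simp)

lemma laplacian_eq_sum_fderiv (f : Space d → ℝ) (x : Space d) :
    Laplacian.laplacian f x = ∑ k, fderiv ℝ (fderiv ℝ f) x
      (EuclideanSpace.basisFun (Fin d) ℝ k) (EuclideanSpace.basisFun (Fin d) ℝ k) := by
  rw [InnerProductSpace.laplacian_eq_iteratedFDeriv_orthonormalBasis f
    (EuclideanSpace.basisFun (Fin d) ℝ)]
  simp [iteratedFDeriv_two_apply]

lemma generatorOU_eq (σ γ : ℝ) (f : Space d → ℝ) (x : Space d) :
    generatorOU σ γ f x = 1 / 2 * σ * Laplacian.laplacian f x - γ * fderiv ℝ f x x := by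
  rw [generatorOU, real_inner_comm, inner_gradient_left]

lemma fderiv_fderiv_apply_eq_sum (f : Space d → ℝ) (x w : Space d) :
    fderiv ℝ (fderiv ℝ f) x w w = ∑ k, ∑ l, w k * w l * fderiv ℝ (fderiv ℝ f) x
      (EuclideanSpace.basisFun (Fin d) ℝ k) (EuclideanSpace.basisFun (Fin d) ℝ l) := by
  conv_lhs => rw [← (EuclideanSpace.basisFun (Fin d) ℝ).sum_repr w]
  simp only [map_sum, map_smul, sum_apply, smul_apply, smul_eq_mul,
    EuclideanSpace.basisFun_repr]
  rw [Finset.sum_comm]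
  refine Finset.sum_congr rfl fun k _ => ?_
  simp only [Finset.mul_sum]
  exact Finset.sum_congr rfl fun l _ => by ring

lemma fderiv_apply_eq_sum (f : Space d → ℝ) (x w : Space d) :
    fderiv ℝ f x w = ∑ k, w k * fderiv ℝ f x (EuclideanSpace.basisFun (Fin d) ℝ k) := by
  conv_lhs => rw [← (EuclideanSpace.basisFun (Fin d) ℝ).sum_repr w]
  simp [map_sum, map_smul]

/-- Taylor's formula of order two with a uniform remainder. -/
lemma exists_taylor_bound (hf : ContDiff ℝ (⊤ : ℕ∞) f) (hc : HasCompactSupport f) :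
    ∃ C : ℝ, 0 ≤ C ∧ ∀ x w : Space d,
      |f (x + w) - f x - fderiv ℝ f x w - 1 / 2 * fderiv ℝ (fderiv ℝ f) x w w| ≤ C * ‖w‖ ^ 3 := by
  have hcs : HasCompactSupport (fderiv ℝ (fderiv ℝ f)) := (hc.fderiv ℝ).fderiv ℝ
  obtain ⟨C, hC⟩ : ∃ C, LipschitzWith C (fderiv ℝ (fderiv ℝ f)) :=
    ContDiff.lipschitzWith_of_hasCompactSupport (𝕂 := ℝ) (n := ((⊤ : ℕ∞) : WithTop ℕ∞))
      hcs (contDiff_fderiv_fderiv hf) (by simp)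
  refine ⟨C, C.2, fun x w => ?_⟩
  have hline : ∀ t : ℝ, HasDerivAt (fun t : ℝ => x + t • w) w t := fun t => by
    simpa using ((hasDerivAt_id t).smul_const w).const_add x
  have h1 : ∀ t : ℝ, HasDerivAt (fun t : ℝ => f (x + t • w)) (fderiv ℝ f (x + t • w) w) t :=
    fun t => ((hf.differentiable (by simp) _).hasFDerivAt).comp_hasDerivAt t (hline t)
  have h2 : ∀ t : ℝ, HasDerivAt (fun t : ℝ => fderiv ℝ f (x + t • w) w)
      (fderiv ℝ (fderiv ℝ f) (x + t • w) w w) t := fun t =>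
    (((contDiff_fderiv hf).differentiable (by simp) _).hasFDerivAt.comp_hasDerivAt t
      (hline t)).clm_apply (hasDerivAt_const t w) |>.congr_deriv (by simp)
  -- The mean value inequality is used twice along the segment from `x` to `x + w`: here for the
  -- first derivative, by the Lipschitz bound on the second, and in `hr` for `f` itself.
  have hq : ∀ t ∈ Set.Icc (0 : ℝ) 1, ‖fderiv ℝ f (x + t • w) w - fderiv ℝ f x w -
      t * fderiv ℝ (fderiv ℝ f) x w w‖ ≤ C * ‖w‖ ^ 3 := by
    intro t ht
    have hd : ∀ s ∈ Set.Icc (0 : ℝ) 1, HasDerivWithinAt (fun s : ℝ => fderiv ℝ f (x + s • w) w -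
        fderiv ℝ f x w - s * fderiv ℝ (fderiv ℝ f) x w w)
        (fderiv ℝ (fderiv ℝ f) (x + s • w) w w - fderiv ℝ (fderiv ℝ f) x w w)
        (Set.Icc 0 1) s := fun s _ => by
      have := ((h2 s).sub_const (fderiv ℝ f x w)).sub
        ((hasDerivAt_id s).mul_const (fderiv ℝ (fderiv ℝ f) x w w))
      exact (this.congr_deriv (by simp)).hasDerivWithinAt
    have hb : ∀ s ∈ Set.Icc (0 : ℝ) 1, ‖fderiv ℝ (fderiv ℝ f) (x + s • w) w w -
        fderiv ℝ (fderiv ℝ f) x w w‖ ≤ C * ‖w‖ ^ 3 := fun s hs => by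
      have h3 := hC.dist_le_mul (x + s • w) x
      rw [dist_eq_norm, dist_eq_norm, add_sub_cancel_left, norm_smul, Real.norm_eq_abs,
        abs_of_nonneg hs.1] at h3
      have h4 := (fderiv ℝ (fderiv ℝ f) (x + s • w) - fderiv ℝ (fderiv ℝ f) x).le_opNorm w
      have h5 := ((fderiv ℝ (fderiv ℝ f) (x + s • w) - fderiv ℝ (fderiv ℝ f) x) w).le_opNorm w
      have h6 : s * ‖w‖ ≤ ‖w‖ := mul_le_of_le_one_left (norm_nonneg _) hs.2
      calc _ ≤ ‖fderiv ℝ (fderiv ℝ f) (x + s • w) - fderiv ℝ (fderiv ℝ f) x‖ * ‖w‖ * ‖w‖ :=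
            h5.trans (by gcongr)
        _ ≤ C * ‖w‖ * ‖w‖ * ‖w‖ := by
            gcongr
            exact h3.trans (by gcongr)
        _ = C * ‖w‖ ^ 3 := by ring
    have := (convex_Icc (0 : ℝ) 1).norm_image_sub_le_of_norm_hasDerivWithin_le hd hb
      (Set.left_mem_Icc.2 zero_le_one) ht
    simp only [zero_smul, add_zero, sub_self, zero_mul, sub_zero, Real.norm_eq_abs t,
      abs_of_nonneg ht.1] at this
    exact this.trans (mul_le_of_le_one_right (by positivity) ht.2)
  have hr := norm_image_sub_le_of_norm_deriv_le_segment_01'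
    (f := fun t : ℝ => f (x + t • w) - f x - t * fderiv ℝ f x w -
      1 / 2 * t ^ 2 * fderiv ℝ (fderiv ℝ f) x w w)
    (f' := fun t => fderiv ℝ f (x + t • w) w - fderiv ℝ f x w -
      t * fderiv ℝ (fderiv ℝ f) x w w) (C := C * ‖w‖ ^ 3) (fun t _ => by
      have := (((h1 t).sub_const (f x)).sub ((hasDerivAt_id t).mul_const (fderiv ℝ f x w))).sub
        ((((hasDerivAt_id t).pow 2).const_mul (1 / 2 : ℝ)).mul_const
          (fderiv ℝ (fderiv ℝ f) x w w))
      exact (this.congr_deriv (by simp)).hasDerivWithinAt)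
    (fun t ht => hq t ⟨ht.1, ht.2.le⟩)
  simpa using hr

end Calculus

/-! ### Gaussian moments and the Taylor expansion under independence -/

section Moments

variable {Ω : Type*} {m' : MeasurableSpace Ω} [mΩ : MeasurableSpace Ω] {Q : Measure Ω} {d : ℕ}

lemma integrable_abs_pow_gaussianReal (v : ℝ≥0) (n : ℕ) :
    Integrable (fun x : ℝ => |x| ^ n) (gaussianReal 0 v) := by
  have := (memLp_id_gaussianReal (μ := 0) (v := v) n).integrable_norm_pow'
  simpa using this

lemma integral_abs_pow_gaussianReal (v : ℝ≥0) (n : ℕ) :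
    ∫ x, |x| ^ n ∂(gaussianReal 0 v) = √v ^ n * ∫ x, |x| ^ n ∂(gaussianReal 0 1) := by
  have h : gaussianReal 0 v = (gaussianReal 0 1).map (fun x => √v * x) := by
    rw [gaussianReal_map_const_mul]
    congr 1
    · simp
    · ext
      simp [Real.sq_sqrt]
  rw [h, integral_map (by fun_prop) (by fun_prop), ← integral_const_mul]
  refine integral_congr_ae (Eventually.of_forall fun x => ?_)
  simp only
  rw [abs_mul, mul_pow, abs_of_nonneg (Real.sqrt_nonneg _)]

/-- A constant which bounds the absolute moments of isotropic Gaussian vectors. -/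
noncomputable def gaussianMoment (d n : ℕ) : ℝ :=
  (d : ℝ) ^ n * (d * ∫ x, |x| ^ (n + 1) ∂(gaussianReal 0 1))

lemma norm_pow_le_sum (x : Space d) (n : ℕ) :
    ‖x‖ ^ (n + 1) ≤ (d : ℝ) ^ n * ∑ k, |x k| ^ (n + 1) := by
  refine (pow_le_pow_left₀ (norm_nonneg _) (norm_le_sum_abs x) _).trans ?_
  have := pow_sum_le_card_mul_sum_pow (s := Finset.univ) (f := fun k => |x k|)
    (fun k _ => abs_nonneg _) n
  simpa using this

lemma integral_norm_pow_le {V : Ω → Space d} (hV : Measurable V) {v : ℝ≥0}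
    (hlaw : ∀ k, Q.map (fun ω => V ω k) = gaussianReal 0 v) (n : ℕ) :
    Integrable (fun ω => ‖V ω‖ ^ (n + 1)) Q ∧
      ∫ ω, ‖V ω‖ ^ (n + 1) ∂Q ≤ gaussianMoment d n * √v ^ (n + 1) := by
  have hk : ∀ k, Measurable fun ω => V ω k := fun k => (measurable_coord k).comp hV
  have hi : ∀ k, Integrable (fun ω => |V ω k| ^ (n + 1)) Q := fun k => by
    have := integrable_abs_pow_gaussianReal v (n + 1)
    rw [← hlaw k] at this
    exact this.comp_measurable (hk k)
  have hI : ∀ k, ∫ ω, |V ω k| ^ (n + 1) ∂Q =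
      √v ^ (n + 1) * ∫ x, |x| ^ (n + 1) ∂(gaussianReal 0 1) := fun k => by
    rw [← integral_abs_pow_gaussianReal, ← hlaw k,
      integral_map (hk k).aemeasurable (by fun_prop)]
  have hS : Integrable (fun ω => (d : ℝ) ^ n * ∑ k, |V ω k| ^ (n + 1)) Q :=
    (integrable_finsetSum _ fun k _ => hi k).const_mul _
  have hint : Integrable (fun ω => ‖V ω‖ ^ (n + 1)) Q :=
    hS.mono' (hV.norm.pow_const _).aestronglyMeasurable (Eventually.of_forall fun ω => by
      rw [Real.norm_of_nonneg (by positivity)]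
      exact norm_pow_le_sum _ _)
  refine ⟨hint, (integral_mono hint hS fun ω => norm_pow_le_sum _ _).trans (le_of_eq ?_)⟩
  rw [integral_const_mul, integral_finsetSum _ fun k _ => hi k]
  simp_rw [hI]
  simp only [Finset.sum_const, Finset.card_univ, Fintype.card_fin, nsmul_eq_mul, gaussianMoment]
  ring

/-- The second order expansion of `E[f(X + V); A]` for a small centred Gaussian vector `V`
which is independent of `X` and `A`. -/
lemma abs_setIntegral_taylor_le [IsProbabilityMeasure Q] {f : Space d → ℝ}
    (hf : ContDiff ℝ (⊤ : ℕ∞) f)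
    (hc : HasCompactSupport f) {C : ℝ} (hC0 : 0 ≤ C) (hC : ∀ x w : Space d,
      |f (x + w) - f x - fderiv ℝ f x w - 1 / 2 * fderiv ℝ (fderiv ℝ f) x w w| ≤ C * ‖w‖ ^ 3)
    (hm' : m' ≤ mΩ) {X V : Ω → Space d} {A : Set Ω} {v : ℝ≥0}
    (hX : Measurable[m'] X) (hA : MeasurableSet[m'] A) (hV : @Measurable _ _ mΩ _ V)
    (hind : Indep m' (MeasurableSpace.comap V inferInstance) Q)
    (hlaw : ∀ k, Q.map (fun ω => V ω k) = gaussianReal 0 v)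
    (hmean : ∀ k, ∫ ω, V ω k ∂Q = 0)
    (hcov : ∀ k l, ∫ ω, V ω k * V ω l ∂Q = v * if k = l then 1 else 0) :
    |∫ ω in A, f (X ω + V ω) ∂Q - ∫ ω in A, f (X ω) ∂Q -
      1 / 2 * v * ∫ ω in A, Laplacian.laplacian f (X ω) ∂Q| ≤
      C * (gaussianMoment d 2 * √v ^ 3) := by
  have hXm : @Measurable _ _ mΩ _ X := hX.mono hm' le_rfl
  have hAm : @MeasurableSet _ mΩ A := hm' _ hA
  have hk : ∀ k, @Measurable _ _ mΩ _ fun ω => V ω k := fun k => (measurable_coord k).comp hV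
  have hL2 : ∀ k, MemLp (fun ω => V ω k) 2 Q := fun k => by
    have : MemLp id 2 (Q.map (fun ω => V ω k)) := by
      rw [hlaw k]
      exact_mod_cast memLp_id_gaussianReal 2
    exact (memLp_map_measure_iff aestronglyMeasurable_id (hk k).aemeasurable).1 this
  -- The indicator of `A` is absorbed into the factor measurable for `m'`, so that independence of
  -- `V` applies.
  have hprod : ∀ {φ : Space d → ℝ} {ψ : Space d → ℝ}, Continuous φ → Measurable ψ →
      ∫ ω in A, φ (X ω) * ψ (V ω) ∂Q = (∫ ω in A, φ (X ω) ∂Q) * ∫ ω, ψ (V ω) ∂Q := by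
    intro φ ψ hφ hψ
    have hφX : Measurable[m'] (A.indicator fun ω => φ (X ω)) :=
      (hφ.measurable.comp hX).indicator hA
    have hI : IndepFun (A.indicator fun ω => φ (X ω)) (fun ω => ψ (V ω)) Q := by
      rw [IndepFun_iff_Indep]
      exact indep_of_indep_of_le hind hφX.comap_le
        (Measurable.comap_le (hψ.comp (comap_measurable V)))
    have := hI.integral_fun_mul_eq_mul_integral
      (hφX.mono hm' le_rfl).aestronglyMeasurable
      (hψ.comp hV).aestronglyMeasurable
    rw [integral_indicator hAm] at this
    rw [← this, ← integral_indicator hAm]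
    congr 1
    funext ω
    by_cases hω : ω ∈ A <;> simp [hω]
  have hbdd : ∀ {φ : Space d → ℝ}, Continuous φ → HasCompactSupport φ →
      ∃ M, ∀ x, ‖φ x‖ ≤ M := fun h1 h2 => h1.bounded_above_of_compact_support h2
  have hint : ∀ {φ : Space d → ℝ} {ψ : Space d → ℝ}, Continuous φ → HasCompactSupport φ →
      Integrable (fun ω => ψ (V ω)) Q →
      Integrable (fun ω => φ (X ω) * ψ (V ω)) (Q.restrict A) := by
    intro φ ψ h1 h2 h3
    obtain ⟨M, hM⟩ := hbdd h1 h2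
    exact (h3.bdd_mul (c := M) (h1.measurable.comp hXm).aestronglyMeasurable
      (Eventually.of_forall fun ω => hM _)).restrict
  set e := EuclideanSpace.basisFun (Fin d) ℝ
  have hcf := hf.continuous
  have hc1 : ∀ k, Continuous fun x => fderiv ℝ f x (e k) := fun k =>
    (contDiff_fderiv hf).continuous.clm_apply continuous_const
  have hs1 : ∀ k, HasCompactSupport fun x => fderiv ℝ f x (e k) := fun k =>
    (hc.fderiv ℝ).comp_left (g := fun L : Space d →L[ℝ] ℝ => L (e k)) rfl
  have hc2 : ∀ k l, Continuous fun x => fderiv ℝ (fderiv ℝ f) x (e k) (e l) := fun k l =>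
    ((contDiff_fderiv_fderiv hf).continuous.clm_apply continuous_const).clm_apply
      continuous_const
  have hs2 : ∀ k l, HasCompactSupport fun x => fderiv ℝ (fderiv ℝ f) x (e k) (e l) := fun k l =>
    ((hc.fderiv ℝ).fderiv ℝ).comp_left
      (g := fun L : Space d →L[ℝ] Space d →L[ℝ] ℝ => L (e k) (e l)) rfl
  have hI1 : ∀ k, Integrable (fun ω => fderiv ℝ f (X ω) (e k) * V ω k) (Q.restrict A) := fun k =>
    hint (ψ := fun w => w k) (hc1 k) (hs1 k) ((hL2 k).integrable (by norm_num))
  have hI2 : ∀ k l, Integrable (fun ω => fderiv ℝ (fderiv ℝ f) (X ω) (e k) (e l) *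
      (V ω k * V ω l)) (Q.restrict A) := fun k l =>
    hint (ψ := fun w => w k * w l) (hc2 k l) (hs2 k l) ((hL2 k).integrable_mul (hL2 l))
  have hE1 : ∫ ω in A, fderiv ℝ f (X ω) (V ω) ∂Q = 0 := by
    simp_rw [fderiv_apply_eq_sum f _ (V _), mul_comm (V _ _)]
    rw [integral_finsetSum _ fun k _ => hI1 k]
    refine Finset.sum_eq_zero fun k _ => ?_
    rw [hprod (ψ := fun w => w k) (hc1 k) (measurable_coord k), hmean, mul_zero]
  -- The covariance of `V` is `v` times the identity, so only the diagonal second derivatives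
  -- survive and form the Laplacian.
  have hE2 : ∫ ω in A, fderiv ℝ (fderiv ℝ f) (X ω) (V ω) (V ω) ∂Q =
      v * ∫ ω in A, Laplacian.laplacian f (X ω) ∂Q := by
    simp_rw [fderiv_fderiv_apply_eq_sum f _ (V _), laplacian_eq_sum_fderiv,
      mul_comm (V _ _ * V _ _)]
    rw [integral_finsetSum _ fun k _ => integrable_finsetSum _ fun l _ => hI2 k l,
      integral_finsetSum _ fun k _ => by
        simpa only [mul_one] using
          hint (ψ := fun _ => 1) (hc2 k k) (hs2 k k) (integrable_const _),
      Finset.mul_sum]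
    refine Finset.sum_congr rfl fun k _ => ?_
    rw [integral_finsetSum _ fun l _ => hI2 k l, Finset.sum_eq_single k]
    · rw [hprod (ψ := fun w => w k * w k) (hc2 k k)
        ((measurable_coord k).mul (measurable_coord k)), hcov, if_pos rfl, mul_one, mul_comm]
    · intro l _ hl
      rw [hprod (ψ := fun w => w k * w l) (hc2 k l)
        ((measurable_coord k).mul (measurable_coord l)), hcov, if_neg (Ne.symm hl)]
      simp
    · simp
  have hD1 : Integrable (fun ω => fderiv ℝ f (X ω) (V ω)) (Q.restrict A) := by
    simp_rw [fderiv_apply_eq_sum f _ (V _), mul_comm (V _ _)]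
    exact integrable_finsetSum _ fun k _ => hI1 k
  have hD2 : Integrable (fun ω => fderiv ℝ (fderiv ℝ f) (X ω) (V ω) (V ω)) (Q.restrict A) := by
    simp_rw [fderiv_fderiv_apply_eq_sum f _ (V _), mul_comm (V _ _ * V _ _)]
    exact integrable_finsetSum _ fun k _ => integrable_finsetSum _ fun l _ => hI2 k l
  obtain ⟨M, hM⟩ := hbdd hcf hc
  have hF1 : Integrable (fun ω => f (X ω + V ω)) (Q.restrict A) :=
    Integrable.of_bound (hcf.measurable.comp (hXm.add hV)).aestronglyMeasurable M
      (Eventually.of_forall fun ω => hM _)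
  have hF2 : Integrable (fun ω => f (X ω)) (Q.restrict A) :=
    Integrable.of_bound (hcf.measurable.comp hXm).aestronglyMeasurable M
      (Eventually.of_forall fun ω => hM _)
  have h3 := integral_norm_pow_le hV hlaw 2
  have heq : ∫ ω in A, f (X ω + V ω) ∂Q - ∫ ω in A, f (X ω) ∂Q -
      1 / 2 * v * ∫ ω in A, Laplacian.laplacian f (X ω) ∂Q =
      ∫ ω in A, (f (X ω + V ω) - f (X ω) - fderiv ℝ f (X ω) (V ω) -
        1 / 2 * fderiv ℝ (fderiv ℝ f) (X ω) (V ω) (V ω)) ∂Q := by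
    have h12 : Integrable (fun ω => f (X ω + V ω) - f (X ω)) (Q.restrict A) := hF1.sub hF2
    have h123 : Integrable (fun ω => f (X ω + V ω) - f (X ω) - fderiv ℝ f (X ω) (V ω))
      (Q.restrict A) := h12.sub hD1
    rw [integral_sub h123 (hD2.const_mul _), integral_sub h12 hD1, integral_sub hF1 hF2,
      integral_const_mul, hE1, hE2]
    ring
  rw [heq, ← Real.norm_eq_abs]
  calc _ ≤ ∫ ω in A, C * ‖V ω‖ ^ 3 ∂Q :=
        norm_integral_le_of_norm_le (h3.1.const_mul C).restrict
          (Eventually.of_forall fun ω => hC _ _)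
    _ ≤ ∫ ω, C * ‖V ω‖ ^ 3 ∂Q :=
        setIntegral_le_integral (h3.1.const_mul C) (Eventually.of_forall fun ω => by positivity)
    _ ≤ C * (gaussianMoment d 2 * √v ^ 3) := by
        rw [integral_const_mul]
        exact mul_le_mul_of_nonneg_left h3.2 hC0

end Moments

/-! ### Exchange of expectation and time integral -/

section Fubini

variable {Ω : Type*} [mΩ : MeasurableSpace Ω] {Q : Measure Ω}

/-- Fubini's theorem for a process with continuous paths. -/
lemma integral_intervalIntegral_of_continuous [IsFiniteMeasure Q] {g : ℝ → Ω → ℝ} {a b M : ℝ}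
    (hab : a ≤ b) (hg : ∀ s ∈ Set.Icc a b, Measurable (g s))
    (hc : ∀ᵐ ω ∂Q, ContinuousOn (fun s => g s ω) (Set.Icc a b))
    (hi : ∀ s ∈ Set.Icc a b, Integrable (g s) Q)
    (hM : ∀ s ∈ Set.Icc a b, ∫ ω, ‖g s ω‖ ∂Q ≤ M) :
    Integrable (fun ω => ∫ s in a..b, g s ω) Q ∧
      ∫ ω, (∫ s in a..b, g s ω) ∂Q = ∫ s in a..b, ∫ ω, g s ω ∂Q := by
  classical
  obtain ⟨G, hGc, hGm, hG⟩ := hc.exists_measurable_mem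
  -- Clamped times and the indicator of `G` give a version that is continuous for every `ω` and all
  -- times, hence jointly measurable.
  let c : ℝ → ℝ := fun s => max a (min s b)
  have hcm : ∀ s, c s ∈ Set.Icc a b := fun s =>
    ⟨le_max_left _ _, max_le hab (min_le_right _ _)⟩
  have hcs : ∀ s ∈ Set.Icc a b, c s = s := fun s hs => by
    simp only [c]
    rw [min_eq_left hs.2, max_eq_right hs.1]
  let g' : Ω → ℝ → ℝ := fun ω s => G.indicator (g (c s)) ω
  have hg'm : ∀ s, Measurable fun ω => g' ω s := fun s => (hg _ (hcm s)).indicator hGm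
  have hg'c : ∀ ω, Continuous (g' ω) := fun ω => by
    by_cases hω : ω ∈ G
    · have : g' ω = fun s => g (c s) ω := funext fun s => Set.indicator_of_mem hω _
      rw [this]
      exact (hG ω hω).comp_continuous (by fun_prop) hcm
    · have : g' ω = fun _ => 0 := funext fun s => Set.indicator_of_notMem hω _
      rw [this]
      exact continuous_const
  have hsm : StronglyMeasurable (Function.uncurry g') := by
    have h := stronglyMeasurable_uncurry_of_continuous_of_stronglyMeasurable (u := fun s ω => g' ω s)
      hg'c (fun s => (hg'm s).stronglyMeasurable)
    exact h.comp_measurable measurable_swap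
  have hsm' : StronglyMeasurable (Function.uncurry fun s ω => g' ω s) :=
    hsm.comp_measurable measurable_swap
  have hae : ∀ s ∈ Set.Icc a b, (fun ω => g' ω s) =ᵐ[Q] g s := fun s hs => by
    filter_upwards [hGc] with ω hω
    simp only [g', Set.indicator_of_mem hω, hcs s hs]
  have hIoc : ∀ᵐ s ∂(volume.restrict (Set.Ioc a b)), s ∈ Set.Icc a b := by
    filter_upwards [ae_restrict_mem measurableSet_Ioc] with s hs using Set.Ioc_subset_Icc_self hs
  have hint : Integrable (Function.uncurry fun s ω => g' ω s)
      ((volume.restrict (Set.Ioc a b)).prod Q) := by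
    rw [integrable_prod_iff hsm'.aestronglyMeasurable]
    refine ⟨?_, ?_⟩
    · filter_upwards [hIoc] with s hs
      exact (hi s hs).congr (hae s hs).symm
    · refine Integrable.of_bound (C := M) ?_ ?_
      · exact (hsm'.norm.integral_prod_right (f := fun s ω => ‖g' ω s‖)).aestronglyMeasurable
      · filter_upwards [hIoc] with s hs
        rw [Real.norm_of_nonneg (integral_nonneg fun _ => norm_nonneg _)]
        refine le_trans (le_of_eq (integral_congr_ae ?_)) (hM s hs)
        filter_upwards [hae s hs] with ω hω
        simp only [Function.uncurry_apply_pair, hω]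
  have hpath : (fun ω => ∫ s in a..b, g' ω s) =ᵐ[Q] fun ω => ∫ s in a..b, g s ω := by
    filter_upwards [hGc] with ω hω
    refine intervalIntegral.integral_congr fun s hs => ?_
    rw [Set.uIcc_of_le hab] at hs
    simp only [g', Set.indicator_of_mem hω, hcs s hs]
  have htime : ∫ s in a..b, ∫ ω, g' ω s ∂Q = ∫ s in a..b, ∫ ω, g s ω ∂Q := by
    refine intervalIntegral.integral_congr fun s hs => ?_
    rw [Set.uIcc_of_le hab] at hs
    exact integral_congr_ae (hae s hs)
  have hint' : Integrable (fun ω => ∫ s in a..b, g' ω s) Q := by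
    simp only [intervalIntegral.integral_of_le hab]
    exact hint.integral_prod_right
  refine ⟨hint'.congr hpath, ?_⟩
  rw [← integral_congr_ae hpath, ← htime]
  simp only [intervalIntegral.integral_of_le hab]
  exact (integral_integral_swap hint).symm

end Fubini

/-! ### The Ornstein–Uhlenbeck operator on test functions -/

section TestFunctions

variable {d : ℕ} {f : Space d → ℝ}

lemma sigmaOU_nonneg (m : ℕ) : 0 ≤ sigmaOU m :=
  sub_nonneg.2 (inv_le_one_of_one_le₀ (one_le_pow₀ (by norm_num)))

lemma sigmaOU_le_one (m : ℕ) : sigmaOU m ≤ 1 :=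
  sub_le_self _ (by positivity)

lemma continuous_laplacian (hf : ContDiff ℝ (⊤ : ℕ∞) f) : Continuous (Laplacian.laplacian f) := by
  have : Laplacian.laplacian f = fun x => ∑ k, fderiv ℝ (fderiv ℝ f) x
      (EuclideanSpace.basisFun (Fin d) ℝ k) (EuclideanSpace.basisFun (Fin d) ℝ k) :=
    funext (laplacian_eq_sum_fderiv f)
  rw [this]
  exact continuous_finsetSum _ fun k _ => ((contDiff_fderiv_fderiv hf).continuous.clm_apply
    continuous_const).clm_apply continuous_const

lemma hasCompactSupport_laplacian (hc : HasCompactSupport f) :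
    HasCompactSupport (Laplacian.laplacian f) := by
  refine HasCompactSupport.mono ((hc.fderiv ℝ).fderiv ℝ) fun x hx hx' => hx ?_
  simp [laplacian_eq_sum_fderiv, hx']

lemma continuous_fderiv_apply_self (hf : ContDiff ℝ (⊤ : ℕ∞) f) :
    Continuous fun x => fderiv ℝ f x x :=
  (contDiff_fderiv hf).continuous.clm_apply continuous_id

lemma hasCompactSupport_fderiv_apply_self (hc : HasCompactSupport f) :
    HasCompactSupport fun x => fderiv ℝ f x x := by
  refine HasCompactSupport.mono (hc.fderiv ℝ) fun x hx hx' => hx ?_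
  simp [hx']

lemma continuous_generatorOU (σ γ : ℝ) (hf : ContDiff ℝ (⊤ : ℕ∞) f) :
    Continuous (generatorOU σ γ f) := by
  have : generatorOU σ γ f = fun x => 1 / 2 * σ * Laplacian.laplacian f x - γ * fderiv ℝ f x x :=
    funext (generatorOU_eq σ γ f)
  rw [this]
  exact ((continuous_laplacian hf).const_mul _).sub ((continuous_fderiv_apply_self hf).const_mul _)

lemma exists_bound_generatorOU (σ γ : ℝ) (hf : ContDiff ℝ (⊤ : ℕ∞) f) (hc : HasCompactSupport f) :
    ∃ M, ∀ x, ‖generatorOU σ γ f x‖ ≤ M := by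
  obtain ⟨M₁, h₁⟩ := (continuous_laplacian hf).bounded_above_of_compact_support
    (hasCompactSupport_laplacian hc)
  obtain ⟨M₂, h₂⟩ := (continuous_fderiv_apply_self hf).bounded_above_of_compact_support
    (hasCompactSupport_fderiv_apply_self hc)
  refine ⟨‖1 / 2 * σ‖ * M₁ + ‖γ‖ * M₂, fun x => ?_⟩
  rw [generatorOU_eq]
  refine (norm_sub_le _ _).trans ?_
  rw [norm_mul, norm_mul γ]
  gcongr
  · exact h₁ x
  · exact h₂ x

lemma tendsto_generatorOU (γ : ℝ) (f : Space d → ℝ) (y : Space d) :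
    Tendsto (fun m : ℕ => generatorOU (sigmaOU m) γ f y) atTop (𝓝 (generatorOU 1 γ f y)) := by
  have h : Tendsto sigmaOU atTop (𝓝 1) := by
    have := (tendsto_pow_atTop_atTop_of_one_lt (one_lt_two (α := ℝ))).inv_tendsto_atTop
    have h := this.const_sub 1
    rw [sub_zero] at h
    exact h
  exact ((h.const_mul _).mul_const _).sub_const _

end TestFunctions

/-! ### Increments of the correlated noise -/

section Increments

variable {Ω : Type*} [mΩ : MeasurableSpace Ω] {Q : Measure Ω} {d m : ℕ}
  {V : Fin (2 ^ m) → ℝ≥0 → Ω → Space d}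

/-- A single particle sees only the diagonal entry of the centering matrix, which is `sigmaOU m`. -/
lemma integral_increment_mul (hV : IsCorrelatedBrownian (centeringMatrix m) V Q)
    (i : Fin (2 ^ m)) {u v : ℝ≥0} (huv : u ≤ v) (k l : Fin d) :
    ∫ ω, (V i v ω - V i u ω) k * (V i v ω - V i u ω) l ∂Q =
      ((v - u) * (sigmaOU m).toNNReal : ℝ≥0) * if k = l then 1 else 0 := by
  have hL : ∀ s k, MemLp (fun ω => V i s ω k) 2 Q := fun s k =>
    (hV.gaussian.hasGaussianLaw_eval (s, i, k)).memLp_two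
  have hI : ∀ s t k l, Integrable (fun ω => V i s ω k * V i t ω l) Q := fun s t k l =>
    (hL s k).integrable_mul (hL t l)
  have huv' : (u : ℝ) ≤ v := huv
  have e : ∀ ω, (V i v ω - V i u ω) k * (V i v ω - V i u ω) l =
      V i v ω k * V i v ω l - V i v ω k * V i u ω l -
        (V i u ω k * V i v ω l - V i u ω k * V i u ω l) := fun ω => by
    simp only [PiLp.sub_apply]
    ring
  simp_rw [e]
  have h₁ : Integrable (fun ω => V i v ω k * V i v ω l - V i v ω k * V i u ω l) Q :=
    (hI v v k l).sub (hI v u k l)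
  have h₂ : Integrable (fun ω => V i u ω k * V i v ω l - V i u ω k * V i u ω l) Q :=
    (hI u v k l).sub (hI u u k l)
  rw [integral_sub h₁ h₂, integral_sub (hI v v k l) (hI v u k l), integral_sub (hI u v k l) (hI u u k l)]
  simp only [hV.covariance, min_self, min_eq_left huv', min_eq_right huv']
  rw [NNReal.coe_mul, NNReal.coe_sub huv, Real.coe_toNNReal _ (sigmaOU_nonneg m)]
  simp only [centeringMatrix, Matrix.of_apply, if_true, sigmaOU]
  ring

lemma integral_increment (hV : IsCorrelatedBrownian (centeringMatrix m) V Q)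
    (i : Fin (2 ^ m)) (u v : ℝ≥0) (k : Fin d) :
    ∫ ω, (V i v ω - V i u ω) k ∂Q = 0 := by
  have hL : ∀ s k, Integrable (fun ω => V i s ω k) Q := fun s k =>
    (hV.gaussian.hasGaussianLaw_eval (s, i, k)).integrable
  simp only [PiLp.sub_apply]
  rw [integral_sub (hL v k) (hL u k), hV.mean, hV.mean, sub_zero]

lemma map_increment (hV : IsCorrelatedBrownian (centeringMatrix m) V Q)
    (i : Fin (2 ^ m)) {u v : ℝ≥0} (huv : u ≤ v) (k : Fin d) :
    Q.map (fun ω => (V i v ω - V i u ω) k) =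
      gaussianReal 0 ((v - u) * (sigmaOU m).toNNReal) := by
  have hprob : IsProbabilityMeasure Q := hV.gaussian.isProbabilityMeasure
  have hG : HasGaussianLaw (fun ω => (V i v ω - V i u ω) k) Q :=
    hV.gaussian.hasGaussianLaw_fun_sub (s := (v, i, k)) (t := (u, i, k))
  rw [hG.map_eq_gaussianReal, integral_increment hV]
  congr 1
  have h0 : Var[fun ω => (V i v ω - V i u ω) k; Q] =
      ((v - u) * (sigmaOU m).toNNReal : ℝ≥0) := by
    rw [variance_of_integral_eq_zero hG.aemeasurable (integral_increment hV i u v k)]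
    have := integral_increment_mul hV i huv k k
    rw [if_pos rfl, mul_one] at this
    rw [← this]
    exact integral_congr_ae (Eventually.of_forall fun ω => sq _)
  rw [h0, Real.toNNReal_coe]

end Increments

/-! ### Short time expansion of the semigroup -/

section OneStep

lemma gaussianMoment_nonneg (d n : ℕ) : 0 ≤ gaussianMoment d n := by
  unfold gaussianMoment
  have : 0 ≤ ∫ x, |x| ^ (n + 1) ∂(gaussianReal 0 1) := integral_nonneg fun x => by positivity
  positivity

variable {Ω : Type*} [mΩ : MeasurableSpace Ω] {Q : Measure Ω} {d : ℕ} {γ : ℝ}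
  {W : (m : ℕ) → Fin (2 ^ m) → ℝ≥0 → Ω → Space d} {Y : ℝ → ℕ → Ω → Space d}

/-- The drift correction in a step of the Ornstein–Uhlenbeck equation is of order `h ^ (3 / 2)`. -/
lemma integral_pathIntegral_le {m : ℕ} {V : Fin (2 ^ m) → ℝ≥0 → Ω → Space d}
    (hV : IsCorrelatedBrownian (centeringMatrix m) V Q) (i : Fin (2 ^ m)) (u h : ℝ≥0) :
    Integrable (fun ω => ∫ s in (0 : ℝ)..h, ‖V i (u + s.toNNReal) ω - V i u ω‖) Q ∧
    ∫ ω, (∫ s in (0 : ℝ)..h, ‖V i (u + s.toNNReal) ω - V i u ω‖) ∂Q ≤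
      gaussianMoment d 0 * √h ^ 3 := by
  have hprob : IsProbabilityMeasure Q := hV.gaussian.isProbabilityMeasure
  have hb : ∀ s ∈ Set.Icc (0 : ℝ) h, Integrable (fun ω => ‖V i (u + s.toNNReal) ω - V i u ω‖) Q ∧
      ∫ ω, ‖V i (u + s.toNNReal) ω - V i u ω‖ ∂Q ≤ gaussianMoment d 0 * √h := fun s hs => by
    have h1 := integral_norm_pow_le (Q := Q) (V := fun ω => V i (u + s.toNNReal) ω - V i u ω)
      ((hV.measurable _ _).sub (hV.measurable _ _)) (fun k => map_increment hV i le_self_add k) 0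
    simp only [zero_add, pow_one] at h1
    refine ⟨h1.1, h1.2.trans ?_⟩
    refine mul_le_mul_of_nonneg_left (Real.sqrt_le_sqrt ?_) (gaussianMoment_nonneg d 0)
    rw [add_tsub_cancel_left, NNReal.coe_mul, Real.coe_toNNReal _ hs.1,
      Real.coe_toNNReal _ (sigmaOU_nonneg m)]
    exact (mul_le_of_le_one_right hs.1 (sigmaOU_le_one m)).trans hs.2
  have hF := integral_intervalIntegral_of_continuous (Q := Q)
    (g := fun s ω => ‖V i (u + s.toNNReal) ω - V i u ω‖) (a := 0) (b := h) h.coe_nonneg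
    (fun s _ => ((hV.measurable _ _).sub (hV.measurable _ _)).norm)
    (by
      filter_upwards [hV.continuous] with ω hω
      have := hω i
      fun_prop) (fun s hs => (hb s hs).1)
    (fun s hs => by simpa only [norm_norm] using (hb s hs).2)
  refine ⟨hF.1, hF.2.le.trans ?_⟩
  have hn := intervalIntegral.norm_integral_le_of_norm_le_const (a := 0) (b := (h : ℝ))
    (f := fun s : ℝ => ∫ ω, ‖V i (u + s.toNNReal) ω - V i u ω‖ ∂Q)
    (C := gaussianMoment d 0 * √h) (fun s hs => by
      rw [Set.uIoc_of_le h.coe_nonneg] at hs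
      rw [Real.norm_of_nonneg (integral_nonneg fun _ => norm_nonneg _)]
      exact (hb s ⟨hs.1.le, hs.2⟩).2)
  refine (le_abs_self _).trans (hn.trans (le_of_eq ?_))
  rw [sub_zero, abs_of_nonneg h.coe_nonneg, pow_succ, Real.sq_sqrt h.coe_nonneg]
  ring

/-- The short time expansion of the semigroup of a branching Ornstein–Uhlenbeck process. -/
lemma exists_ou_step_bound
    (hY : IsDyadicSystem Y Q) (hW : ∀ m, IsCorrelatedBrownian (centeringMatrix m) (W m) Q)
    (hind : iIndepFun (fun (m : ℕ) ω (i : Fin (2 ^ m)) (τ : ℝ≥0) => W m i τ ω) Q)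
    (hs : ∀ᵐ ω ∂Q, ∀ (m : ℕ) (i : Fin (2 ^ m)) (τ : ℝ≥0), τ < 1 →
      Y (m + τ) i ω = Y m i ω + W m i τ ω - γ • ∫ s in (0 : ℝ)..τ, Y (m + s) i ω)
    {f : Space d → ℝ} (hf : ContDiff ℝ (⊤ : ℕ∞) f) (hc : HasCompactSupport f)
    (m : ℕ) (i : Fin (2 ^ m)) :
    ∃ K : ℝ, ∀ (u h : ℝ≥0) (A : Set Ω), u + h < 1 →
      MeasurableSet[aeCompletion (noisePast W m u) Q] A →
      |∫ ω in A, f (Y (m + u + h) i ω) ∂Q - ∫ ω in A, f (Real.exp (-(γ * h)) • Y (m + u) i ω) ∂Q -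
        1 / 2 * (h * sigmaOU m) *
          ∫ ω in A, Laplacian.laplacian f (Real.exp (-(γ * h)) • Y (m + u) i ω) ∂Q| ≤
        K * √h ^ 3 := by
  have hprob : IsProbabilityMeasure Q := (hW 0).gaussian.isProbabilityMeasure
  obtain ⟨C, hC0, hC⟩ := exists_taylor_bound hf hc
  obtain ⟨L, hL⟩ : ∃ L, LipschitzWith L f :=
    ContDiff.lipschitzWith_of_hasCompactSupport (𝕂 := ℝ) (n := ((⊤ : ℕ∞) : WithTop ℕ∞))
      hc hf (by simp)
  -- The first summand is the cost, through the Lipschitz constant of `f`, of dropping the noise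
  -- integral from the explicit solution; the two exponentials are bounded using `h ≤ 1`. The second
  -- is the Taylor remainder.
  refine ⟨L * (|γ| * Real.exp |γ| ^ 2) * gaussianMoment d 0 + C * gaussianMoment d 2,
    fun u h A huh hA => ?_⟩
  have hu : u < 1 := lt_of_le_of_lt le_self_add huh
  have huh' : (u : ℝ) + h < 1 := by exact_mod_cast huh
  have hh1 : (h : ℝ) ≤ 1 := by linarith [u.coe_nonneg]
  have hle : noisePast W m u ≤ mΩ := noisePast_le fun n j τ _ => (hW n).measurable j τ
  have hAm : MeasurableSet A := aeCompletion_le _ hA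
  have hWm : ∀ m i τ, Measurable (W m i τ) := fun m => (hW m).measurable
  have hWc : ∀ᵐ ω ∂Q, ∀ m i, Continuous fun τ => W m i τ ω :=
    ae_all_iff.2 fun m => (hW m).continuous
  set a := Real.exp (-(γ * h))
  set V : Ω → Space d := fun ω => W m i (u + h) ω - W m i u ω
  have hVm : Measurable V := ((hW m).measurable _ _).sub ((hW m).measurable _ _)
  have hYu : Measurable[aeCompletion (noisePast W m u) Q] (Y (m + u) i) :=
    measurable_ou_of_measurable_start hY hWm hWc hs (measurable_ou_start hY hWm hWc hs m) hu i.2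
  have hX : Measurable[aeCompletion (noisePast W m u) Q] (fun ω => a • Y (m + u) i ω) :=
    hYu.const_smul a
  have hXm : Measurable (fun ω => a • Y (m + u) i ω) := hX.mono aeCompletion_le le_rfl
  have hYh : Measurable (Y (m + u + h) i) := by
    have := measurable_ou_of_measurable_start hY hWm hWc hs
      (measurable_ou_start hY hWm hWc hs m) huh i.2
    push_cast at this
    rw [← add_assoc] at this
    exact this.mono aeCompletion_le le_rfl
  have hI : Indep (aeCompletion (noisePast W m u) Q) (MeasurableSpace.comap V inferInstance) Q :=
    indep_of_indep_of_le_right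
      (Indep.aeCompletion (indep_noisePast_increment hW hind m i (le_self_add : u ≤ u + h)))
      (le_aeCompletion hVm.comap_le)
  have hT := abs_setIntegral_taylor_le hf hc hC0 hC aeCompletion_le hX hA hVm hI
    (fun k => map_increment (hW m) i le_self_add k) (fun k => integral_increment (hW m) i _ _ k)
    (fun k l => integral_increment_mul (hW m) i le_self_add k l)
  rw [add_tsub_cancel_left, NNReal.coe_mul, Real.coe_toNNReal _ (sigmaOU_nonneg m)] at hT
  obtain ⟨hJi, hJ⟩ := integral_pathIntegral_le (hW m) i u h
  have hR : ∀ᵐ ω ∂Q, ‖f (Y (m + u + h) i ω) - f (a • Y (m + u) i ω + V ω)‖ ≤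
      L * (|γ| * Real.exp |γ| ^ 2) *
        ∫ s in (0 : ℝ)..h, ‖W m i (u + s.toNNReal) ω - W m i u ω‖ := by
    filter_upwards [hs, hY.continuous, (hW m).continuous] with ω h1 h2 h3
    have hWc := h3 i
    have e := ou_path_eq (h2 m i i.2) hWc (h1 m i) u h huh
    have hn := hL.dist_le_mul (Y (m + u + h) i ω) (a • Y (m + u) i ω + V ω)
    rw [dist_eq_norm, dist_eq_norm] at hn
    refine hn.trans ?_
    rw [mul_assoc]
    refine mul_le_mul_of_nonneg_left ?_ L.2
    have e2 : Y (m + u + h) i ω - (a • Y (m + u) i ω + V ω) = -(a * γ) • ∫ s in (0 : ℝ)..h,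
        Real.exp (γ * s) • (W m i (u + s.toNNReal) ω - W m i u ω) := by
      rw [e]
      simp only [V, a]
      module
    have ha : a ≤ Real.exp |γ| := Real.exp_le_exp.2 (by
      calc -(γ * h) ≤ |γ * h| := neg_le_abs _
        _ = |γ| * h := by rw [abs_mul, abs_of_nonneg h.coe_nonneg]
        _ ≤ |γ| := mul_le_of_le_one_right (abs_nonneg _) hh1)
    have hi : ‖∫ s in (0 : ℝ)..h, Real.exp (γ * s) • (W m i (u + s.toNNReal) ω - W m i u ω)‖ ≤
        Real.exp |γ| * ∫ s in (0 : ℝ)..h, ‖W m i (u + s.toNNReal) ω - W m i u ω‖ := by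
      rw [← intervalIntegral.integral_const_mul]
      refine intervalIntegral.norm_integral_le_of_norm_le h.coe_nonneg
        (Eventually.of_forall fun s hs' => ?_) (Continuous.intervalIntegrable (by fun_prop) _ _)
      rw [norm_smul, Real.norm_of_nonneg (Real.exp_pos _).le]
      refine mul_le_mul_of_nonneg_right (Real.exp_le_exp.2 ?_) (norm_nonneg _)
      calc γ * s ≤ |γ * s| := le_abs_self _
        _ = |γ| * s := by rw [abs_mul, abs_of_nonneg hs'.1.le]
        _ ≤ |γ| := mul_le_of_le_one_right (abs_nonneg _) (hs'.2.trans hh1)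
    rw [e2, norm_smul, norm_neg, norm_mul, Real.norm_of_nonneg (Real.exp_pos _).le,
      Real.norm_eq_abs]
    calc _ ≤ Real.exp |γ| * |γ| * (Real.exp |γ| *
          ∫ s in (0 : ℝ)..h, ‖W m i (u + s.toNNReal) ω - W m i u ω‖) := by gcongr
      _ = _ := by ring
  obtain ⟨M, hM⟩ := hf.continuous.bounded_above_of_compact_support hc
  have hint : ∀ {X : Ω → Space d}, Measurable X → Integrable (fun ω => f (X ω)) (Q.restrict A) :=
    fun hX => Integrable.of_bound (hf.continuous.measurable.comp hX).aestronglyMeasurable M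
      (Eventually.of_forall fun ω => hM _)
  have hE : |∫ ω in A, f (Y (m + u + h) i ω) ∂Q - ∫ ω in A, f (a • Y (m + u) i ω + V ω) ∂Q| ≤
      L * (|γ| * Real.exp |γ| ^ 2) * (gaussianMoment d 0 * √h ^ 3) := by
    have hXV : Measurable fun ω => a • Y (m + u) i ω + V ω := hXm.add hVm
    rw [← integral_sub (hint hYh) (hint hXV), ← Real.norm_eq_abs]
    have hpos : 0 ≤ᵐ[Q] fun ω => ∫ s in (0 : ℝ)..h, ‖W m i (u + s.toNNReal) ω - W m i u ω‖ :=
      Eventually.of_forall fun ω =>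
        intervalIntegral.integral_nonneg h.coe_nonneg fun _ _ => norm_nonneg _
    calc _ ≤ ∫ ω in A, L * (|γ| * Real.exp |γ| ^ 2) *
          (∫ s in (0 : ℝ)..h, ‖W m i (u + s.toNNReal) ω - W m i u ω‖) ∂Q :=
          norm_integral_le_of_norm_le (hJi.const_mul _).restrict (ae_restrict_of_ae hR)
      _ ≤ L * (|γ| * Real.exp |γ| ^ 2) * ∫ ω,
          (∫ s in (0 : ℝ)..h, ‖W m i (u + s.toNNReal) ω - W m i u ω‖) ∂Q := by
          rw [integral_const_mul]
          exact mul_le_mul_of_nonneg_left (setIntegral_le_integral hJi hpos) (by positivity)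
      _ ≤ _ := mul_le_mul_of_nonneg_left hJ (by positivity)
  -- Since `sigmaOU m ≤ 1`, the Taylor error fits the common order `√h ^ 3`.
  have hσ : C * (gaussianMoment d 2 * √(h * sigmaOU m) ^ 3) ≤
      C * (gaussianMoment d 2 * √h ^ 3) := by
    have := gaussianMoment_nonneg d 2
    gcongr
    exact mul_le_of_le_one_right h.coe_nonneg (sigmaOU_le_one m)
  rw [abs_le] at hT hE ⊢
  constructor <;> linarith [hT.1, hT.2, hE.1, hE.2]

end OneStep

/-! ### Right derivatives and the martingale problem -/

section Generator

variable {Ω : Type*} [mΩ : MeasurableSpace Ω] {Q : Measure Ω} {d : ℕ} {γ : ℝ}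
  {W : (m : ℕ) → Fin (2 ^ m) → ℝ≥0 → Ω → Space d} {Y : ℝ → ℕ → Ω → Space d}
  {f : Space d → ℝ}

/-- The derivative at time zero of the semigroup generated by the drift. -/
lemma hasDerivAt_integral_exp_smul [IsFiniteMeasure Q] (hf : ContDiff ℝ (⊤ : ℕ∞) f)
    (hc : HasCompactSupport f) {X : Ω → Space d} (hX : Measurable X) (γ : ℝ) :
    HasDerivAt (fun h : ℝ => ∫ ω, f (Real.exp (-(γ * h)) • X ω) ∂Q)
      (∫ ω, -γ * fderiv ℝ f (X ω) (X ω) ∂Q) 0 := by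
  obtain ⟨M, hM⟩ := hf.continuous.bounded_above_of_compact_support hc
  obtain ⟨M', hM'⟩ := (continuous_fderiv_apply_self hf).bounded_above_of_compact_support
    (hasCompactSupport_fderiv_apply_self hc)
  have hm : ∀ {g : Space d → ℝ}, Continuous g → ∀ h : ℝ,
      AEStronglyMeasurable (fun ω => g (Real.exp (-(γ * h)) • X ω)) Q := fun hg h =>
    ((hg.comp (continuous_const_smul (Real.exp (-(γ * h))))).measurable.comp hX).aestronglyMeasurable
  have h := (hasDerivAt_integral_of_dominated_loc_of_deriv_le (μ := Q) (x₀ := (0 : ℝ))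
    (F := fun h ω => f (Real.exp (-(γ * h)) • X ω))
    (F' := fun h ω => -γ * fderiv ℝ f (Real.exp (-(γ * h)) • X ω) (Real.exp (-(γ * h)) • X ω))
    (bound := fun _ => ‖-γ‖ * M') Filter.univ_mem (Eventually.of_forall fun h => hm hf.continuous h)
    (Integrable.of_bound (hm hf.continuous 0) M (Eventually.of_forall fun ω => hM _))
    ((hm (continuous_fderiv_apply_self hf) 0).const_mul _)
    (Eventually.of_forall fun ω h _ => by
      rw [norm_mul]
      exact mul_le_mul_of_nonneg_left (hM' _) (norm_nonneg _))
    (integrable_const _)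
    (Eventually.of_forall fun ω h _ => by
      have h1 : HasDerivAt (fun h : ℝ => Real.exp (-(γ * h)) • X ω)
          ((Real.exp (-(γ * h)) * -(γ * 1)) • X ω) h :=
        (((hasDerivAt_id h).const_mul γ).neg.exp).smul_const (X ω)
      refine ((hf.differentiable (by simp) _).hasFDerivAt.comp_hasDerivAt h h1).congr_deriv ?_
      simp only [map_smul, smul_eq_mul]
      ring)).2
  simpa using h

lemma continuous_integral_exp_smul [IsFiniteMeasure Q] {g : Space d → ℝ} (hg : Continuous g)
    (hc : HasCompactSupport g) {X : Ω → Space d} (hX : Measurable X) (γ : ℝ) :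
    Continuous (fun h : ℝ => ∫ ω, g (Real.exp (-(γ * h)) • X ω) ∂Q) := by
  obtain ⟨M, hM⟩ := hg.bounded_above_of_compact_support hc
  exact continuous_of_dominated
    (fun h => ((hg.comp (continuous_const_smul (Real.exp (-(γ * h))))).measurable.comp hX).aestronglyMeasurable)
    (fun h => Eventually.of_forall fun ω => hM _) (integrable_const _)
    (Eventually.of_forall fun ω => by fun_prop)

/-- In the one-step expansion the deterministic contraction by `exp (-(γ * h))` produces the drift
and the Laplacian term produces the diffusion. The error, of order `h ^ (3 / 2)`, disappears in the
difference quotient. -/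
lemma hasDerivWithinAt_setIntegral_ou
    (hY : IsDyadicSystem Y Q) (hW : ∀ m, IsCorrelatedBrownian (centeringMatrix m) (W m) Q)
    (hind : iIndepFun (fun (m : ℕ) ω (i : Fin (2 ^ m)) (τ : ℝ≥0) => W m i τ ω) Q)
    (hs : ∀ᵐ ω ∂Q, ∀ (m : ℕ) (i : Fin (2 ^ m)) (τ : ℝ≥0), τ < 1 →
      Y (m + τ) i ω = Y m i ω + W m i τ ω - γ • ∫ s in (0 : ℝ)..τ, Y (m + s) i ω)
    (hf : ContDiff ℝ (⊤ : ℕ∞) f) (hc : HasCompactSupport f)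
    (m : ℕ) (i : Fin (2 ^ m)) {u : ℝ≥0} (hu : u < 1) {A : Set Ω}
    (hA : MeasurableSet[aeCompletion (noisePast W m u) Q] A) :
    HasDerivWithinAt (fun r => ∫ ω in A, f (Y r i ω) ∂Q)
      (∫ ω in A, generatorOU (sigmaOU m) γ f (Y (m + u) i ω) ∂Q)
      (Set.Ioi ((m : ℝ) + u)) (m + u) := by
  have hprob : IsProbabilityMeasure Q := (hW 0).gaussian.isProbabilityMeasure
  have hu' : (u : ℝ) < 1 := by exact_mod_cast hu
  obtain ⟨K, hK⟩ := exists_ou_step_bound hY hW hind hs hf hc m i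
  have hX : Measurable (Y (m + u) i) := hY.measurable _ (by positivity) i
    (by rw [numParticles_of_mem_Ico (add_mem_Ico m u.coe_nonneg hu')]; exact i.2)
  set x : ℝ := m + u with hx
  set G : ℝ → ℝ := fun h => ∫ ω in A, f (Real.exp (-(γ * h)) • Y x i ω) ∂Q with hGdef
  set H : ℝ → ℝ := fun h => ∫ ω in A, Laplacian.laplacian f (Real.exp (-(γ * h)) • Y x i ω) ∂Q
    with hHdef
  have hG := hasDerivAt_integral_exp_smul (Q := Q.restrict A) hf hc hX γ
  have hH : Continuous H := continuous_integral_exp_smul (Q := Q.restrict A)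
    (continuous_laplacian hf) (hasCompactSupport_laplacian hc) hX γ
  have hψ : ∫ ω in A, generatorOU (sigmaOU m) γ f (Y x i ω) ∂Q =
      ∫ ω in A, -γ * fderiv ℝ f (Y x i ω) (Y x i ω) ∂Q + 1 / 2 * sigmaOU m * H 0 := by
    obtain ⟨M₁, h₁⟩ := (continuous_laplacian hf).bounded_above_of_compact_support
      (hasCompactSupport_laplacian hc)
    obtain ⟨M₂, h₂⟩ := (continuous_fderiv_apply_self hf).bounded_above_of_compact_support
      (hasCompactSupport_fderiv_apply_self hc)
    simp only [H, mul_zero, neg_zero, Real.exp_zero, one_smul]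
    rw [← integral_const_mul, ← integral_add]
    · refine integral_congr_ae (Eventually.of_forall fun ω => ?_)
      simp only [generatorOU_eq]
      ring
    · exact (Integrable.of_bound ((continuous_fderiv_apply_self hf).measurable.comp
        hX).aestronglyMeasurable M₂ (Eventually.of_forall fun ω => h₂ _)).const_mul _
    · exact (Integrable.of_bound ((continuous_laplacian hf).measurable.comp
        hX).aestronglyMeasurable M₁ (Eventually.of_forall fun ω => h₁ _)).const_mul _
  rw [hψ, hasDerivWithinAt_iff_tendsto_slope' (by simp)]
  have hsub : Tendsto (fun r : ℝ => r - x) (𝓝[>] x) (𝓝 0) := by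
    have : Tendsto (fun r : ℝ => r - x) (𝓝 x) (𝓝 (x - x)) := tendsto_id.sub_const x
    rw [sub_self] at this
    exact this.mono_left nhdsWithin_le_nhds
  have hsub' : Tendsto (fun r : ℝ => r - x) (𝓝[>] x) (𝓝[≠] 0) :=
    tendsto_nhdsWithin_iff.2 ⟨hsub, by
      filter_upwards [self_mem_nhdsWithin] with r hr using (sub_pos.2 hr).ne'⟩
  have hlim := ((hasDerivAt_iff_tendsto_slope.1 hG).comp hsub').add
    (((hH.tendsto 0).comp hsub).const_mul (1 / 2 * sigmaOU m))
  refine (tendsto_iff_of_dist ?_).2 hlim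
  have hsqrt : Tendsto (fun r : ℝ => K * √(r - x)) (𝓝[>] x) (𝓝 0) := by
    have := ((Real.continuous_sqrt.tendsto 0).comp hsub).const_mul K
    simpa using this
  refine squeeze_zero' (Eventually.of_forall fun _ => dist_nonneg) ?_ hsqrt
  have hev : ∀ᶠ r in 𝓝[>] x, r ∈ Set.Ioo x (m + 1) :=
    Ioo_mem_nhdsGT (by rw [hx]; linarith)
  filter_upwards [hev] with r hr
  have hδ : 0 < r - x := sub_pos.2 hr.1
  have hcoe : (((r - x).toNNReal : ℝ≥0) : ℝ) = r - x := Real.coe_toNNReal _ hδ.le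
  have hstep := hK u (r - x).toNNReal A (by
    rw [← NNReal.coe_lt_coe]
    push_cast
    rw [hcoe, hx]
    linarith [hr.2]) hA
  rw [hcoe, ← hx, add_sub_cancel] at hstep
  change |_ - G (r - x) - 1 / 2 * ((r - x) * sigmaOU m) * H (r - x)| ≤ _ at hstep
  have hG0 : ∫ ω in A, f (Y x i ω) ∂Q = G 0 := by
    simp only [G, mul_zero, neg_zero, Real.exp_zero, one_smul]
  rw [Real.dist_eq]
  have e : slope (fun r => ∫ ω in A, f (Y r i ω) ∂Q) x r -
      (slope G 0 (r - x) + 1 / 2 * sigmaOU m * H (r - x)) =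
      (r - x)⁻¹ * (∫ ω in A, f (Y r i ω) ∂Q - G (r - x) -
        1 / 2 * ((r - x) * sigmaOU m) * H (r - x)) := by
    rw [slope_def_field, slope_def_field, hG0, sub_zero]
    field_simp
    ring
  calc _ = |(r - x)⁻¹ * (∫ ω in A, f (Y r i ω) ∂Q - G (r - x) -
        1 / 2 * ((r - x) * sigmaOU m) * H (r - x))| := congrArg _ e
    _ ≤ (r - x)⁻¹ * (K * √(r - x) ^ 3) := by
      rw [abs_mul, abs_of_pos (inv_pos.2 hδ)]
      exact mul_le_mul_of_nonneg_left hstep (inv_pos.2 hδ).le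
    _ = K * √(r - x) := by
      rw [pow_succ, Real.sq_sqrt hδ.le]
      field_simp

/-- The particles of a branching Ornstein–Uhlenbeck process solve the martingale problem. -/
theorem IsBranchingOU.hasGeneratorOn (h : IsBranchingOU γ Y Q) (m : ℕ) {i : ℕ} (hi : i < 2 ^ m) :
    HasGeneratorOn (generatorOU (sigmaOU m) γ) Y i m (m + 1) Q := by
  obtain ⟨hY, W, hW, hind, hsde⟩ := h
  have hprob : IsProbabilityMeasure Q := (hW 0).gaussian.isProbabilityMeasure
  intro f hf hc s t hms hst htm
  obtain ⟨M₀, hM₀⟩ := hf.continuous.bounded_above_of_compact_support hc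
  obtain ⟨M, hM⟩ := exists_bound_generatorOU (sigmaOU m) γ hf hc
  have hgc := continuous_generatorOU (sigmaOU m) γ hf
  have hIcc : Set.Icc s t ⊆ Set.Ico (m : ℝ) (m + 1) := fun r hr =>
    ⟨hms.trans hr.1, hr.2.trans_lt htm⟩
  have hpath : ∀ᵐ ω ∂Q, ContinuousOn (fun r => Y r i ω) (Set.Icc s t) := by
    filter_upwards [hY.continuous] with ω hω using (hω m i hi).mono hIcc
  have hmeas : ∀ r ∈ Set.Icc s t, Measurable (Y r i) := fun r hr =>
    hY.measurable r ((Nat.cast_nonneg m).trans (hIcc hr).1) i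
      (by rwa [numParticles_of_mem_Ico (hIcc hr)])
  have hfi : ∀ r ∈ Set.Icc s t, Integrable (fun ω => f (Y r i ω)) Q := fun r hr =>
    Integrable.of_bound (hf.continuous.measurable.comp (hmeas r hr)).aestronglyMeasurable M₀
      (Eventually.of_forall fun ω => hM₀ _)
  have hgi : ∀ r ∈ Set.Icc s t, Integrable (fun ω => generatorOU (sigmaOU m) γ f (Y r i ω)) Q :=
    fun r hr => Integrable.of_bound (hgc.measurable.comp (hmeas r hr)).aestronglyMeasurable M
      (Eventually.of_forall fun ω => hM _)
  have hs : s ∈ Set.Icc s t := Set.left_mem_Icc.2 hst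
  have ht : t ∈ Set.Icc s t := Set.right_mem_Icc.2 hst
  have hFub : ∀ A : Set Ω, _ := fun A => integral_intervalIntegral_of_continuous
    (Q := Q.restrict A) (g := fun r ω => generatorOU (sigmaOU m) γ f (Y r i ω)) (M := M) hst
    (fun r hr => hgc.measurable.comp (hmeas r hr))
    (by
      filter_upwards [ae_restrict_of_ae hpath] with ω hω using hgc.comp_continuousOn hω)
    (fun r hr => (hgi r hr).restrict)
    (fun r hr => by
      have h1 : ∫ ω in A, ‖generatorOU (sigmaOU m) γ f (Y r i ω)‖ ∂Q ≤
          ∫ ω, ‖generatorOU (sigmaOU m) γ f (Y r i ω)‖ ∂Q :=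
        setIntegral_le_integral (hgi r hr).norm (Eventually.of_forall fun _ => norm_nonneg _)
      have h2 := integral_mono (hgi r hr).norm (integrable_const M) fun ω => hM _
      simpa using h1.trans h2)
  have hFu := (hFub Set.univ).1
  rw [Measure.restrict_univ] at hFu
  have hdiff : Integrable (fun ω => f (Y t i ω) - f (Y s i ω)) Q := (hfi t ht).sub (hfi s hs)
  refine ⟨hdiff.sub hFu, fun A hA => ?_⟩
  rw [integral_sub hdiff.restrict (hFub A).1, integral_sub (hfi t ht).restrict (hfi s hs).restrict,
    (hFub A).2, sub_eq_zero, eq_comm]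
  have hcont : ∀ {g : Space d → ℝ} {M : ℝ}, Continuous g → (∀ x, ‖g x‖ ≤ M) →
      ContinuousOn (fun r => ∫ ω in A, g (Y r i ω) ∂Q) (Set.Icc s t) := fun hg hM =>
    continuousOn_of_dominated
      (fun r hr => (hg.measurable.comp (hmeas r hr)).aestronglyMeasurable)
      (fun r _ => Eventually.of_forall fun ω => hM _) (integrable_const _)
      (by filter_upwards [ae_restrict_of_ae hpath] with ω hω using hg.comp_continuousOn hω)
  -- A right derivative is enough here, since the expectation of `f` over `A` is continuous in time
  -- and the derivative is integrable.
  refine intervalIntegral.integral_eq_sub_of_hasDeriv_right_of_le hst (hcont hf.continuous hM₀)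
    (fun r hr => ?_) ((hcont hgc hM).intervalIntegrable_of_Icc hst)
  have hs0 : 0 ≤ s - m := sub_nonneg.2 hms
  have hr0 : 0 ≤ r - m := hs0.trans (by linarith [hr.1])
  have hscoe : (((s - m).toNNReal : ℝ≥0) : ℝ) = s - m := Real.coe_toNNReal _ hs0
  have hrcoe : (((r - m).toNNReal : ℝ≥0) : ℝ) = r - m := Real.coe_toNNReal _ hr0
  have hs1 : (s - m).toNNReal < 1 := by
    rw [← NNReal.coe_lt_coe, hscoe, NNReal.coe_one]
    linarith
  have hr1 : (r - m).toNNReal < 1 := by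
    rw [← NNReal.coe_lt_coe, hrcoe, NNReal.coe_one]
    linarith [hr.2]
  -- An event of the history up to `s` belongs to the completed noise past at every later `r`, so
  -- `A` stays fixed along the whole interval.
  have hA' : MeasurableSet[aeCompletion (noisePast W m (r - m).toNNReal) Q] A := by
    refine aeCompletion_mono (noisePast_mono (Or.inr ⟨rfl, Real.toNNReal_le_toNNReal ?_⟩)) _
      (history_le_noisePast hY (fun m => (hW m).measurable)
        (ae_all_iff.2 fun m => (hW m).continuous) hsde hs1 A ?_)
    · linarith [hr.1]
    · rwa [hscoe, add_sub_cancel]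
  have := hasDerivWithinAt_setIntegral_ou hY hW hind hsde hf hc m ⟨i, hi⟩ hr1 hA'
  rwa [hrcoe, add_sub_cancel] at this

end Generator

/-! ### Countably generated path σ-algebras -/

section PathAlgebra

variable {Ω ι E : Type*} [MeasurableSpace E]

/-- The σ-algebra generated by a family of processes. -/
@[reducible] def pathAlgebra (U : ι → ℝ≥0 → Ω → E) : MeasurableSpace Ω :=
  MeasurableSpace.comap (fun ω (p : ι × ℝ≥0) => U p.1 p.2 ω) inferInstance

/-- The σ-algebra generated by a family of processes at the times of a dense sequence. -/
@[reducible] noncomputable def denseAlgebra (U : ι → ℝ≥0 → Ω → E) : MeasurableSpace Ω :=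
  MeasurableSpace.comap
    (fun ω (p : ι × ℕ) => U p.1 (TopologicalSpace.denseSeq ℝ≥0 p.2) ω) inferInstance

variable {U : ι → ℝ≥0 → Ω → E}

lemma measurable_pathAlgebra (a : ι) (t : ℝ≥0) : Measurable[pathAlgebra U] (U a t) :=
  measurable_comap_apply (fun ω (p : ι × ℝ≥0) => U p.1 p.2 ω) (a, t)

lemma measurable_denseAlgebra (a : ι) (n : ℕ) :
    Measurable[denseAlgebra U] (U a (TopologicalSpace.denseSeq ℝ≥0 n)) :=
  measurable_comap_apply
    (fun ω (p : ι × ℕ) => U p.1 (TopologicalSpace.denseSeq ℝ≥0 p.2) ω) (a, n)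

lemma pathAlgebra_le {m' : MeasurableSpace Ω} (hU : ∀ a t, Measurable[m'] (U a t)) :
    pathAlgebra U ≤ m' :=
  Measurable.comap_le (measurable_pi_lambda _ fun p => hU p.1 p.2)

lemma denseAlgebra_le {m' : MeasurableSpace Ω} (hU : ∀ a t, Measurable[m'] (U a t)) :
    denseAlgebra U ≤ m' :=
  Measurable.comap_le (measurable_pi_lambda _ fun p => hU p.1 _)

lemma countablyGenerated_denseAlgebra [Countable ι] [TopologicalSpace E]
    [SecondCountableTopology E] [BorelSpace E] :
    @MeasurableSpace.CountablyGenerated Ω (denseAlgebra U) :=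
  MeasurableSpace.CountablyGenerated.comap _

/-- A continuous process is determined by its values at the times of a dense sequence. -/
lemma pathAlgebra_le_aeCompletion [mΩ : MeasurableSpace Ω] {Q : Measure Ω} [TopologicalSpace E]
    [TopologicalSpace.IsCompletelyMetrizableSpace E]
    [SecondCountableTopology E] [Nonempty E] [BorelSpace E]
    (hU : ∀ a t, Measurable (U a t)) (hc : ∀ᵐ ω ∂Q, ∀ a, Continuous fun t => U a t ω) :
    pathAlgebra U ≤ aeCompletion (denseAlgebra U) Q := by
  refine pathAlgebra_le fun a t => ?_
  obtain ⟨x, hx, hxt⟩ := mem_closure_iff_seq_limit.1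
    (TopologicalSpace.denseRange_denseSeq ℝ≥0 t)
  choose n hn using hx
  refine measurable_aeCompletion_of_tendsto (f := fun k => U a (x k)) (fun k => ?_) (hU a t) ?_
  · rw [← hn k]
    exact (measurable_denseAlgebra a (n k)).mono (le_aeCompletion (denseAlgebra_le hU)) le_rfl
  · filter_upwards [hc] with ω hω
    exact ((hω a).tendsto t).comp hxt

end PathAlgebra

/-! ### Transfer of properties of the noise to another measure -/

section Transfer

variable {Ω : Type*} [mΩ : MeasurableSpace Ω] {P Q : Measure Ω} {d : ℕ}

lemma identDistrib_of_measure_eq {E : Type*} [MeasurableSpace E] {F : Ω → E} (hF : Measurable F)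
    (h : ∀ s, MeasurableSet[MeasurableSpace.comap F inferInstance] s → Q s = P s) :
    IdentDistrib F F Q P where
  aemeasurable_fst := hF.aemeasurable
  aemeasurable_snd := hF.aemeasurable
  map_eq := Measure.ext fun s hs => by
    rw [Measure.map_apply hF hs, Measure.map_apply hF hs, h _ ⟨s, hs, rfl⟩]

/-- Gaussianity, means and covariances depend only on the law on the product space. Path continuity
is not an event of the product σ-algebra and has to be assumed separately. -/
lemma IsCorrelatedBrownian.of_identDistrib {ι : Type*} {C : Matrix ι ι ℝ}
    {V : ι → ℝ≥0 → Ω → Space d} (hV : IsCorrelatedBrownian C V P)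
    (h : IdentDistrib (fun ω (p : ι × ℝ≥0) => V p.1 p.2 ω) (fun ω p => V p.1 p.2 ω) Q P)
    (hc : ∀ᵐ ω ∂Q, ∀ i, Continuous fun t => V i t ω) : IsCorrelatedBrownian C V Q where
  measurable := hV.measurable
  gaussian := ⟨fun I => ⟨by
    have hm : Measurable fun (x : ι × ℝ≥0 → Space d) =>
        I.restrict fun a : ℝ≥0 × ι × Fin d => x (a.2.1, a.1) a.2.2 :=
      measurable_pi_lambda _ fun a => (measurable_coord a.1.2.2).comp (measurable_pi_apply _)
    have h1 := (h.comp hm).map_eq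
    have h2 := (hV.gaussian.hasGaussianLaw I).isGaussian_map
    simp only [Function.comp_def] at h1
    rwa [← h1] at h2⟩⟩
  mean i t k := by
    have h1 := (h.comp (u := fun x : ι × ℝ≥0 → Space d => x (i, t) k)
      ((measurable_coord k).comp (measurable_pi_apply _))).integral_eq
    exact h1.trans (hV.mean i t k)
  covariance i j s t k l := by
    have h1 := (h.comp (u := fun x : ι × ℝ≥0 → Space d => x (i, s) k * x (j, t) l)
      (((measurable_coord k).comp (measurable_pi_apply (i, s))).mul
        ((measurable_coord l).comp (measurable_pi_apply (j, t))))).integral_eq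
    exact h1.trans (hV.covariance i j s t k l)
  continuous := hc

lemma iIndepFun.of_measure_eq {κ : Type*} {β : κ → Type*} {mβ : ∀ a, MeasurableSpace (β a)}
    {F : ∀ a, Ω → β a} (hF : iIndepFun F P) {m : MeasurableSpace Ω}
    (hm : ∀ a, Measurable[m] (F a)) (h : ∀ s, MeasurableSet[m] s → Q s = P s) :
    iIndepFun F Q := by
  rw [iIndepFun_iff_measure_inter_preimage_eq_mul] at hF ⊢
  intro S sets hs
  have hms : ∀ a ∈ S, MeasurableSet[m] (F a ⁻¹' sets a) := fun a ha => hm a (hs a ha)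
  rw [h _ (S.measurableSet_biInter hms), hF S hs]
  exact Finset.prod_congr rfl fun a ha => (h _ (hms a ha)).symm

end Transfer

/-! ### The processes as functions of their driving noises -/

section Adapted

variable {Ω : Type*} [mΩ : MeasurableSpace Ω] {Q : Measure Ω} {d : ℕ} {γ : ℝ}
  {W : (m : ℕ) → Fin (2 ^ m) → ℝ≥0 → Ω → Space d} {β : ℕ → ℝ≥0 → Ω → Space d}
  {Y Z : ℝ → ℕ → Ω → Space d}

lemma measurable_systemPath
    (hY : IsDyadicSystem Y Q) (hWm : ∀ m i τ, Measurable (W m i τ))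
    (hWc : ∀ᵐ ω ∂Q, ∀ m i, Continuous fun τ => W m i τ ω)
    (hs : ∀ᵐ ω ∂Q, ∀ (m : ℕ) (i : Fin (2 ^ m)) (τ : ℝ≥0), τ < 1 →
      Y (m + τ) i ω = Y m i ω + W m i τ ω - γ • ∫ s in (0 : ℝ)..τ, Y (m + s) i ω) :
    Measurable[aeCompletion (noiseAlgebra W) Q] (systemPath Y) := by
  refine @measurable_pi_lambda _ _ _ (_) _ _ fun t => @measurable_pi_lambda _ _ _ (_) _ _ fun i => ?_
  have hfl := mem_Ico_floor t.coe_nonneg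
  set n := ⌊(t : ℝ)⌋₊
  have hv : ((((t : ℝ) - n).toNNReal : ℝ≥0) : ℝ) = t - n :=
    Real.coe_toNNReal _ (by linarith [hfl.1])
  have hv1 : ((t : ℝ) - n).toNNReal < 1 := by
    rw [← NNReal.coe_lt_coe, hv, NNReal.coe_one]
    linarith [hfl.2]
  have h := measurable_ou_of_measurable_start hY hWm hWc hs
    (measurable_ou_start hY hWm hWc hs n) hv1 (i := i)
    (lt_of_lt_of_eq i.2 (numParticles_of_mem_Ico hfl))
  rw [hv, add_sub_cancel] at h
  exact h.mono (aeCompletion_mono (noisePast_le_noiseAlgebra _ _)) le_rfl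

lemma measurable_centerPath (hβ : ∀ m τ, Measurable (β m τ))
    (hZ : ∀ t : ℝ, 0 ≤ t → Measurable (centerOfMass Z t))
    (h1 : ∀ᵐ ω ∂Q, ∀ (m : ℕ) (τ : ℝ≥0), τ < 1 →
      centerOfMass Z (m + τ) ω = centerOfMass Z m ω + β m τ ω)
    (h2 : ∀ᵐ ω ∂Q, ∀ m : ℕ, centerOfMass Z m ω = ∑ k ∈ Finset.range m, β k 1 ω) :
    Measurable[aeCompletion (pathAlgebra β) Q] (centerPath Z) := by
  refine @measurable_pi_lambda _ _ _ (_) _ _ fun t => ?_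
  have hfl := mem_Ico_floor t.coe_nonneg
  set n := ⌊(t : ℝ)⌋₊
  have hv : ((((t : ℝ) - n).toNNReal : ℝ≥0) : ℝ) = t - n :=
    Real.coe_toNNReal _ (by linarith [hfl.1])
  have hv1 : ((t : ℝ) - n).toNNReal < 1 := by
    rw [← NNReal.coe_lt_coe, hv, NNReal.coe_one]
    linarith [hfl.2]
  have hm : ∀ k τ, Measurable[aeCompletion (pathAlgebra β) Q] (β k τ) := fun k τ =>
    (measurable_pathAlgebra k τ).mono (le_aeCompletion (pathAlgebra_le hβ)) le_rfl
  refine measurable_aeCompletion_of_ae_eq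
    (g := fun ω => ∑ k ∈ Finset.range n, β k 1 ω + β n ((t : ℝ) - n).toNNReal ω)
    (Measurable.add (Finset.measurable_fun_sum _ fun k _ => hm k 1) (hm _ _))
    (hZ t t.coe_nonneg) ?_
  filter_upwards [h1, h2] with ω e1 e2
  have := e1 n _ hv1
  rw [hv, add_sub_cancel, e2] at this
  exact this

/-- Independence of the two noises carries over to the processes which they drive. -/
lemma indepFun_systemPath_centerPath
    (hY : IsDyadicSystem Y Q) (hWm : ∀ m i τ, Measurable (W m i τ))
    (hWc : ∀ᵐ ω ∂Q, ∀ m i, Continuous fun τ => W m i τ ω)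
    (hs : ∀ᵐ ω ∂Q, ∀ (m : ℕ) (i : Fin (2 ^ m)) (τ : ℝ≥0), τ < 1 →
      Y (m + τ) i ω = Y m i ω + W m i τ ω - γ • ∫ s in (0 : ℝ)..τ, Y (m + s) i ω)
    (hind : Indep (noiseAlgebra W) (pathAlgebra β) Q) {E : Type*} [MeasurableSpace E] {F : Ω → E}
    (hF : Measurable[aeCompletion (pathAlgebra β) Q] F) :
    IndepFun (systemPath Y) F Q :=
  (IndepFun_iff_Indep _ _ _).2 (indep_of_indep_of_le (Indep.aeCompletion hind)
    (measurable_systemPath hY hWm hWc hs).comap_le hF.comap_le)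

end Adapted

/-! ### Conditioning on the limit of the center of mass -/

section Conditioning

variable {Ω : Type*} [mΩ : MeasurableSpace Ω] {P : Measure Ω} {d : ℕ} {γ : ℝ}
  {B : (m : ℕ) → Fin (2 ^ m) → ℝ≥0 → Ω → Space d} {Z : ℝ → ℕ → Ω → Space d}

lemma IsIndependentNoise.measurable_centeredNoise (hB : IsIndependentNoise B P) (m : ℕ)
    (i : Fin (2 ^ m)) (τ : ℝ≥0) : Measurable (centeredNoise B m i τ) :=
  hB.measurable_noiseComb _ _ _

lemma IsIndependentNoise.measurable_meanNoise (hB : IsIndependentNoise B P) (m : ℕ) (τ : ℝ≥0) :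
    Measurable (meanNoise B m τ) :=
  hB.measurable_noiseComb _ _ _

lemma IsIndependentNoise.indep_noiseAlgebra (hB : IsIndependentNoise B P) :
    Indep (noiseAlgebra (centeredNoise B)) (pathAlgebra (meanNoise B)) P :=
  (IndepFun_iff_Indep _ _ _).1 hB.indepFun_centeredNoise_meanNoise

lemma IsSelfInteractingBBM.measurable_centerPath (h : IsSelfInteractingBBM γ B Z P) :
    Measurable[aeCompletion (pathAlgebra (meanNoise B)) P] (centerPath Z) :=
  _root_.measurable_centerPath h.noise.measurable_meanNoise
    (fun _ ht => measurable_centerOfMass h.measurable ht) h.ae_centerOfMass_add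
    h.ae_centerOfMass_natCast

lemma IsSelfInteractingBBM.measurable_limit (h : IsSelfInteractingBBM γ B Z P) {N : Ω → Space d}
    (hN : Measurable N)
    (hlim : ∀ᵐ ω ∂P, Tendsto (fun t => centerOfMass Z t ω) atTop (𝓝 (N ω))) :
    Measurable[aeCompletion (pathAlgebra (meanNoise B)) P] N := by
  refine measurable_aeCompletion_of_tendsto (f := fun (n : ℕ) ω => centerPath Z ω n)
    (fun n => (measurable_pi_apply (n : ℝ≥0)).comp h.measurable_centerPath) hN ?_
  filter_upwards [hlim] with ω hω
  have := hω.comp (tendsto_natCast_atTop_atTop (R := ℝ))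
  simpa [centerPath, Function.comp_def] using this

lemma IsSelfInteractingBBM.indepFun_systemPath (h : IsSelfInteractingBBM γ B Z P)
    {N : Ω → Space d} (hN : Measurable N)
    (hlim : ∀ᵐ ω ∂P, Tendsto (fun t => centerOfMass Z t ω) atTop (𝓝 (N ω))) :
    IndepFun (systemPath (relativeSystem Z)) (fun ω => (centerPath Z ω, N ω)) P := by
  refine indepFun_systemPath_centerPath h.toIsDyadicSystem.relativeSystem
    h.noise.measurable_centeredNoise ?_ h.ae_relativeSystem_eq h.noise.indep_noiseAlgebra
    (h.measurable_centerPath.prodMk (h.measurable_limit hN hlim))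
  filter_upwards [h.noise.continuous] with ω hω m i using continuous_noiseComb (hω m)

/-- Conditioning on the limit of the center of mass does not change the joint law of the centred
noise, nor its independence of the average noise. -/
lemma IsSelfInteractingBBM.ae_indep_cond (h : IsSelfInteractingBBM γ B Z P)
    {N : Ω → Space d} (hN : Measurable N)
    (hlim : ∀ᵐ ω ∂P, Tendsto (fun t => centerOfMass Z t ω) atTop (𝓝 (N ω)))
    {κ : Kernel (Space d) Ω} (hκ : IsRegularCondProb N P κ) :
    ∀ᵐ x ∂(P.map N), Indep (noiseAlgebra (centeredNoise B)) (pathAlgebra (meanNoise B)) (κ x) ∧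
      ∀ s, MeasurableSet[aeCompletion (noiseAlgebra (centeredNoise B)) (κ x + P)] s →
        κ x s = P s := by
  have hprob : IsProbabilityMeasure P := h.noise.isProbabilityMeasure
  let U : (Σ m : ℕ, Fin (2 ^ m)) → ℝ≥0 → Ω → Space d := fun a => centeredNoise B a.1 a.2
  have hU : ∀ a t, Measurable (U a t) := fun a t => h.noise.measurable_centeredNoise a.1 a.2 t
  have hβ := h.noise.measurable_meanNoise
  have hUc : ∀ᵐ ω ∂P, ∀ a, Continuous fun t => U a t ω := by
    filter_upwards [h.noise.continuous] with ω hω a using continuous_noiseComb (hω a.1)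
  have hβc : ∀ᵐ ω ∂P, ∀ m, Continuous fun t => meanNoise B m t ω := by
    filter_upwards [h.noise.continuous] with ω hω m using continuous_noiseComb (hω m)
  -- Both the average noise and `N` lie in the completion of one σ-algebra independent of the
  -- centered noise, so they may be joined.
  have hind : Indep (denseAlgebra (meanNoise B) ⊔ MeasurableSpace.comap N inferInstance)
      (denseAlgebra U) P := by
    refine indep_of_indep_of_le (Indep.aeCompletion h.noise.indep_noiseAlgebra.symm)
      (sup_le ?_ (h.measurable_limit hN hlim).comap_le) ?_
    · exact (denseAlgebra_le fun a t => measurable_pathAlgebra a t).trans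
        (le_aeCompletion (pathAlgebra_le hβ))
    · exact (denseAlgebra_le fun a t => measurable_pathAlgebra a t).trans
        (le_aeCompletion (pathAlgebra_le hU))
  filter_upwards [hκ.ae_indep hN (denseAlgebra_le hβ) (denseAlgebra_le hU)
    countablyGenerated_denseAlgebra countablyGenerated_denseAlgebra hind,
    hκ.ae_ae hN hUc, hκ.ae_ae hN hβc] with x hx hxU hxβ
  refine ⟨indep_of_indep_of_le (Indep.aeCompletion hx.1.symm) (pathAlgebra_le_aeCompletion hU hxU)
    (pathAlgebra_le_aeCompletion hβ hxβ), fun s hs => ?_⟩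
  -- The path σ-algebra already lies in a completion of the countably generated one, so `s` lies in
  -- a completion of a completion.
  refine measure_eq_of_aeCompletion_add hx.2 (m := denseAlgebra U) (aeCompletion_idem _ ?_)
  exact aeCompletion_mono (pathAlgebra_le_aeCompletion hU (ae_add_measure_iff.2 ⟨hxU, hUc⟩)) _ hs

/-- The system seen from its center of mass, conditioned on the limit of the center of mass. -/
lemma IsSelfInteractingBBM.ae_cond (h : IsSelfInteractingBBM γ B Z P)
    {N : Ω → Space d} (hN : Measurable N)
    (hlim : ∀ᵐ ω ∂P, Tendsto (fun t => centerOfMass Z t ω) atTop (𝓝 (N ω)))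
    {κ : Kernel (Space d) Ω} (hκ : IsRegularCondProb N P κ) :
    ∀ᵐ x ∂(P.map N),
      IndepFun (centerPath Z) (systemPath (relativeSystem Z)) (κ x) ∧
      IdentDistrib (systemPath (relativeSystem Z)) (systemPath (relativeSystem Z)) (κ x) P ∧
      IsBranchingOU γ (relativeSystem Z) (κ x) := by
  have hprob : IsProbabilityMeasure P := h.noise.isProbabilityMeasure
  have hY := h.toIsDyadicSystem.relativeSystem
  have hWm := h.noise.measurable_centeredNoise
  have hWc : ∀ᵐ ω ∂P, ∀ m i, Continuous fun τ => centeredNoise B m i τ ω := by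
    filter_upwards [h.noise.continuous] with ω hω m i using continuous_noiseComb (hω m)
  filter_upwards [h.ae_indep_cond hN hlim hκ, hκ.ae_ae hN hY.start, hκ.ae_ae hN hY.continuous,
    hκ.ae_ae hN hY.fission, hκ.ae_ae hN h.ae_relativeSystem_eq, hκ.ae_ae hN hWc,
    hκ.ae_ae hN h.ae_centerOfMass_add, hκ.ae_ae hN h.ae_centerOfMass_natCast]
    with x ⟨hind, heq⟩ hst hc hf hs hWc' hadd hnat
  have hYx : IsDyadicSystem (relativeSystem Z) (κ x) := ⟨hY.measurable, hst, hc, hf⟩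
  -- Under the sum of the two measures `Y` is a function of the centered noise off a set null for
  -- both, which permits comparing its two laws.
  have hYρ : IsDyadicSystem (relativeSystem Z) (κ x + P) :=
    ⟨hY.measurable, ae_add_measure_iff.2 ⟨hst, hY.start⟩,
      ae_add_measure_iff.2 ⟨hc, hY.continuous⟩, ae_add_measure_iff.2 ⟨hf, hY.fission⟩⟩
  have hle : noiseAlgebra (centeredNoise B) ≤ aeCompletion (noiseAlgebra (centeredNoise B))
      (κ x + P) := le_aeCompletion (pathAlgebra_le
        (U := fun a : Σ m : ℕ, Fin (2 ^ m) => centeredNoise B a.1 a.2) fun a t => hWm a.1 a.2 t)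
  have hsys := measurable_systemPath hYρ hWm (ae_add_measure_iff.2 ⟨hWc', hWc⟩)
    (ae_add_measure_iff.2 ⟨hs, h.ae_relativeSystem_eq⟩)
  refine ⟨(indepFun_systemPath_centerPath hYx hWm hWc' hs hind
      (_root_.measurable_centerPath h.noise.measurable_meanNoise
        (fun _ ht => measurable_centerOfMass h.measurable ht) hadd hnat)).symm,
    identDistrib_of_measure_eq (hsys.mono aeCompletion_le le_rfl)
      fun s hs => heq s (hsys.comap_le _ hs), hYx, centeredNoise B, fun m => ?_, ?_, hs⟩
  · refine (h.noise.isCorrelatedBrownian_centeredNoise m).of_identDistrib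
      (identDistrib_of_measure_eq (measurable_pi_lambda _ fun p => hWm m p.1 p.2) fun s hs =>
        heq s (hle _ (pathAlgebra_le (U := centeredNoise B m)
          (fun i t => measurable_noiseAlgebra m i t) _ hs))) ?_
    filter_upwards [hWc'] with ω hω using hω m
  · exact iIndepFun.of_measure_eq h.noise.iIndepFun_centeredNoise (fun m =>
      @measurable_pi_lambda _ _ _ (_) _ _ fun i => @measurable_pi_lambda _ _ _ (_) _ _ fun τ =>
        measurable_noiseAlgebra m i τ) fun s hs => heq s (hle _ hs)

end Conditioning

/-! ### The main theorem -/

theorem theorem2 {Ω : Type*} [MeasurableSpace Ω] (P : Measure Ω) [IsProbabilityMeasure P]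
    (d : ℕ) (γ : ℝ) (hγ : γ ≠ 0)
    (B : (m : ℕ) → Fin (2 ^ m) → ℝ≥0 → Ω → Space d) (Z : ℝ → ℕ → Ω → Space d)
    (hZ : IsSelfInteractingBBM γ B Z P) :
    ∃ N : Ω → Space d, Measurable N ∧
      -- the center of mass converges almost surely to the normal vector `N`
      (∀ᵐ ω ∂P, Tendsto (fun t => centerOfMass Z t ω) atTop (𝓝 (N ω))) ∧
      HasLaw N (multivariateGaussian 0 ((2 : ℝ) • (1 : Matrix (Fin d) (Fin d) ℝ))) P ∧
      -- the process `Y = Z - Z̄` is independent of `N`, even jointly with the process `Z̄`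
      IndepFun (systemPath (relativeSystem Z)) N P ∧
      IndepFun (systemPath (relativeSystem Z)) (fun ω => (centerPath Z ω, N ω)) P ∧
      -- `Y` is the branching Ornstein–Uhlenbeck process
      IsBranchingOU γ (relativeSystem Z) P ∧
      (∀ m : ℕ, ∀ i < 2 ^ m,
        HasGeneratorOn (generatorOU (sigmaOU m) γ) (relativeSystem Z) i m (m + 1) P) ∧
      -- the generators converge to that of the Ornstein–Uhlenbeck process
      (∀ f : Space d → ℝ, ContDiff ℝ (⊤ : ℕ∞) f → HasCompactSupport f → ∀ y : Space d,
        Tendsto (fun m : ℕ => generatorOU (sigmaOU m) γ f y) atTop (𝓝 (generatorOU 1 γ f y))) ∧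
      -- conditionally on `N = x`, for almost all `x`
      ∀ κ : Kernel (Space d) Ω, IsRegularCondProb N P κ → ∀ᵐ x ∂(P.map N),
        (∀ᵐ ω ∂(κ x), Tendsto (fun t => centerOfMass Z t ω) atTop (𝓝 x)) ∧
        -- `Z = Z̄ ⊕ Y`, an independent sum
        (∀ (t : ℝ) (i : ℕ) (ω : Ω), Z t i ω = centerOfMass Z t ω + relativeSystem Z t i ω) ∧
        IndepFun (centerPath Z) (systemPath (relativeSystem Z)) (κ x) ∧
        -- `Y` has the same law as under `P`
        IdentDistrib (systemPath (relativeSystem Z)) (systemPath (relativeSystem Z)) (κ x) P ∧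
        -- `Y` is the branching Ornstein–Uhlenbeck process
        IsBranchingOU γ (relativeSystem Z) (κ x) ∧
        (∀ m : ℕ, ∀ i < 2 ^ m,
          HasGeneratorOn (generatorOU (sigmaOU m) γ) (relativeSystem Z) i m (m + 1) (κ x)) ∧
        -- `Z` is asymptotically `Y` with the origin shifted to `x`
        (∀ᵐ ω ∂(κ x), ∀ ε > 0, ∀ᶠ t in atTop, ∀ i < numParticles t,
          ‖Z t i ω - (x + relativeSystem Z t i ω)‖ < ε) := by
  obtain ⟨N, hN, hlim⟩ := hZ.exists_limit
  have hpair := hZ.indepFun_systemPath hN hlim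
  refine ⟨N, hN, hlim, hZ.hasLaw_limit hN hlim, hpair.comp measurable_id measurable_snd, hpair,
    hZ.isBranchingOU, fun m i hi => hZ.isBranchingOU.hasGeneratorOn m hi,
    fun f _ _ y => tendsto_generatorOU γ f y, fun κ hκ => ?_⟩
  filter_upwards [hZ.ae_cond hN hlim hκ, hκ.ae_ae hN hlim, hκ.ae_eq hN] with x ⟨hi, hd, hou⟩ hl hx
  have hlx : ∀ᵐ ω ∂(κ x), Tendsto (fun t => centerOfMass Z t ω) atTop (𝓝 x) := by
    filter_upwards [hl, hx] with ω h1 h2 using h2 ▸ h1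
  refine ⟨hlx, fun t i ω => by simp [relativeSystem], hi, hd, hou,
    fun m i hi => hou.hasGeneratorOn m hi, ?_⟩
  filter_upwards [hlx] with ω hω ε hε
  filter_upwards [Metric.tendsto_nhds.1 hω ε hε] with t ht i _
  rw [dist_eq_norm] at ht
  -- The difference does not depend on the particle, so convergence of the center is uniform over
  -- the generation.
  have e : Z t i ω - (x + relativeSystem Z t i ω) = centerOfMass Z t ω - x := by
    rw [relativeSystem]
    abel
  rwa [e]
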